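/- **Setting.** Let $X,Z$ be random vectors in $\mathbb R^d$ on a common probability space, with supports $\mathcal Z\subset\mathcal X\subset\mathbb R^d$, let $m\ge1$ and let $\phi:\mathcal X\to\mathbb R^m$ be measurable. Assume that the laws $\nu_0$ of $\phi(X)$ and $\nu_1$ of $\phi(Z)$ have Lebesgue densities $f_0,f_1\ge 0$ on $\mathbb R^m$ and that $\nu_1\ll\nu_0$; put $r=f_1/f_0$ (with $0/0=0$). Let $X_1,X_2,\dots$ be copies of $X$ and $Z_1,Z_2,\dots$ copies of $Z$, all mutually independent. The sample sizes are $N_0$ and $N_1=N_1(N_0)$, the number of matches is $M=M(N_0)$, and all limits are as $N_0\to\infty$. For $x\in\mathcal X$ let $\hat\phi$ be an estimator of $\phi$ which may depend (measurably) on $X_1,\dots,X_{N_0},Z_1,\dots,Z_{N_1}$, and also on $x$. Let $\hat\Phi_M(z)$ be the $M$-th order statistic of $\{\|\hat\phi(X_i)-\hat\phi(z)\|\}_{i=1}^{N_0}$ and set $$A_\phi(x)=\{z\in\mathcal Z:\|\hat\phi(x)-\hat\phi(z)\|\le\hat\Phi_M(z)\},\quad K_\phi(x)=\sum_{j=1}^{N_1}\mathbf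 1(Z_j\in A_\phi(x)),\quad \hat r_\phi(x)=\frac{N_0}{N_1}\frac{K_\phi(x)}{M}.$$ For a positive integer $p$ and $z\in\mathcal Z^p$ let $\hat\phi_{(Z_1,\dots,Z_p)\to z}$ be the estimator computed with $(Z_1,\dots,Z_p)$ replaced by $z$, and let $\|\cdot\|_\infty$ be the supremum over $\mathcal X$ of the Euclidean norm. Consider the following two conditions. (A) For some integer $1\le q\le m$, $$\lim_{N_0\to\infty}\mathrm E\Big[\Big(\frac{N_0}{M}\Big)^p\sup_{z\in\mathcal Z^p}\|\hat\phi_{(Z_1,\dots,Z_p)\to z}-\phi\|_\infty^{pq}\Big]=0.$$ (B) For every $\epsilon>0$ there are functions $T_\epsilon=T_{\epsilon,N_0}:(0,\infty)\to[0,\infty]$ such that, for all $N_0$ and all $u>0$, $$\mathrm P\Big(\sup_{\delta\ge u}\delta^{-1}\sup_{s,t\in\mathcal X:\|\phi(s)-\phi(t)\|\le\delta}\ \sup_{z\in\mathcal Z^p}\big\|(\hat\phi_{(Z_1,\dots,Z_p)\to z}-\phi)(s)-(\hat\phi_{(Z_1,\dots,Z_p)\to z}-\phi)(t)\big\|>\epsilon\Big)\le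 T_{\epsilon}(u),$$ for every $k\in\{1,\dots,p\}$, $\lim_{N_0\to\infty}(N_0/M)^k\int_0^\infty u^{k-1}T_\epsilon(u^{1/m})\,du=0$, and $\lim_{N_0\to\infty}(N_0/M)^p\,\mathrm P(\|\hat\phi-\phi\|_\infty>\epsilon)=0$. **Corollary (pointwise consistency).** Let $p$ be an even positive integer and assume that $M\log N_0/N_0\to0$, $MN_1/N_0\to\infty$ and $M\to\infty$ as $N_0\to\infty$. Then for every $x\in\mathcal X$ for which (A) or (B) holds, $f_0(\phi(x))>0$, and $f_0,f_1$ are continuous at $\phi(x)$ (as functions on $\mathbb R^m$), the random variable $|\hat r_\phi(x)-r(\phi(x))|^p$ is integrable for every $N_0$ and $$\lim_{N_0\to\infty}\mathrm E\big[|\hat r_\phi(x)-r(\phi(x))|^p\big]=0 .$$ -/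

import Mathlib

open MeasureTheory ProbabilityTheory Filter Topology
open scoped ENNReal

noncomputable section

namespace DensityRatio

/-- `ℝᵈ` with the Euclidean norm. -/
abbrev E (d : ℕ) : Type := EuclideanSpace ℝ (Fin d)

/-- The `M`-th order statistic (the `M`-th smallest value, `1 ≤ M ≤ n`) of `a 0, …, a (n - 1)`;
the value outside of `1 ≤ M ≤ n` is irrelevant. -/
def orderStat {n : ℕ} (M : ℕ) (a : Fin n → ℝ) : ℝ :=
  if h : M - 1 < n then a (Tuple.sort a ⟨M - 1, h⟩) else 0

/-- The catchment area of `x`: the points `z` of `𝒵` such that `‖g x - g z‖` is at most the `M`-th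
order statistic of `‖g X₁ - g z‖, …, ‖g Xₙ - g z‖`. Here `g` is the (estimated) transformation. -/
def catchment {d m n : ℕ} (𝒵 : Set (E d)) (M : ℕ) (xs : Fin n → E d) (g : E d → E m) (x : E d) :
    Set (E d) :=
  {z ∈ 𝒵 | ‖g x - g z‖ ≤ orderStat M (fun i => ‖g (xs i) - g z‖)}

/-- The number of matched times of `x`: the number of the `Z_j` in the catchment area of `x`. -/
def matchCount {d m n k : ℕ} (𝒵 : Set (E d)) (M : ℕ) (xs : Fin n → E d) (zs : Fin k → E d)
    (g : E d → E m) (x : E d) : ℝ :=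
  ∑ j, (catchment 𝒵 M xs g x).indicator (fun _ => (1 : ℝ)) (zs j)

/-- The density ratio estimator `(N₀ / N₁) * (K(x) / M)` for the transformation `g`. -/
def ratioEstimate {d m n k : ℕ} (𝒵 : Set (E d)) (M : ℕ) (xs : Fin n → E d) (zs : Fin k → E d)
    (g : E d → E m) (x : E d) : ℝ :=
  ((n : ℝ) / (k : ℝ)) * (matchCount 𝒵 M xs zs g x / (M : ℝ))

/-- An estimator of a transformation `ℝᵈ → ℝᵐ` from the samples `X₁, …, X_n`, `Z₁, …, Z_k`
and the evaluation point `x`. -/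
abbrev TransformEstimator (d m n k : ℕ) : Type :=
  (Fin n → E d) → (Fin k → E d) → E d → E d → E m

/-- The sample `zs` with its first `p` members replaced by `z`. -/
def replaceFirst {d k : ℕ} (p : ℕ) (zs : Fin k → E d) (z : Fin p → E d) : Fin k → E d :=
  fun j => if h : (j : ℕ) < p then z ⟨j, h⟩ else zs j

/-- The sup norm of `g - φ` over `𝒳`, as an extended nonnegative number. -/
def supDist {d m : ℕ} (𝒳 : Set (E d)) (g φ : E d → E m) : ℝ≥0∞ :=
  ⨆ t ∈ 𝒳, ‖g t - φ t‖ₑ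

/-- `sup_{z ∈ 𝒵ᵖ} ‖φ̂_{(Z₁,…,Z_p) → z} - φ‖_∞ ^ r`. -/
def replacedSupPow {d m n k : ℕ} (𝒳 𝒵 : Set (E d)) (φ : E d → E m)
    (φhat : TransformEstimator d m n k) (x : E d) (p r : ℕ)
    (xs : Fin n → E d) (zs : Fin k → E d) : ℝ≥0∞ :=
  ⨆ z ∈ {z : Fin p → E d | ∀ i, z i ∈ 𝒵},
    supDist 𝒳 (φhat xs (replaceFirst p zs z) x) φ ^ r

/-- `sup_{δ ≥ u} δ⁻¹ sup_{s, t ∈ 𝒳, ‖φ s - φ t‖ ≤ δ} sup_{z ∈ 𝒵ᵖ}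
‖(φ̂_{(Z₁,…,Z_p) → z} - φ)(s) - (φ̂_{(Z₁,…,Z_p) → z} - φ)(t)‖`. -/
def replacedModulus {d m n k : ℕ} (𝒳 𝒵 : Set (E d)) (φ : E d → E m)
    (φhat : TransformEstimator d m n k) (x : E d) (p : ℕ) (u : ℝ)
    (xs : Fin n → E d) (zs : Fin k → E d) : ℝ≥0∞ :=
  ⨆ (δ : ℝ) (_ : u ≤ δ), ENNReal.ofReal δ⁻¹ *
    ⨆ (s ∈ 𝒳) (t ∈ 𝒳) (_ : ‖φ s - φ t‖ ≤ δ) (z ∈ {z : Fin p → E d | ∀ i, z i ∈ 𝒵}),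
      ‖(φhat xs (replaceFirst p zs z) x s - φ s) - (φhat xs (replaceFirst p zs z) x t - φ t)‖ₑ

section Sampling

variable {Ω : Type*} [MeasurableSpace Ω]

/-- The sample `(X₁, …, X_N), (Z₁, …, Z_k)`. -/
def sample {d : ℕ} (X Z : ℕ → Ω → E d) (N k : ℕ) (ω : Ω) : (Fin N → E d) × (Fin k → E d) :=
  (fun i => X i ω, fun j => Z j ω)

/-- The sup-norm approximation condition for the estimators `φ̂_N` used at the point `x`:
`E[(N₀/M)ᵖ sup_{z ∈ 𝒵ᵖ} ‖φ̂_{(Z₁,…,Z_p) → z} - φ‖_∞ ^ (p q)] → 0` for some `q ∈ {1, …, m}`.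
The first clause says that the random variable under the expectation is measurable with
respect to the completed law of the sample. -/
def SupNormCondition {d m : ℕ} (P : Measure Ω) (X Z : ℕ → Ω → E d) (M N₁ : ℕ → ℕ)
    (𝒳 𝒵 : Set (E d)) (φ : E d → E m) (φhat : ∀ N : ℕ, TransformEstimator d m N (N₁ N))
    (p : ℕ) (x : E d) : Prop :=
  ∃ q : ℕ, 1 ≤ q ∧ q ≤ m ∧
    (∀ N, AEMeasurable
      (fun s : (Fin N → E d) × (Fin (N₁ N) → E d) =>
        replacedSupPow 𝒳 𝒵 φ (φhat N) x p (p * q) s.1 s.2)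
      (P.map (sample X Z N (N₁ N)))) ∧
    Tendsto (fun N : ℕ => ∫⁻ ω, ((N : ℝ≥0∞) / (M N : ℝ≥0∞)) ^ p *
        replacedSupPow 𝒳 𝒵 φ (φhat N) x p (p * q)
          (sample X Z N (N₁ N) ω).1 (sample X Z N (N₁ N) ω).2 ∂P)
      atTop (𝓝 0)

/-- The modulus-of-continuity approximation condition for the estimators `φ̂_N` used at the
point `x`. The bound `T` may depend on `ε` and on the sample size. The first clause says that the
random variables whose probabilities are taken are measurable with respect to the completed law
of the sample. -/
def ModulusCondition {d m : ℕ} (P : Measure Ω) (X Z : ℕ → Ω → E d) (M N₁ : ℕ → ℕ)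
    (𝒳 𝒵 : Set (E d)) (φ : E d → E m) (φhat : ∀ N : ℕ, TransformEstimator d m N (N₁ N))
    (p : ℕ) (x : E d) : Prop :=
  (∀ N, (∀ u : ℝ, 0 < u → AEMeasurable
        (fun s : (Fin N → E d) × (Fin (N₁ N) → E d) =>
          replacedModulus 𝒳 𝒵 φ (φhat N) x p u s.1 s.2)
        (P.map (sample X Z N (N₁ N)))) ∧
      AEMeasurable
        (fun s : (Fin N → E d) × (Fin (N₁ N) → E d) => supDist 𝒳 (φhat N s.1 s.2 x) φ)
        (P.map (sample X Z N (N₁ N)))) ∧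
  ∀ ε : ℝ, 0 < ε → ∃ T : ℕ → ℝ → ℝ≥0∞,
    (∀ N : ℕ, ∀ u : ℝ, 0 < u →
      P {ω | ENNReal.ofReal ε < replacedModulus 𝒳 𝒵 φ (φhat N) x p u
        (sample X Z N (N₁ N) ω).1 (sample X Z N (N₁ N) ω).2} ≤ T N u) ∧
    (∀ k : ℕ, 1 ≤ k → k ≤ p →
      Tendsto (fun N : ℕ => ((N : ℝ≥0∞) / (M N : ℝ≥0∞)) ^ k *
          ∫⁻ u in Set.Ioi (0 : ℝ), ENNReal.ofReal (u ^ (k - 1)) * T N (u ^ (1 / (m : ℝ))))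
        atTop (𝓝 0)) ∧
    Tendsto (fun N : ℕ => ((N : ℝ≥0∞) / (M N : ℝ≥0∞)) ^ p *
        P {ω | ENNReal.ofReal ε < supDist 𝒳
          (φhat N (sample X Z N (N₁ N) ω).1 (sample X Z N (N₁ N) ω).2 x) φ})
      atTop (𝓝 0)

end Sampling

end DensityRatio

end

/-! Write κ = f₀(φ(x)), r = f₁(φ(x))/κ and V for the volume of the unit ball, and let ρ solve N κ
ρ^m V = M, so that a ball of radius ρ near φ(x) is expected to hold about M of the φ(X_i). A point z
of 𝒵 is in the catchment area exactly when fewer than M of the X_i are strictly closer to z than x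
is, distances being measured after φ̂. If φ̂ is close to φ, this happens essentially when ‖φ(z) −
φ(x)‖ is below ρ. Hence, for any s > 1 and up to exceptional points, the matched Z_j include those
with φ(Z_j) in the ball of radius ρ/s⁴ around φ(x) and are among those with φ(Z_j) in the ball of
radius s⁴ρ. By continuity of f₁ a ball of radius aρ holds about N₁ (M/N) r a^m of the φ(Z_j), so the
two scaled counts concentrate at r s^{−4m} and r s^{4m}; letting s decrease to 1 gives the result.

The difficulty is that φ̂ may depend on the Z_j. The comparison is therefore made pathwise
(`matchCount_le`, `hits_closedBall_le`), with exceptional sets of two kinds. The sets `farSet` and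
`nearSet` depend on the φ(X_i) alone: given these, the numbers of φ(Z_j) in them are binomial.
Chernoff bounds at each fixed point, combined with Minkowski's inequality
`lintegral_measure_section_pow_le`, make their scaled p-th moments vanish as M → ∞. The set
`errorAnnulus` has a radius proportional to a random scale D, above which increments of φ̂ − φ are
relatively small. As D may depend on the Z_j, `hits_errorAnnulus_le` compares with dyadic balls: the
count is at most a multiple of N₁ D^m plus an excess, and the moments of the excesses are summable
over the dyadic scales.

All that is needed of φ̂ is `ErrorControl`: (N/M)^p E[D^{mp}] → 0, and (N/M)^p P(S > e) → 0 for a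
bound S of the sup-norm error. The latter suffices because the estimate never exceeds N/M. Under
(A), D is a multiple of a root of the random variable in the condition; under (B), D is the first
scale at which the modulus is at most ε, and the layer-cake formula bounds its moment. -/

namespace DensityRatio

/-! ### Exponential and polynomial moments of binomial counts, Chernoff bounds -/

section Binomial

variable {α : Type*}

/-- The number of coordinates of `y` that lie in `G`. -/
noncomputable def hits {k : ℕ} (G : Set α) (y : Fin k → α) : ℝ :=
  ∑ j, G.indicator (fun _ => (1 : ℝ)) (y j)

lemma hits_nonneg {k : ℕ} (G : Set α) (y : Fin k → α) : 0 ≤ hits G y :=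
  Finset.sum_nonneg fun _ _ => Set.indicator_nonneg (fun _ _ => zero_le_one) _

lemma hits_le {k : ℕ} (G : Set α) (y : Fin k → α) : hits G y ≤ k := by
  have : hits G y ≤ ∑ _j : Fin k, (1 : ℝ) :=
    Finset.sum_le_sum fun _ _ => Set.indicator_le_self' (fun _ _ => zero_le_one) _
  simpa using this

lemma hits_mono {k : ℕ} {G H : Set α} (h : G ⊆ H) (y : Fin k → α) : hits G y ≤ hits H y :=
  Finset.sum_le_sum fun _ _ => Set.indicator_le_indicator_of_subset h (fun _ => zero_le_one) _

lemma hits_union_le {k : ℕ} (G H : Set α) (y : Fin k → α) :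
    hits (G ∪ H) y ≤ hits G y + hits H y := by
  unfold hits
  rw [← Finset.sum_add_distrib]
  refine Finset.sum_le_sum fun j _ => ?_
  by_cases h1 : y j ∈ G <;> by_cases h2 : y j ∈ H <;> simp [h1, h2]

variable [MeasurableSpace α]

lemma measurable_hits {k : ℕ} {G : Set α} (hG : MeasurableSet G) :
    Measurable (fun y : Fin k → α => hits G y) :=
  Finset.measurable_sum _ fun j _ =>
    (measurable_const.indicator hG).comp (measurable_pi_apply j)

variable (ν : Measure α) [IsProbabilityMeasure ν]

/-- By independence the moment generating function is the k-th power of 1 + ν(G)(e^s − 1), and 1 + a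
≤ e^a. Every moment and tail bound for counts below is drawn from this one. -/
lemma lintegral_exp_hits_le (k : ℕ) {G : Set α} (hG : MeasurableSet G) (s : ℝ) :
    ∫⁻ y : Fin k → α, ENNReal.ofReal (Real.exp (s * hits G y)) ∂(Measure.pi fun _ => ν)
      ≤ ENNReal.ofReal (Real.exp (k * ν.real G * (Real.exp s - 1))) := by
  have hpt : ∀ a : α, Real.exp (s * G.indicator (fun _ => (1 : ℝ)) a)
      = 1 + G.indicator (fun _ => Real.exp s - 1) a := by
    intro a
    by_cases h : a ∈ G <;> simp [h]
  have hbdd : ∀ y : Fin k → α, ‖Real.exp (s * hits G y)‖ ≤ Real.exp (|s| * k) := by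
    intro y
    rw [Real.norm_of_nonneg (Real.exp_pos _).le]
    refine Real.exp_le_exp.2 ?_
    calc s * hits G y ≤ |s| * hits G y :=
          mul_le_mul_of_nonneg_right (le_abs_self s) (hits_nonneg G y)
      _ ≤ |s| * k := mul_le_mul_of_nonneg_left (hits_le G y) (abs_nonneg s)
  have hint : Integrable (fun y : Fin k → α => Real.exp (s * hits G y))
      (Measure.pi fun _ => ν) :=
    Integrable.of_bound
      ((Real.measurable_exp.comp ((measurable_hits hG).const_mul s)).aestronglyMeasurable)
      _ (Eventually.of_forall hbdd)
  rw [← ofReal_integral_eq_lintegral_ofReal hint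
    (Eventually.of_forall fun _ => (Real.exp_pos _).le)]
  refine ENNReal.ofReal_le_ofReal ?_
  have h1 : ∀ y : Fin k → α, Real.exp (s * hits G y)
      = ∏ j, (1 + G.indicator (fun _ => Real.exp s - 1) (y j)) := by
    intro y
    unfold hits
    rw [Finset.mul_sum, Real.exp_sum]
    exact Finset.prod_congr rfl fun j _ => hpt _
  simp_rw [h1]
  rw [integral_fintype_prod_eq_pow (fun a => 1 + G.indicator (fun _ => Real.exp s - 1) a),
    integral_add (integrable_const _) ((integrable_const _).indicator hG),
    integral_indicator_const _ hG, integral_const, Fintype.card_fin]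
  simp only [probReal_univ, smul_eq_mul, one_mul]
  have h2 : 1 + ν.real G * (Real.exp s - 1) ≤ Real.exp (ν.real G * (Real.exp s - 1)) := by
    linarith [Real.add_one_le_exp (ν.real G * (Real.exp s - 1))]
  have h3 : 0 ≤ 1 + ν.real G * (Real.exp s - 1) := by
    have : ν.real G ≤ 1 := measureReal_le_one
    nlinarith [measureReal_nonneg (μ := ν) (s := G), Real.exp_pos s]
  calc _ ≤ Real.exp (ν.real G * (Real.exp s - 1)) ^ k := pow_le_pow_left₀ h3 h2 k
    _ = _ := by rw [← Real.exp_nat_mul]; ring_nf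

/-- One term of the exponential series at s x. The free parameter s is tuned to the size of the mean
in each use. -/
lemma pow_le_factorial_mul_exp {x s : ℝ} (hx : 0 ≤ x) (hs : 0 < s) (p : ℕ) :
    x ^ p ≤ p.factorial * s⁻¹ ^ p * Real.exp (s * x) := by
  have h := Real.pow_div_factorial_le_exp (s * x) (mul_nonneg hs.le hx) p
  rw [div_le_iff₀ (by positivity), mul_pow] at h
  have : x ^ p = s⁻¹ ^ p * (s ^ p * x ^ p) := by
    rw [← mul_assoc, ← mul_pow, inv_mul_cancel₀ hs.ne', one_pow, one_mul]
  rw [this]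
  calc s⁻¹ ^ p * (s ^ p * x ^ p) ≤ s⁻¹ ^ p * (Real.exp (s * x) * p.factorial) := by gcongr
    _ = _ := by ring

lemma exp_sub_one_sub_le_sq {s : ℝ} (hs : |s| ≤ 1) : Real.exp s - 1 - s ≤ s ^ 2 :=
  (le_abs_self _).trans (Real.abs_exp_sub_one_sub_id_le hs)

/-- The moments of a binomial random variable. -/
lemma lintegral_hits_pow_le (k : ℕ) {G : Set α} (hG : MeasurableSet G) (p : ℕ) :
    ∫⁻ y : Fin k → α, ENNReal.ofReal (hits G y ^ p) ∂(Measure.pi fun _ => ν)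
      ≤ ENNReal.ofReal (p.factorial * Real.exp 2 * (1 + k * ν.real G) ^ p) := by
  set q := (k : ℝ) * ν.real G with hq
  have hq0 : 0 ≤ q := by positivity
  -- This choice keeps q(e^s − 1) ≤ 2 while s⁻ᵖ = (1 + q)^p has the desired order.
  set s := (1 + q)⁻¹ with hs
  have hs0 : 0 < s := by positivity
  have hs1 : s ≤ 1 := inv_le_one_of_one_le₀ (by linarith)
  have hsq : q * s ≤ 1 := by
    rw [hs, ← div_eq_mul_inv, div_le_one (by positivity)]; linarith
  calc _ ≤ ∫⁻ y : Fin k → α, ENNReal.ofReal (p.factorial * s⁻¹ ^ p) *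
          ENNReal.ofReal (Real.exp (s * hits G y)) ∂(Measure.pi fun _ => ν) := by
        refine lintegral_mono fun y => ?_
        rw [← ENNReal.ofReal_mul (by positivity)]
        exact ENNReal.ofReal_le_ofReal (pow_le_factorial_mul_exp (hits_nonneg G y) hs0 p)
    _ ≤ ENNReal.ofReal (p.factorial * s⁻¹ ^ p) *
          ENNReal.ofReal (Real.exp (q * (Real.exp s - 1))) := by
        rw [lintegral_const_mul' _ _ ENNReal.ofReal_ne_top]
        gcongr
        exact lintegral_exp_hits_le ν k hG s
    _ ≤ _ := by
        rw [← ENNReal.ofReal_mul (by positivity)]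
        refine ENNReal.ofReal_le_ofReal ?_
        have h1 : Real.exp s - 1 ≤ 2 * s := by
          have := exp_sub_one_sub_le_sq (s := s) (by rw [abs_of_pos hs0]; exact hs1)
          nlinarith
        have h2 : q * (Real.exp s - 1) ≤ 2 := by nlinarith
        have h3 : s⁻¹ = 1 + q := by rw [hs, inv_inv]
        rw [h3]
        calc p.factorial * (1 + q) ^ p * Real.exp (q * (Real.exp s - 1))
            ≤ p.factorial * (1 + q) ^ p * Real.exp 2 := by gcongr
          _ = _ := by ring

/-- The even central moments of a binomial random variable. -/
lemma lintegral_hits_central_pow_le (k : ℕ) {G : Set α} (hG : MeasurableSet G) (h : ℕ) :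
    ∫⁻ y : Fin k → α, ENNReal.ofReal (|hits G y - k * ν.real G| ^ (2 * h))
        ∂(Measure.pi fun _ => ν)
      ≤ ENNReal.ofReal (2 * (2 * h).factorial * Real.exp 1 * (1 + k * ν.real G) ^ h) := by
  set q := (k : ℝ) * ν.real G with hq
  have hq0 : 0 ≤ q := by positivity
  -- The square root reflects the standard deviation: after centring only the quadratic part of the
  -- exponent remains, and q s² ≤ 1.
  set s := (√(1 + q))⁻¹ with hs
  have hs0 : 0 < s := by positivity
  have hss : s ^ 2 = (1 + q)⁻¹ := by rw [hs, inv_pow, Real.sq_sqrt (by positivity)]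
  have hs1 : s ≤ 1 := inv_le_one_of_one_le₀ (Real.one_le_sqrt.2 (by linarith))
  have hsq : q * s ^ 2 ≤ 1 := by
    rw [hss, ← div_eq_mul_inv, div_le_one (by positivity)]; linarith
  have key : ∀ t : ℝ, |t| = s →
      ∫⁻ y : Fin k → α, ENNReal.ofReal (Real.exp (t * (hits G y - q))) ∂(Measure.pi fun _ => ν)
        ≤ ENNReal.ofReal (Real.exp 1) := by
    intro t ht
    have h1 : ∀ y : Fin k → α, ENNReal.ofReal (Real.exp (t * (hits G y - q)))
        = ENNReal.ofReal (Real.exp (-(t * q))) * ENNReal.ofReal (Real.exp (t * hits G y)) := by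
      intro y
      rw [← ENNReal.ofReal_mul (Real.exp_pos _).le, ← Real.exp_add]
      ring_nf
    simp_rw [h1]
    rw [lintegral_const_mul' _ _ ENNReal.ofReal_ne_top]
    calc _ ≤ ENNReal.ofReal (Real.exp (-(t * q))) *
          ENNReal.ofReal (Real.exp (q * (Real.exp t - 1))) := by
          gcongr
          exact lintegral_exp_hits_le ν k hG t
      _ ≤ _ := by
          rw [← ENNReal.ofReal_mul (Real.exp_pos _).le, ← Real.exp_add]
          refine ENNReal.ofReal_le_ofReal (Real.exp_le_exp.2 ?_)
          have h2 := exp_sub_one_sub_le_sq (s := t) (by rw [ht]; exact hs1)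
          have h3 : t ^ 2 = s ^ 2 := by rw [← sq_abs, ht]
          rw [h3] at h2
          nlinarith
  calc _ ≤ ∫⁻ y : Fin k → α, ENNReal.ofReal ((2 * h).factorial * s⁻¹ ^ (2 * h)) *
          (ENNReal.ofReal (Real.exp (s * (hits G y - q))) +
            ENNReal.ofReal (Real.exp ((-s) * (hits G y - q)))) ∂(Measure.pi fun _ => ν) := by
        refine lintegral_mono fun y => ?_
        rw [← ENNReal.ofReal_add (Real.exp_pos _).le (Real.exp_pos _).le,
          ← ENNReal.ofReal_mul (by positivity)]
        refine ENNReal.ofReal_le_ofReal ?_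
        refine (pow_le_factorial_mul_exp (abs_nonneg _) hs0 _).trans ?_
        gcongr
        rcases abs_cases (hits G y - q) with ⟨h', -⟩ | ⟨h', -⟩ <;> rw [h']
        · linarith [Real.exp_pos (-s * (hits G y - q))]
        · rw [mul_neg, ← neg_mul]
          linarith [Real.exp_pos (s * (hits G y - q))]
    _ ≤ ENNReal.ofReal ((2 * h).factorial * s⁻¹ ^ (2 * h)) *
          (ENNReal.ofReal (Real.exp 1) + ENNReal.ofReal (Real.exp 1)) := by
        rw [lintegral_const_mul' _ _ ENNReal.ofReal_ne_top]
        gcongr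
        rw [lintegral_add_left]
        · exact add_le_add (key s (abs_of_pos hs0)) (key (-s) (by rw [abs_neg, abs_of_pos hs0]))
        · exact (Real.measurable_exp.comp
            (((measurable_hits hG).sub_const q).const_mul s)).ennreal_ofReal
    _ ≤ _ := by
        rw [← ENNReal.ofReal_add (Real.exp_pos _).le (Real.exp_pos _).le,
          ← ENNReal.ofReal_mul (by positivity)]
        refine ENNReal.ofReal_le_ofReal (le_of_eq ?_)
        rw [pow_mul, inv_pow, hss, inv_inv]
        ring

/-- The moments of the excess of a binomial random variable over twice a bound of its mean. -/
lemma lintegral_hits_excess_pow_le (k : ℕ) {G : Set α} (hG : MeasurableSet G) {p : ℕ}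
    (hp : p ≠ 0) {μ : ℝ} (hμ : k * ν.real G ≤ μ) :
    ∫⁻ y : Fin k → α, ENNReal.ofReal (hits G y - 2 * μ) ^ p ∂(Measure.pi fun _ => ν)
      ≤ ENNReal.ofReal (p.factorial * Real.exp (-(μ / 4))) := by
  have hq0 : 0 ≤ (k : ℝ) * ν.real G := by positivity
  -- With tilt 1 the exponent is at most −2μ + μ(e − 1) = μ(e − 3), and e < 2.75 makes this at most
  -- −μ/4.
  have he : Real.exp 1 < 2.75 := by linarith [Real.exp_one_lt_d9]
  have he' : 1 < Real.exp 1 := Real.one_lt_exp_iff.2 one_pos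
  calc _ ≤ ∫⁻ y : Fin k → α, ENNReal.ofReal (p.factorial * Real.exp (-(2 * μ))) *
          ENNReal.ofReal (Real.exp (1 * hits G y)) ∂(Measure.pi fun _ => ν) := by
        refine lintegral_mono fun y => ?_
        rw [← ENNReal.ofReal_mul (by positivity)]
        rcases le_total (hits G y - 2 * μ) 0 with h | h
        · rw [ENNReal.ofReal_of_nonpos h, zero_pow hp]
          exact zero_le
        · rw [← ENNReal.ofReal_pow h]
          refine ENNReal.ofReal_le_ofReal ((pow_le_factorial_mul_exp h one_pos p).trans
            (le_of_eq ?_))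
          rw [mul_assoc (p.factorial : ℝ) (Real.exp _), ← Real.exp_add]
          simp only [inv_one, one_pow, mul_one, one_mul]
          ring_nf
    _ ≤ ENNReal.ofReal (p.factorial * Real.exp (-(2 * μ))) *
          ENNReal.ofReal (Real.exp (k * ν.real G * (Real.exp 1 - 1))) := by
        rw [lintegral_const_mul' _ _ ENNReal.ofReal_ne_top]
        gcongr
        exact lintegral_exp_hits_le ν k hG 1
    _ ≤ _ := by
        rw [← ENNReal.ofReal_mul (by positivity), mul_assoc, ← Real.exp_add]
        refine ENNReal.ofReal_le_ofReal ?_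
        gcongr
        nlinarith

/-- A Chernoff bound for the lower tail of a binomial random variable. -/
lemma pi_hits_lt_le (n : ℕ) {G : Set α} (hG : MeasurableSet G) {s : ℝ} (hs : 0 ≤ s) (M : ℝ) :
    (Measure.pi fun _ : Fin n => ν) {w | hits G w < M}
      ≤ ENNReal.ofReal (Real.exp (s * M - n * ν.real G * (1 - Real.exp (-s)))) := by
  calc _ = ∫⁻ w, Set.indicator {w : Fin n → α | hits G w < M} 1 w
          ∂(Measure.pi fun _ : Fin n => ν) :=
        (lintegral_indicator_one (measurableSet_lt (measurable_hits hG) measurable_const)).symm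
    _ ≤ ∫⁻ w, ENNReal.ofReal (Real.exp (s * M)) * ENNReal.ofReal (Real.exp ((-s) * hits G w))
          ∂(Measure.pi fun _ : Fin n => ν) := by
        refine lintegral_mono fun w => ?_
        by_cases h : hits G w < M
        · rw [Set.indicator_of_mem (by exact h), Pi.one_apply,
            ← ENNReal.ofReal_mul (Real.exp_pos _).le, ← Real.exp_add, ENNReal.one_le_ofReal,
            Real.one_le_exp_iff]
          nlinarith
        · rw [Set.indicator_of_notMem (by exact h)]
          exact zero_le
    _ ≤ ENNReal.ofReal (Real.exp (s * M)) *
          ENNReal.ofReal (Real.exp (n * ν.real G * (Real.exp (-s) - 1))) := by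
        rw [lintegral_const_mul' _ _ ENNReal.ofReal_ne_top]
        gcongr
        exact lintegral_exp_hits_le ν n hG (-s)
    _ = _ := by
        rw [← ENNReal.ofReal_mul (Real.exp_pos _).le, ← Real.exp_add]
        ring_nf

/-- A Chernoff bound for the upper tail of a binomial random variable. -/
lemma pi_le_hits_le (n : ℕ) {G : Set α} (hG : MeasurableSet G) {s : ℝ} (hs : 0 ≤ s) (M : ℝ) :
    (Measure.pi fun _ : Fin n => ν) {w | M ≤ hits G w}
      ≤ ENNReal.ofReal (Real.exp (n * ν.real G * (Real.exp s - 1) - s * M)) := by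
  calc _ = ∫⁻ w, Set.indicator {w : Fin n → α | M ≤ hits G w} 1 w
          ∂(Measure.pi fun _ : Fin n => ν) :=
        (lintegral_indicator_one (measurableSet_le measurable_const (measurable_hits hG))).symm
    _ ≤ ∫⁻ w, ENNReal.ofReal (Real.exp (-(s * M))) * ENNReal.ofReal (Real.exp (s * hits G w))
          ∂(Measure.pi fun _ : Fin n => ν) := by
        refine lintegral_mono fun w => ?_
        by_cases h : M ≤ hits G w
        · rw [Set.indicator_of_mem (by exact h), Pi.one_apply,
            ← ENNReal.ofReal_mul (Real.exp_pos _).le, ← Real.exp_add, ENNReal.one_le_ofReal,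
            Real.one_le_exp_iff]
          nlinarith
        · rw [Set.indicator_of_notMem (by exact h)]
          exact zero_le
    _ ≤ ENNReal.ofReal (Real.exp (-(s * M))) *
          ENNReal.ofReal (Real.exp (n * ν.real G * (Real.exp s - 1))) := by
        rw [lintegral_const_mul' _ _ ENNReal.ofReal_ne_top]
        gcongr
        exact lintegral_exp_hits_le ν n hG s
    _ = _ := by
        rw [← ENNReal.ofReal_mul (Real.exp_pos _).le, ← Real.exp_add]
        ring_nf

/-- If the mean of a binomial random variable exceeds the threshold by a constant factor, then
its lower tail decays exponentially in the mean. -/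
lemma exists_pi_hits_lt_le_exp {θ : ℝ} (hθ : 1 < θ) :
    ∃ c : ℝ, 0 < c ∧ ∀ (n : ℕ) (G : Set α), MeasurableSet G → ∀ M : ℝ,
      θ * M ≤ n * ν.real G →
      (Measure.pi fun _ : Fin n => ν) {w | hits G w < M}
        ≤ ENNReal.ofReal (Real.exp (-(c * (n * ν.real G)))) := by
  -- Then M ≤ (1 − 2s) q, and the Chernoff exponent is at most s(1 − 2s)q − (s − s²)q = −s² q.
  set s : ℝ := (1 - θ⁻¹) / 2 with hs
  have hθ' : θ⁻¹ < 1 := inv_lt_one_of_one_lt₀ hθ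
  have hθ0 : 0 < θ⁻¹ := by positivity
  have hs0 : 0 < s := by rw [hs]; linarith
  refine ⟨s * (s / 2), by positivity, fun n G hG M hM => ?_⟩
  refine (pi_hits_lt_le ν n hG hs0.le M).trans (ENNReal.ofReal_le_ofReal (Real.exp_le_exp.2 ?_))
  set q := (n : ℝ) * ν.real G with hq
  have hq0 : 0 ≤ q := by positivity
  have h1 : s - s ^ 2 ≤ 1 - Real.exp (-s) := by
    have := exp_sub_one_sub_le_sq (s := -s) (by rw [abs_neg, abs_of_pos hs0, hs]; linarith)
    nlinarith
  have h2 : M ≤ θ⁻¹ * q := by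
    rw [← div_eq_inv_mul, le_div_iff₀ (by positivity)]; linarith
  have h3 : s * M ≤ s * (θ⁻¹ * q) := by gcongr
  have h4 : q * (s - s ^ 2) ≤ q * (1 - Real.exp (-s)) := by gcongr
  have h5 : θ⁻¹ = 1 - 2 * s := by rw [hs]; ring
  rw [h5] at h3
  nlinarith [mul_nonneg hq0 (sq_nonneg s)]

/-- If the threshold exceeds the mean of a binomial random variable by a constant factor, then
its upper tail decays exponentially in the threshold. -/
lemma exists_pi_le_hits_le_exp {θ : ℝ} (hθ0 : 0 ≤ θ) (hθ : θ < 1) :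
    ∃ c : ℝ, 0 < c ∧ ∀ (n : ℕ) (G : Set α), MeasurableSet G → ∀ M : ℝ, 0 ≤ M →
      n * ν.real G ≤ θ * M →
      (Measure.pi fun _ : Fin n => ν) {w | M ≤ hits G w}
        ≤ ENNReal.ofReal (Real.exp (-(c * M))) := by
  -- Then q ≤ (1 − 2s) M, and the Chernoff exponent is at most (1 − 2s)(s + s²)M − sM ≤ −s² M.
  set s : ℝ := (1 - θ) / 2 with hs
  have hs0 : 0 < s := by rw [hs]; linarith
  refine ⟨s * s, by positivity, fun n G hG M hM0 hM => ?_⟩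
  refine (pi_le_hits_le ν n hG hs0.le M).trans (ENNReal.ofReal_le_ofReal (Real.exp_le_exp.2 ?_))
  set q := (n : ℝ) * ν.real G with hq
  have hq0 : 0 ≤ q := by positivity
  have h1 : Real.exp s - 1 ≤ s + s ^ 2 := by
    have := exp_sub_one_sub_le_sq (s := s) (by rw [abs_of_pos hs0, hs]; linarith)
    linarith
  have h4 : q * (Real.exp s - 1) ≤ (θ * M) * (s + s ^ 2) := by
    refine mul_le_mul hM h1 ?_ (by positivity)
    linarith [Real.add_one_le_exp s]
  have h5 : θ = 1 - 2 * s := by rw [hs]; ring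
  rw [h5] at h4
  nlinarith [mul_nonneg hM0 (pow_nonneg hs0.le 3), mul_nonneg hM0 (pow_nonneg hs0.le 2)]

end Binomial

/-! ### Measures with bounded density: balls and radial exponentials -/

section Density

/-- The volume of the unit ball of `ℝᵐ`. -/
noncomputable def unitBallVolume (m : ℕ) : ℝ := volume.real (Metric.ball (0 : E m) 1)

lemma unitBallVolume_pos (m : ℕ) : 0 < unitBallVolume m :=
  ENNReal.toReal_pos (Metric.measure_ball_pos _ _ one_pos).ne' measure_ball_lt_top.ne

lemma volume_real_ball {m : ℕ} (hm : 1 ≤ m) (y : E m) {t : ℝ} (ht : 0 ≤ t) :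
    volume.real (Metric.ball y t) = t ^ m * unitBallVolume m := by
  have : Nonempty (Fin m) := ⟨⟨0, hm⟩⟩
  unfold unitBallVolume
  rw [measureReal_def, Measure.addHaar_ball _ _ ht, ENNReal.toReal_mul,
    ENNReal.toReal_ofReal (by positivity), finrank_euclideanSpace_fin, measureReal_def]

lemma volume_real_closedBall {m : ℕ} (y : E m) {t : ℝ} (ht : 0 ≤ t) :
    volume.real (Metric.closedBall y t) = t ^ m * unitBallVolume m := by
  unfold unitBallVolume
  rw [measureReal_def, Measure.addHaar_closedBall _ _ ht, ENNReal.toReal_mul,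
    ENNReal.toReal_ofReal (by positivity), finrank_euclideanSpace_fin, measureReal_def]

variable {m : ℕ} {f : E m → ℝ} {ν : Measure (E m)}

lemma real_le_of_density_le (hν : ν = volume.withDensity (fun y => ENNReal.ofReal (f y)))
    {S : Set (E m)} (hS : MeasurableSet S) (hfin : volume S ≠ ∞) {b : ℝ} (hb0 : 0 ≤ b)
    (hb : ∀ y ∈ S, f y ≤ b) : ν.real S ≤ b * volume.real S := by
  have h : ν S ≤ ENNReal.ofReal b * volume S := by
    rw [hν, withDensity_apply _ hS, ← setLIntegral_const]
    exact setLIntegral_mono measurable_const fun y hy => ENNReal.ofReal_le_ofReal (hb y hy)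
  have := ENNReal.toReal_mono (ENNReal.mul_ne_top ENNReal.ofReal_ne_top hfin) h
  rwa [ENNReal.toReal_mul, ENNReal.toReal_ofReal hb0] at this

lemma le_real_of_le_density [IsFiniteMeasure ν] (hf : Measurable f)
    (hν : ν = volume.withDensity (fun y => ENNReal.ofReal (f y)))
    {S : Set (E m)} (hS : MeasurableSet S) {b : ℝ} (hb0 : 0 ≤ b)
    (hb : ∀ y ∈ S, b ≤ f y) : b * volume.real S ≤ ν.real S := by
  have h : ENNReal.ofReal b * volume S ≤ ν S := by
    rw [hν, withDensity_apply _ hS, ← setLIntegral_const]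
    exact setLIntegral_mono hf.ennreal_ofReal fun y hy => ENNReal.ofReal_le_ofReal (hb y hy)
  have := ENNReal.toReal_mono (measure_ne_top ν S) h
  rwa [ENNReal.toReal_mul, ENNReal.toReal_ofReal hb0] at this

/-- The general formula for the volume of a unit ball of a gauge, applied to c‖·‖ with c^m = a.
Exponent and dimension are both m, so the Gamma factor is Γ(2) = 1 and the integral is the volume of
a ball of radius 1/c. -/
lemma lintegral_exp_neg_norm_pow (hm : 1 ≤ m) {a : ℝ} (ha : 0 < a) :
    ∫⁻ y : E m, ENNReal.ofReal (Real.exp (-(a * ‖y‖ ^ m))) = ENNReal.ofReal (unitBallVolume m / a) := by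
  have hm0 : (m : ℝ) ≠ 0 := by positivity
  set c : ℝ := a ^ (1 / (m : ℝ)) with hc
  have hc0 : 0 < c := by positivity
  have hcm : c ^ m = a := by
    rw [hc, ← Real.rpow_natCast, ← Real.rpow_mul ha.le, one_div, inv_mul_cancel₀ hm0, Real.rpow_one]
  have h := measure_lt_one_eq_integral_div_gamma (volume : Measure (E m)) (g := fun x => c * ‖x‖)
    (by simp) (by simp)
    (fun x y => by rw [← mul_add]; exact mul_le_mul_of_nonneg_left (norm_add_le x y) hc0.le)
    (fun {x} hx => by simpa [hc0.ne'] using hx)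
    (fun r x => by rw [norm_smul, Real.norm_eq_abs]; exact le_of_eq (by ring))
    (p := m) (by positivity)
  have hset : {x : E m | c * ‖x‖ < 1} = Metric.ball 0 c⁻¹ := by
    ext x
    rw [Set.mem_ofPred_eq, mem_ball_zero_iff, ← one_div, lt_div_iff₀ hc0, mul_comm]
  have hpow : ∀ x : E m, (c * ‖x‖) ^ (m : ℝ) = a * ‖x‖ ^ m := by
    intro x
    rw [Real.rpow_natCast, mul_pow, hcm]
  simp_rw [hpow] at h
  rw [hset, finrank_euclideanSpace_fin, div_self hm0] at h
  norm_num at h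
  have hv : (volume (Metric.ball (0 : E m) c⁻¹)) = ENNReal.ofReal (unitBallVolume m / a) := by
    rw [← ENNReal.ofReal_toReal (measure_ball_lt_top (μ := volume) (x := (0 : E m)) (r := c⁻¹)).ne]
    congr 1
    have := volume_real_ball hm (0 : E m) (t := c⁻¹) (by positivity)
    rw [measureReal_def] at this
    rw [this, inv_pow, hcm]
    ring
  rw [hv] at h
  rw [h]
  have hpos : 0 < unitBallVolume m / a := div_pos (unitBallVolume_pos m) ha
  -- Integrability comes for free: the Bochner integral is nonzero.
  have hI : 0 < ∫ x : E m, Real.exp (-(a * ‖x‖ ^ m)) := by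
    rw [← ENNReal.ofReal_pos, ← h, ENNReal.ofReal_pos]
    exact hpos
  rw [ofReal_integral_eq_lintegral_ofReal (Integrable.of_integral_ne_zero hI.ne')
    (Eventually.of_forall fun _ => (Real.exp_pos _).le)]

/-- With a proportional to N this gives the order 1/N which cancels the factor N in the scaling N/M.
-/
lemma setLIntegral_exp_neg_le (hm : 1 ≤ m)
    (hf : Measurable f) (hν : ν = volume.withDensity (fun y => ENNReal.ofReal (f y)))
    {S : Set (E m)} (hS : MeasurableSet S) {b : ℝ} (hb0 : 0 ≤ b) (hb : ∀ y ∈ S, f y ≤ b)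
    (y₀ : E m) {a : ℝ} (ha : 0 < a) :
    ∫⁻ y in S, ENNReal.ofReal (Real.exp (-(a * ‖y - y₀‖ ^ m))) ∂ν
      ≤ ENNReal.ofReal (b * unitBallVolume m / a) := by
  have hmeas : Measurable fun y : E m => ENNReal.ofReal (Real.exp (-(a * ‖y - y₀‖ ^ m))) := by
    fun_prop
  rw [hν, restrict_withDensity hS, lintegral_withDensity_eq_lintegral_mul _ hf.ennreal_ofReal hmeas]
  calc _ ≤ ∫⁻ y in S, ENNReal.ofReal b * ENNReal.ofReal (Real.exp (-(a * ‖y - y₀‖ ^ m))) := by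
        refine setLIntegral_mono (hmeas.const_mul _) fun y hy => ?_
        exact mul_le_mul_left (ENNReal.ofReal_le_ofReal (hb y hy)) _
    _ ≤ ∫⁻ y, ENNReal.ofReal b * ENNReal.ofReal (Real.exp (-(a * ‖y - y₀‖ ^ m))) :=
        setLIntegral_le_lintegral _ _
    _ = ENNReal.ofReal b * ∫⁻ y : E m, ENNReal.ofReal (Real.exp (-(a * ‖y‖ ^ m))) := by
        rw [lintegral_const_mul _ hmeas,
          lintegral_sub_right_eq_self (fun y : E m => ENNReal.ofReal (Real.exp (-(a * ‖y‖ ^ m))))]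
    _ = _ := by
        rw [lintegral_exp_neg_norm_pow hm ha, ← ENNReal.ofReal_mul hb0, mul_div_assoc]

end Density

/-! ### Minkowski's inequality for sections -/

section Minkowski

variable {β γ : Type*} [MeasurableSpace β] [MeasurableSpace γ]

/-- Minkowski's integral inequality for the measures of the sections of a set. -/
lemma lintegral_measure_section_pow_le (μ : Measure β) [SFinite μ] (ν : Measure γ) [SFinite ν]
    {F : Set (β × γ)} (hF : MeasurableSet F) {p : ℕ} (hp : 0 < p) {b : γ → ℝ≥0∞}
    (hb : Measurable b) (hb0 : ∀ y, b y ≠ 0) (hbtop : ∀ y, b y ≠ ∞)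
    (h : ∀ y, μ {w | (w, y) ∈ F} ≤ b y ^ p) :
    ∫⁻ w, ν {y | (w, y) ∈ F} ^ p ∂μ ≤ (∫⁻ y, b y ∂ν) ^ p := by
  have hFw : ∀ w, MeasurableSet {y | (w, y) ∈ F} := fun w => measurable_prodMk_left hF
  have hFy : ∀ y, MeasurableSet {w | (w, y) ∈ F} := fun y => measurable_prodMk_right hF
  -- Weighted Hölder: the indicator of a section is g^{1/p} b^{(p−1)/p}, so the p-th power of its
  -- measure is at most (∫ g)(∫ b)^{p−1}. Integrating g in w first leaves at most b, by the
  -- hypothesis on the sections.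
  set g : β → γ → ℝ≥0∞ := fun w y => F.indicator (fun z => (b z.2 ^ (p - 1))⁻¹) (w, y) with hg
  have hgm : Measurable (Function.uncurry g) :=
    (((hb.comp measurable_snd).pow_const _).inv).indicator hF
  have key : ∀ w, ν {y | (w, y) ∈ F} ^ p ≤ (∫⁻ y, g w y ∂ν) * (∫⁻ y, b y ∂ν) ^ (p - 1) := by
    intro w
    have hgw : Measurable (g w) := hgm.comp measurable_prodMk_left
    -- The case p = 1 is plain Tonelli; it is split off because p would have no finite conjugate
    -- exponent.
    rcases (Nat.one_le_iff_ne_zero.2 hp.ne').eq_or_lt with rfl | hp1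
    · simp only [pow_one, hg, tsub_self, pow_zero, inv_one, mul_one]
      rw [← lintegral_indicator_one (hFw w)]
      exact le_of_eq rfl
    · have hpr : (1 : ℝ) < p := by exact_mod_cast hp1
      have hp0 : (p : ℝ) ≠ 0 := by positivity
      have hpm : (p : ℝ) - 1 ≠ 0 := by linarith
      have hconj : (p : ℝ).HolderConjugate (Real.conjExponent p) :=
        Real.HolderConjugate.conjExponent hpr
      have hq : Real.conjExponent p = p / (p - 1) := rfl
      set q := Real.conjExponent (p : ℝ) with hqdef
      have hholder := ENNReal.lintegral_mul_le_Lp_mul_Lq ν hconj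
        (f := fun y => g w y ^ (1 / (p : ℝ))) (g := fun y => b y ^ (1 / q))
        (hgw.pow_const _).aemeasurable (hb.pow_const _).aemeasurable
      have hq0 : q ≠ 0 := hconj.symm.ne_zero
      simp only [Pi.mul_apply, ← ENNReal.rpow_mul, one_div, inv_mul_cancel₀ hp0,
        inv_mul_cancel₀ hq0, ENNReal.rpow_one] at hholder
      have hpt : ∀ y, g w y ^ ((p : ℝ)⁻¹) * b y ^ (q⁻¹) = {y | (w, y) ∈ F}.indicator 1 y := by
        intro y
        by_cases hy : (w, y) ∈ F
        · have e1 : g w y = (b y ^ (p - 1))⁻¹ := by simp [hg, hy]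
          rw [Set.indicator_of_mem (by exact hy), e1, ENNReal.inv_rpow, ← ENNReal.rpow_natCast,
            ← ENNReal.rpow_mul, Nat.cast_sub hp, Nat.cast_one]
          have e2 : ((p : ℝ) - 1) * (p : ℝ)⁻¹ = q⁻¹ := by
            rw [hq]; field_simp
          rw [e2, Pi.one_apply, ENNReal.inv_mul_cancel]
          · exact (ENNReal.rpow_pos (pos_iff_ne_zero.2 (hb0 y)) (hbtop y)).ne'
          · exact ENNReal.rpow_ne_top_of_nonneg (inv_nonneg.2 hconj.symm.nonneg) (hbtop y)
        · have e1 : g w y = 0 := by simp [hg, hy]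
          rw [Set.indicator_of_notMem (by exact hy), e1, ENNReal.zero_rpow_of_pos (by positivity),
            zero_mul]
      simp_rw [hpt] at hholder
      rw [lintegral_indicator_one (hFw w)] at hholder
      calc _ ≤ ((∫⁻ y, g w y ∂ν) ^ ((p : ℝ)⁻¹) * (∫⁻ y, b y ∂ν) ^ (q⁻¹)) ^ p := by gcongr
        _ = _ := by
          rw [mul_pow, ← ENNReal.rpow_natCast, ← ENNReal.rpow_mul, inv_mul_cancel₀ hp0,
            ENNReal.rpow_one, ← ENNReal.rpow_natCast, ← ENNReal.rpow_mul,
            ← ENNReal.rpow_natCast _ (p - 1), Nat.cast_sub hp, Nat.cast_one]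
          congr 2
          rw [hq]; field_simp
  calc _ ≤ ∫⁻ w, (∫⁻ y, g w y ∂ν) * (∫⁻ y, b y ∂ν) ^ (p - 1) ∂μ := lintegral_mono key
    _ = (∫⁻ w, ∫⁻ y, g w y ∂ν ∂μ) * (∫⁻ y, b y ∂ν) ^ (p - 1) :=
        lintegral_mul_const _ hgm.lintegral_prod_right
    _ = (∫⁻ y, ∫⁻ w, g w y ∂μ ∂ν) * (∫⁻ y, b y ∂ν) ^ (p - 1) := by
        rw [lintegral_lintegral_swap hgm.aemeasurable]
    _ ≤ (∫⁻ y, b y ∂ν) * (∫⁻ y, b y ∂ν) ^ (p - 1) := by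
        gcongr with y
        have e : ∀ w, g w y = {w | (w, y) ∈ F}.indicator (fun _ => (b y ^ (p - 1))⁻¹) w := by
          intro w
          by_cases hy : (w, y) ∈ F <;> simp [hg, hy]
        simp_rw [e]
        rw [lintegral_indicator_const (hFy y)]
        calc _ ≤ (b y ^ (p - 1))⁻¹ * b y ^ p := by gcongr; exact h y
          _ = b y := by
            obtain ⟨n, rfl⟩ : ∃ n, p = n + 1 := ⟨p - 1, by omega⟩
            rw [pow_succ, ← mul_assoc, Nat.add_sub_cancel, ENNReal.inv_mul_cancel, one_mul]
            · exact pow_ne_zero _ (hb0 y)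
            · exact ENNReal.pow_ne_top (hbtop y)
    _ = _ := by
        rw [← pow_succ', Nat.sub_add_cancel hp]

end Minkowski

/-! ### Counts in random sets independent of the sample -/

section Sections

lemma measurable_hits_section {β γ : Type*} [MeasurableSpace β]
    [MeasurableSpace γ] {k : ℕ} {F : Set (β × γ)} (hF : MeasurableSet F) :
    Measurable (fun z : β × (Fin k → γ) => hits {y | (z.1, y) ∈ F} z.2) := by
  unfold hits
  refine Finset.measurable_sum _ fun j _ => ?_
  have : Measurable fun z : β × (Fin k → γ) => (z.1, z.2 j) := by fun_prop
  exact (Measurable.indicator (measurable_const (a := (1 : ℝ))) hF).comp this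

/-- The moments of the number of the points of an independent sample in a random set. -/
lemma lintegral_hits_section_pow_le {β γ : Type*} [MeasurableSpace β]
    [MeasurableSpace γ] (μ : Measure β) [IsProbabilityMeasure μ] (ν : Measure γ)
    [IsProbabilityMeasure ν] (k : ℕ) {F : Set (β × γ)} (hF : MeasurableSet F) (p : ℕ) :
    ∫⁻ z : β × (Fin k → γ), ENNReal.ofReal (hits {y | (z.1, y) ∈ F} z.2) ^ p
        ∂(μ.prod (Measure.pi fun _ => ν))
      ≤ ENNReal.ofReal (p.factorial * Real.exp 2 * 2 ^ p) *
        (1 + (k : ℝ≥0∞) ^ p * ∫⁻ w, ν {y | (w, y) ∈ F} ^ p ∂μ) := by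
  have hFw : ∀ w, MeasurableSet {y | (w, y) ∈ F} := fun w => measurable_prodMk_left hF
  rw [lintegral_prod _ ((measurable_hits_section hF).ennreal_ofReal.pow_const p).aemeasurable]
  have hmeas : Measurable fun w => ν {y | (w, y) ∈ F} := measurable_measure_prodMk_left hF
  calc _ ≤ ∫⁻ w, ENNReal.ofReal (p.factorial * Real.exp 2 * 2 ^ p) *
          (1 + (k : ℝ≥0∞) ^ p * ν {y | (w, y) ∈ F} ^ p) ∂μ := by
        refine lintegral_mono fun w => ?_
        have h := lintegral_hits_pow_le ν k (hFw w) p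
        simp_rw [← ENNReal.ofReal_pow (hits_nonneg _ _)]
        refine h.trans ?_
        have e : (k : ℝ≥0∞) ^ p * ν {y | (w, y) ∈ F} ^ p
            = ENNReal.ofReal ((k * ν.real {y | (w, y) ∈ F}) ^ p) := by
          rw [ENNReal.ofReal_pow (by positivity), ENNReal.ofReal_mul (by positivity),
            ENNReal.ofReal_natCast, mul_pow, measureReal_def,
            ENNReal.ofReal_toReal (measure_ne_top _ _)]
        rw [e, ← ENNReal.ofReal_one, ← ENNReal.ofReal_add zero_le_one (by positivity),
          ← ENNReal.ofReal_mul (by positivity)]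
        refine ENNReal.ofReal_le_ofReal ?_
        rw [mul_assoc _ (2 ^ p : ℝ)]
        refine mul_le_mul_of_nonneg_left ?_ (by positivity)
        set q := (k : ℝ) * ν.real {y | (w, y) ∈ F}
        have hq : 0 ≤ q := by positivity
        rcases le_total q 1 with hq1 | hq1
        · calc (1 + q) ^ p ≤ 2 ^ p := by gcongr; linarith
            _ ≤ 2 ^ p * (1 + q ^ p) := le_mul_of_one_le_right (by positivity)
                (by linarith [pow_nonneg hq p])
        · calc (1 + q) ^ p ≤ (2 * q) ^ p := by gcongr; linarith
            _ ≤ 2 ^ p * (1 + q ^ p) := by rw [mul_pow]; gcongr; linarith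
    _ = _ := by
        rw [lintegral_const_mul' _ _ ENNReal.ofReal_ne_top,
          lintegral_add_left measurable_const,
          lintegral_const_mul' _ _ (ENNReal.pow_ne_top (ENNReal.natCast_ne_top k))]
        simp

end Sections

/-! ### Chernoff bounds for the exceptional sets around φ(x) -/

section Neighbourhood

variable {m : ℕ}

/-- The points `y` away from `y₀`, at a distance more than `a`, such that fewer than `M` of the
points of `w` lie in the ball around `y` that nearly reaches `y₀`. -/
def farSet {n : ℕ} (y₀ : E m) (θ a u e : ℝ) (M : ℕ) : Set ((Fin n → E m) × E m) :=
  {z | (a < ‖z.2 - y₀‖ ∧ ‖z.2 - y₀‖ ≤ u ∧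
      hits (Metric.ball z.2 (‖z.2 - y₀‖ / θ)) z.1 < M) ∨
    (u < ‖z.2 - y₀‖ ∧ hits (Metric.ball z.2 (‖z.2 - y₀‖ - 4 * e)) z.1 < M)}

/-- The points `y` at a distance at most `a` from `y₀` such that at least `M` of the points of `w`
lie in the ball around `y` of radius `t`. -/
def nearSet {n : ℕ} (y₀ : E m) (a t : ℝ) (M : ℕ) : Set ((Fin n → E m) × E m) :=
  {z | ‖z.2 - y₀‖ ≤ a ∧ (M : ℝ) ≤ hits (Metric.ball z.2 t) z.1}

lemma measurable_hits_ball {n : ℕ} {g : E m → ℝ} (hg : Measurable g) :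
    Measurable (fun z : (Fin n → E m) × E m => hits (Metric.ball z.2 (g z.2)) z.1) := by
  unfold hits
  refine Finset.measurable_sum _ fun j _ => ?_
  have hS : MeasurableSet {z : (Fin n → E m) × E m | dist (z.1 j) z.2 < g z.2} :=
    measurableSet_lt (by fun_prop) (by fun_prop)
  exact Measurable.indicator (measurable_const (a := (1 : ℝ))) hS

lemma measurableSet_farSet {n : ℕ} (y₀ : E m) (θ a u e : ℝ) (M : ℕ) :
    MeasurableSet (farSet (n := n) y₀ θ a u e M) := by
  have h1 : Measurable fun z : (Fin n → E m) × E m =>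
      hits (Metric.ball z.2 (‖z.2 - y₀‖ / θ)) z.1 :=
    measurable_hits_ball (g := fun y => ‖y - y₀‖ / θ) (by fun_prop)
  have h2 : Measurable fun z : (Fin n → E m) × E m =>
      hits (Metric.ball z.2 (‖z.2 - y₀‖ - 4 * e)) z.1 :=
    measurable_hits_ball (g := fun y => ‖y - y₀‖ - 4 * e) (by fun_prop)
  have h3 : Measurable fun z : (Fin n → E m) × E m => ‖z.2 - y₀‖ := by fun_prop
  exact ((measurableSet_lt measurable_const h3).inter ((measurableSet_le h3 measurable_const).inter
    (measurableSet_lt h1 measurable_const))).union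
      ((measurableSet_lt measurable_const h3).inter (measurableSet_lt h2 measurable_const))

lemma measurableSet_nearSet {n : ℕ} (y₀ : E m) (a t : ℝ) (M : ℕ) :
    MeasurableSet (nearSet (n := n) y₀ a t M) := by
  have h1 : Measurable fun z : (Fin n → E m) × E m => hits (Metric.ball z.2 t) z.1 :=
    measurable_hits_ball (g := fun _ => t) (by fun_prop)
  have h3 : Measurable fun z : (Fin n → E m) × E m => ‖z.2 - y₀‖ := by fun_prop
  exact (measurableSet_le h3 measurable_const).inter (measurableSet_le measurable_const h1)

/-- The measure `ν` has a density `f` which is between `κ / s` and `s * κ` on the ball of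
radius `r` around `y₀`. -/
structure DensityNear (ν : Measure (E m)) (y₀ : E m) (κ s r : ℝ) : Prop where
  lower : ∀ S, MeasurableSet S → S ⊆ Metric.ball y₀ r → κ / s * volume.real S ≤ ν.real S
  upper : ∀ S, MeasurableSet S → S ⊆ Metric.ball y₀ r → ν.real S ≤ s * κ * volume.real S

lemma exists_densityNear {ν : Measure (E m)} [IsFiniteMeasure ν] {f : E m → ℝ}
    (hf : Measurable f) (hν : ν = volume.withDensity (fun y => ENNReal.ofReal (f y)))
    {y₀ : E m} (hc : ContinuousAt f y₀) (hpos : 0 < f y₀) {s : ℝ} (hs : 1 < s) :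
    ∃ r > 0, DensityNear ν y₀ (f y₀) s r := by
  have h1 : ∀ᶠ y in 𝓝 y₀, f y₀ / s < f y :=
    hc.eventually_const_lt (div_lt_self hpos hs)
  have h2 : ∀ᶠ y in 𝓝 y₀, f y < s * f y₀ :=
    hc.eventually_lt_const (lt_mul_of_one_lt_left hpos hs)
  obtain ⟨r, hr, h⟩ := Metric.eventually_nhds_iff_ball.1 (h1.and h2)
  refine ⟨r, hr, fun S hS hSr => ?_, fun S hS hSr => ?_⟩
  · exact le_real_of_le_density hf hν hS (by positivity) fun y hy => (h y (hSr hy)).1.le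
  · refine real_le_of_density_le hν hS ?_ (by positivity) fun y hy => (h y (hSr hy)).2.le
    exact ((measure_mono hSr).trans_lt measure_ball_lt_top).ne

lemma DensityNear.mono {ν : Measure (E m)} {y₀ : E m} {κ s r r' : ℝ}
    (h : DensityNear ν y₀ κ s r) (hr : r' ≤ r) : DensityNear ν y₀ κ s r' :=
  ⟨fun S hS hSr => h.lower S hS (hSr.trans (Metric.ball_subset_ball hr)),
    fun S hS hSr => h.upper S hS (hSr.trans (Metric.ball_subset_ball hr))⟩

variable {ν₀ : Measure (E m)} [IsProbabilityMeasure ν₀] {y₀ : E m} {κ s u : ℝ}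

/-- At a distance t with s⁴ρ < t ≤ u, the ball of radius t/s² is expected to hold at least s^{2m−1}
M ≥ s M points, so fewer than M is a large deviation, with a rate proportional to n t^m. Beyond u
the ball contains a fixed amount of mass near y₀, and M is at most half the expected count there. -/
lemma exists_pi_farSet_le (hm : 1 ≤ m) (hκ : 0 < κ) (hs : 1 < s) (hu : 0 < u)
    (hν₀ : DensityNear ν₀ y₀ κ s (2 * u)) :
    ∃ c : ℝ, 0 < c ∧ ∀ (n M : ℕ) (ρ : ℝ), 0 ≤ ρ → n * (κ * ρ ^ m * unitBallVolume m) = M →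
      (M : ℝ) ≤ c * n → ∀ y,
      (Measure.pi fun _ : Fin n => ν₀) {w | (w, y) ∈ farSet y₀ (s ^ 2) (s ^ 4 * ρ) u (u / 6) M} ≤
        if ‖y - y₀‖ ≤ u then ENNReal.ofReal (Real.exp (-(c * n * ‖y - y₀‖ ^ m)))
          else ENNReal.ofReal (Real.exp (-(c * n))) := by
  set V := unitBallVolume m with hV
  have hV0 : 0 < V := unitBallVolume_pos m
  have hs0 : 0 < s := by linarith
  obtain ⟨c₁, hc₁, h₁⟩ := exists_pi_hits_lt_le_exp ν₀ hs
  obtain ⟨c₂, hc₂, h₂⟩ := exists_pi_hits_lt_le_exp ν₀ (one_lt_two)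
  set a₁ := c₁ * (κ / s * V / (s ^ 2) ^ m) with ha₁
  set q₀ := κ / s * ((u / 6) ^ m * V) with hq₀
  have ha₁0 : 0 < a₁ := by positivity
  have hq₀0 : 0 < q₀ := by positivity
  -- The first two constants are the Chernoff rates within and beyond u; the third turns M ≤ c n
  -- into 2 M ≤ n q₀, the mean condition beyond u.
  refine ⟨min a₁ (min (c₂ * q₀) (q₀ / 2)), by positivity, fun n M ρ hρ hM hMn y => ?_⟩
  set c := min a₁ (min (c₂ * q₀) (q₀ / 2)) with hc
  have hca : c ≤ a₁ := min_le_left _ _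
  have hcb : c ≤ c₂ * q₀ := (min_le_right _ _).trans (min_le_left _ _)
  have hcd : c ≤ q₀ / 2 := (min_le_right _ _).trans (min_le_right _ _)
  have hn0 : (0 : ℝ) ≤ n := n.cast_nonneg
  set t := ‖y - y₀‖ with ht
  have ht0 : 0 ≤ t := norm_nonneg _
  by_cases htu : t ≤ u
  · rw [if_pos htu]
    by_cases hta : s ^ 4 * ρ < t
    · have hball : Metric.ball y (t / s ^ 2) ⊆ Metric.ball y₀ (2 * u) := by
        refine Metric.ball_subset_ball' ?_
        rw [dist_eq_norm]
        have : t / s ^ 2 ≤ t := div_le_self ht0 (one_le_pow₀ hs.le)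
        linarith
      have hlow := hν₀.lower _ measurableSet_ball hball
      rw [volume_real_ball hm _ (by positivity), ← hV, div_pow] at hlow
      have hlow' : κ / s * V / (s ^ 2) ^ m * t ^ m ≤ ν₀.real (Metric.ball y (t / s ^ 2)) := by
        refine le_trans (le_of_eq ?_) hlow
        ring
      have hnq := mul_le_mul_of_nonneg_left hlow' hn0
      have hsm : s * M ≤ n * ν₀.real (Metric.ball y (t / s ^ 2)) := by
        refine le_trans ?_ hnq
        have h4 : (s ^ 4 * ρ) ^ m ≤ t ^ m := by gcongr
        have h5 : s * M ≤ n * (κ / s * V / (s ^ 2) ^ m * (s ^ 4 * ρ) ^ m) := by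
          have e : n * (κ / s * V / (s ^ 2) ^ m * (s ^ 4 * ρ) ^ m) = (s ^ 2) ^ m / s * M := by
            rw [← hM, mul_pow]
            have : (s ^ 4) ^ m = (s ^ 2) ^ m * (s ^ 2) ^ m := by rw [← mul_pow]; ring_nf
            rw [this]
            field_simp
          rw [e]
          refine mul_le_mul_of_nonneg_right ?_ M.cast_nonneg
          rw [le_div_iff₀ hs0, ← pow_two]
          exact le_self_pow₀ (one_le_pow₀ hs.le) (by omega)
        refine h5.trans ?_
        gcongr
      have h6 := h₁ n _ (measurableSet_ball (x := y) (ε := t / s ^ 2)) M hsm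
      refine le_trans (measure_mono ?_) (h6.trans ?_)
      · rintro w (⟨-, -, hw⟩ | ⟨hw, -⟩)
        · exact hw
        · exact absurd htu (not_le.2 hw)
      · refine ENNReal.ofReal_le_ofReal (Real.exp_le_exp.2 (neg_le_neg ?_))
        have h7 := mul_le_mul_of_nonneg_left hnq hc₁.le
        refine le_trans ?_ h7
        have h8 : c * (n * t ^ m) ≤ a₁ * (n * t ^ m) := by gcongr
        calc _ = c * (n * t ^ m) := by ring
          _ ≤ _ := h8
          _ = _ := by rw [ha₁]; ring
    · have : {w : Fin n → E m | (w, y) ∈ farSet y₀ (s ^ 2) (s ^ 4 * ρ) u (u / 6) M} = ∅ := by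
        refine Set.eq_empty_iff_forall_notMem.2 ?_
        rintro w (⟨hw, -⟩ | ⟨hw, -⟩)
        · exact hta hw
        · exact absurd htu (not_le.2 hw)
      rw [this, measure_empty]
      exact zero_le
  · rw [if_neg htu]
    rw [not_le] at htu
    have ht0' : 0 < t := hu.trans htu
    -- The point of the segment from y₀ to y at distance u from y₀: its ball of radius u/6 lies near
    -- y₀, where ν₀ is controlled, and inside the ball around y, since t − u + u/6 ≤ t − 4u/6.
    set v : E m := y₀ + (u / t) • (y - y₀) with hv
    have hvy₀ : dist v y₀ = u := by
      rw [dist_eq_norm, hv, add_sub_cancel_left, norm_smul, Real.norm_of_nonneg (by positivity),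
        ← ht, div_mul_cancel₀ _ ht0'.ne']
    have hvy : dist v y = t - u := by
      have : v - y = -((1 - u / t) • (y - y₀)) := by
        rw [hv]; module
      have h1 : 0 ≤ 1 - u / t := by
        rw [sub_nonneg, div_le_one ht0']; exact htu.le
      rw [dist_eq_norm, this, norm_neg, norm_smul, Real.norm_of_nonneg h1, ← ht]
      field_simp
    have hb1 : Metric.ball v (u / 6) ⊆ Metric.ball y₀ (2 * u) :=
      Metric.ball_subset_ball' (by rw [hvy₀]; linarith)
    have hb2 : Metric.ball v (u / 6) ⊆ Metric.ball y (t - 4 * (u / 6)) :=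
      Metric.ball_subset_ball' (by rw [hvy]; linarith)
    have hlow := hν₀.lower _ measurableSet_ball hb1
    rw [volume_real_ball hm _ (by positivity), ← hV, ← hq₀] at hlow
    have hlow' : q₀ ≤ ν₀.real (Metric.ball y (t - 4 * (u / 6))) :=
      hlow.trans (measureReal_mono hb2)
    have hnq := mul_le_mul_of_nonneg_left hlow' hn0
    have h6 := h₂ n _ (measurableSet_ball (x := y) (ε := t - 4 * (u / 6))) M (by nlinarith)
    refine le_trans (measure_mono ?_) (h6.trans ?_)
    · rintro w (⟨-, hw, -⟩ | ⟨-, hw⟩)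
      · exact absurd htu (not_lt.2 hw)
      · exact hw
    · refine ENNReal.ofReal_le_ofReal (Real.exp_le_exp.2 (neg_le_neg ?_))
      have h7 := mul_le_mul_of_nonneg_left hnq hc₂.le
      have h8 : c * n ≤ c₂ * q₀ * n := by gcongr
      linarith

/-- Near y₀ a ball of radius ρ/s² is expected to hold at most s^{1−2m} M ≤ M/s points, so M points
in it is a large deviation. -/
lemma exists_pi_nearSet_le (hm : 1 ≤ m) (hκ : 0 < κ) (hs : 1 < s)
    (hν₀ : DensityNear ν₀ y₀ κ s (2 * u)) :
    ∃ c : ℝ, 0 < c ∧ ∀ (n M : ℕ) (ρ : ℝ), 0 ≤ ρ → ρ ≤ u → n * (κ * ρ ^ m * unitBallVolume m) = M → ∀ y,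
      (Measure.pi fun _ : Fin n => ν₀) {w | (w, y) ∈ nearSet y₀ (ρ / s ^ 4) (ρ / s ^ 2) M} ≤
        ENNReal.ofReal (Real.exp (-(c * M))) := by
  set V := unitBallVolume m with hV
  have hV0 : 0 < V := unitBallVolume_pos m
  have hs0 : 0 < s := by linarith
  obtain ⟨c, hc, h⟩ := exists_pi_le_hits_le_exp ν₀ (θ := s⁻¹) (by positivity)
    (inv_lt_one_of_one_lt₀ hs)
  refine ⟨c, hc, fun n M ρ hρ hρu hM y => ?_⟩
  by_cases hy : ‖y - y₀‖ ≤ ρ / s ^ 4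
  · have hball : Metric.ball y (ρ / s ^ 2) ⊆ Metric.ball y₀ (2 * u) := by
      refine Metric.ball_subset_ball' ?_
      rw [dist_eq_norm]
      have h1 : ρ / s ^ 2 ≤ ρ := div_le_self hρ (one_le_pow₀ hs.le)
      have h2 : ρ / s ^ 4 ≤ ρ := div_le_self hρ (one_le_pow₀ hs.le)
      linarith
    have hup := hν₀.upper _ measurableSet_ball hball
    rw [volume_real_ball hm _ (by positivity), ← hV, div_pow] at hup
    have hnq : n * ν₀.real (Metric.ball y (ρ / s ^ 2)) ≤ s⁻¹ * M := by
      calc _ ≤ n * (s * κ * (ρ ^ m / (s ^ 2) ^ m * V)) := by gcongr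
        _ = s / (s ^ 2) ^ m * M := by rw [← hM]; field_simp
        _ ≤ s⁻¹ * M := by
          refine mul_le_mul_of_nonneg_right ?_ M.cast_nonneg
          rw [div_le_iff₀ (by positivity), ← div_eq_inv_mul, le_div_iff₀ hs0, ← pow_two]
          exact le_self_pow₀ (one_le_pow₀ hs.le) (by omega)
    refine le_trans (measure_mono ?_) (h n _ (measurableSet_ball) M M.cast_nonneg hnq)
    exact fun w hw => hw.2
  · have : {w : Fin n → E m | (w, y) ∈ nearSet y₀ (ρ / s ^ 4) (ρ / s ^ 2) M} = ∅ :=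
      Set.eq_empty_iff_forall_notMem.2 fun w hw => hy hw.1
    rw [this, measure_empty]
    exact zero_le

end Neighbourhood

/-! ### The asymptotic regime and the limits of the scaled counts -/

/-- The sample sizes `N`, `N₁ N` and the numbers of matches `M N`, with radii `ρ N` around a point
where the first density is `κ`: the ball of radius `ρ N` is expected to contain `M N` points. -/
structure MatchingRegime (m : ℕ) (κ : ℝ) (M N₁ : ℕ → ℕ) (ρ : ℕ → ℝ) : Prop where
  dim : 1 ≤ m
  pos : 0 < κ
  frac : Tendsto (fun N : ℕ => (M N : ℝ) / N) atTop (𝓝 0)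
  mean : Tendsto (fun N : ℕ => (M N : ℝ) * (N₁ N : ℝ) / N) atTop atTop
  count : Tendsto M atTop atTop
  radius_nonneg : ∀ N, 0 ≤ ρ N
  radius : Tendsto ρ atTop (𝓝 0)
  radius_pow : ∀ᶠ N in atTop, N * (κ * ρ N ^ m * unitBallVolume m) = M N

namespace MatchingRegime

variable {m : ℕ} {κ : ℝ} {M N₁ : ℕ → ℕ} {ρ : ℕ → ℝ}

lemma eventually_pos (h : MatchingRegime m κ M N₁ ρ) :
    ∀ᶠ N : ℕ in atTop, 0 < N ∧ 0 < M N ∧ 0 < N₁ N := by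
  filter_upwards [eventually_gt_atTop 0, h.count.eventually_gt_atTop 0,
    h.mean.eventually_gt_atTop 0] with N h1 h2 h3
  refine ⟨h1, h2, Nat.pos_of_ne_zero fun h0 => ?_⟩
  rw [h0] at h3
  simp at h3

lemma tendsto_scale (h : MatchingRegime m κ M N₁ ρ) :
    Tendsto (fun N : ℕ => (N : ℝ) / (N₁ N * M N)) atTop (𝓝 0) := by
  refine h.mean.inv_tendsto_atTop.congr fun N => ?_
  rw [Pi.inv_apply, inv_div, mul_comm (N₁ N : ℝ)]

lemma tendsto_scale_pow (h : MatchingRegime m κ M N₁ ρ) {p : ℕ} (hp : 0 < p) :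
    Tendsto (fun N : ℕ => ENNReal.ofReal ((N : ℝ) / (N₁ N * M N)) ^ p) atTop (𝓝 0) := by
  have := (ENNReal.continuous_ofReal.tendsto 0).comp h.tendsto_scale
  rw [ENNReal.ofReal_zero] at this
  have h2 := (ENNReal.continuous_pow p).tendsto 0 |>.comp this
  rw [zero_pow hp.ne'] at h2
  exact h2

lemma scale_mul_eq {N : ℕ} (h : 0 < N ∧ 0 < M N ∧ 0 < N₁ N) :
    ENNReal.ofReal ((N : ℝ) / (N₁ N * M N)) * (N₁ N : ℝ≥0∞) = (N : ℝ≥0∞) / (M N : ℝ≥0∞) := by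
  have h1 : (0 : ℝ) < M N := by exact_mod_cast h.2.1
  have h2 : (0 : ℝ) < N₁ N := by exact_mod_cast h.2.2
  rw [← ENNReal.ofReal_natCast (N₁ N), ← ENNReal.ofReal_mul (by positivity),
    ← ENNReal.ofReal_natCast N, ← ENNReal.ofReal_natCast (M N), ← ENNReal.ofReal_div_of_pos h1]
  congr 1
  field_simp

lemma ratio_eq {N : ℕ} (h : 0 < N ∧ 0 < M N ∧ 0 < N₁ N) :
    (N : ℝ≥0∞) / (M N : ℝ≥0∞) = ENNReal.ofReal ((N : ℝ) / M N) := by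
  have h1 : (0 : ℝ) < M N := by exact_mod_cast h.2.1
  rw [ENNReal.ofReal_div_of_pos h1, ENNReal.ofReal_natCast, ENNReal.ofReal_natCast]

/-- The p-th moment of a binomial count is bounded by a constant times one plus the p-th power of
its mean. The scale N/(N₁ M) tends to 0, which removes the one, and times N₁ it is N/M, which is the
factor in the hypothesis. -/
lemma tendsto_lintegral_hits_section (h : MatchingRegime m κ M N₁ ρ) (ν₀ ν₁ : Measure (E m))
    [IsProbabilityMeasure ν₀] [IsProbabilityMeasure ν₁] {p : ℕ} (hp : 0 < p)
    {F : ∀ N : ℕ, Set ((Fin N → E m) × E m)} (hF : ∀ N, MeasurableSet (F N))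
    (hI : Tendsto (fun N : ℕ => ((N : ℝ≥0∞) / (M N : ℝ≥0∞)) ^ p *
      ∫⁻ w, ν₁ {y | (w, y) ∈ F N} ^ p ∂(Measure.pi fun _ : Fin N => ν₀)) atTop (𝓝 0)) :
    Tendsto (fun N : ℕ => ∫⁻ z : (Fin N → E m) × (Fin (N₁ N) → E m),
      (ENNReal.ofReal ((N : ℝ) / (N₁ N * M N)) *
        ENNReal.ofReal (hits {y | (z.1, y) ∈ F N} z.2)) ^ p
      ∂((Measure.pi fun _ : Fin N => ν₀).prod (Measure.pi fun _ : Fin (N₁ N) => ν₁)))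
      atTop (𝓝 0) := by
  set C : ℝ≥0∞ := ENNReal.ofReal (p.factorial * Real.exp 2 * 2 ^ p) with hC
  have hlim := ENNReal.Tendsto.const_mul (a := C) ((h.tendsto_scale_pow hp).add hI)
    (Or.inr ENNReal.ofReal_ne_top)
  rw [add_zero, mul_zero] at hlim
  refine tendsto_of_tendsto_of_tendsto_of_le_of_le' tendsto_const_nhds hlim
    (Eventually.of_forall fun _ => zero_le) ?_
  filter_upwards [h.eventually_pos] with N hN
  simp_rw [mul_pow]
  rw [lintegral_const_mul' _ _ (ENNReal.pow_ne_top ENNReal.ofReal_ne_top)]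
  refine (mul_le_mul_right (lintegral_hits_section_pow_le _ ν₁ (N₁ N) (hF N) p) _).trans
    (le_of_eq ?_)
  rw [← hC, ← scale_mul_eq hN, mul_pow]
  ring

/-- The deviation of the number of the points in a shrinking set from its mean is negligible. -/
lemma tendsto_lintegral_central (h : MatchingRegime m κ M N₁ ρ) (ν₁ : Measure (E m))
    [IsProbabilityMeasure ν₁] {p : ℕ} (hp : 0 < p) (hpe : Even p)
    {S : ℕ → Set (E m)} (hS : ∀ N, MeasurableSet (S N)) {L : ℝ}
    (hL : Tendsto (fun N : ℕ => (N : ℝ) / M N * ν₁.real (S N)) atTop (𝓝 L)) :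
    Tendsto (fun N : ℕ => ∫⁻ y : Fin (N₁ N) → E m,
      (ENNReal.ofReal ((N : ℝ) / (N₁ N * M N)) *
        ENNReal.ofReal |hits (S N) y - N₁ N * ν₁.real (S N)|) ^ p
      ∂(Measure.pi fun _ : Fin (N₁ N) => ν₁)) atTop (𝓝 0) := by
  obtain ⟨e, rfl⟩ := hpe
  have he : 0 < e := by omega
  rw [← two_mul] at *
  set C : ℝ := 2 * (2 * e).factorial * Real.exp 1 with hC
  -- With p = 2e and c = N/(N₁ M), the scaled moment is at most C c^{2e} (1 + N₁ ν₁(S))^e. One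
  -- factor c^e makes the last factor converge; the other tends to 0.
  have hlim : Tendsto (fun N : ℕ => C * (((N : ℝ) / (N₁ N * M N)) ^ e *
      ((N : ℝ) / (N₁ N * M N) + (N : ℝ) / M N * ν₁.real (S N)) ^ e)) atTop (𝓝 0) := by
    have := ((h.tendsto_scale.pow e).mul ((h.tendsto_scale.add hL).pow e)).const_mul C
    rwa [zero_pow he.ne', zero_mul, mul_zero] at this
  have hlim' := (ENNReal.continuous_ofReal.tendsto 0).comp hlim
  rw [ENNReal.ofReal_zero] at hlim'
  refine tendsto_of_tendsto_of_tendsto_of_le_of_le' tendsto_const_nhds hlim'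
    (Eventually.of_forall fun _ => zero_le) ?_
  filter_upwards [h.eventually_pos] with N hN
  have h1 : (0 : ℝ) < M N := by exact_mod_cast hN.2.1
  have h2 : (0 : ℝ) < N₁ N := by exact_mod_cast hN.2.2
  simp_rw [mul_pow]
  rw [lintegral_const_mul' _ _ (ENNReal.pow_ne_top ENNReal.ofReal_ne_top)]
  simp_rw [← ENNReal.ofReal_pow (abs_nonneg _)]
  refine (mul_le_mul_right (lintegral_hits_central_pow_le ν₁ (N₁ N) (hS N) e) _).trans
    (le_of_eq ?_)
  rw [← ENNReal.ofReal_pow (by positivity), ← ENNReal.ofReal_mul (by positivity),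
    Function.comp_apply, ← hC]
  congr 1
  have h3 : (N : ℝ) / (N₁ N * M N) + (N : ℝ) / M N * ν₁.real (S N)
      = (N : ℝ) / (N₁ N * M N) * (1 + N₁ N * ν₁.real (S N)) := by
    field_simp
  rw [h3, two_mul, pow_add, mul_pow]
  ring

/-! ### Counts in shrinking balls, exceptional sets and dyadic balls -/

section Ball

variable {ν₁ : Measure (E m)} {f₁ : E m → ℝ} {y₀ : E m}

/-- The expected number of the points in a ball whose radius is a multiple of `ρ N`. -/
lemma tendsto_real_closedBall [IsFiniteMeasure ν₁] (h : MatchingRegime m κ M N₁ ρ)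
    (hf₁ : Measurable f₁)
    (hf₁0 : ∀ y, 0 ≤ f₁ y) (hν₁ : ν₁ = volume.withDensity (fun y => ENNReal.ofReal (f₁ y)))
    (hc : ContinuousAt f₁ y₀) {a : ℝ} (ha : 0 ≤ a) :
    Tendsto (fun N : ℕ => (N : ℝ) / M N * ν₁.real (Metric.closedBall y₀ (a * ρ N))) atTop
      (𝓝 (f₁ y₀ / κ * a ^ m)) := by
  have hκ := h.pos
  have hV := unitBallVolume_pos m
  refine Metric.tendsto_nhds.2 fun ε hε => ?_
  -- A deviation δ of the density shifts the limit by δ a^m/κ, which this choice keeps below ε even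
  -- when a = 0.
  set δ := ε * κ / (2 * (a ^ m + 1)) with hδ
  have ham : 0 ≤ a ^ m := by positivity
  have hδ0 : 0 < δ := by positivity
  obtain ⟨r, hr, hball⟩ := Metric.continuousAt_iff.1 hc δ hδ0
  have hsmall : ∀ᶠ N in atTop, a * ρ N < r := by
    have := h.radius.const_mul a
    rw [mul_zero] at this
    exact this.eventually_lt_const hr
  filter_upwards [h.eventually_pos, h.radius_pow, hsmall] with N hN hρ hr
  have h1 : (0 : ℝ) < M N := by exact_mod_cast hN.2.1
  have h0 : (0 : ℝ) < N := by exact_mod_cast hN.1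
  have hmem : ∀ y ∈ Metric.closedBall y₀ (a * ρ N), |f₁ y - f₁ y₀| < δ := fun y hy => by
    have := hball ((Metric.mem_closedBall.1 hy).trans_lt hr)
    rwa [Real.dist_eq] at this
  have haρ : 0 ≤ a * ρ N := mul_nonneg ha (h.radius_nonneg N)
  have hup := real_le_of_density_le hν₁ (Metric.isClosed_closedBall (x := y₀)
    (ε := a * ρ N)).measurableSet measure_closedBall_lt_top.ne (b := f₁ y₀ + δ)
    (by linarith [hf₁0 y₀]) (fun y hy => by linarith [(abs_lt.1 (hmem y hy)).2])
  -- The lower density bound must be nonnegative, hence the maximum with 0 when f₁(y₀) is smaller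
  -- than δ.
  have hlow := le_real_of_le_density hf₁ hν₁ (Metric.isClosed_closedBall (x := y₀)
    (ε := a * ρ N)).measurableSet (b := max (f₁ y₀ - δ) 0)
    (le_max_right _ _) (fun y hy => max_le (by linarith [(abs_lt.1 (hmem y hy)).1]) (hf₁0 y))
  rw [volume_real_closedBall _ haρ] at hup hlow
  have hlow' : (f₁ y₀ - δ) * ((a * ρ N) ^ m * unitBallVolume m)
      ≤ ν₁.real (Metric.closedBall y₀ (a * ρ N)) := by
    refine le_trans ?_ hlow
    gcongr
    exact le_max_left _ _
  set q := ν₁.real (Metric.closedBall y₀ (a * ρ N))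
  have hvol : (N : ℝ) / M N * ((a * ρ N) ^ m * unitBallVolume m) = a ^ m / κ := by
    rw [← hρ, mul_pow]
    have : 0 < ρ N ^ m := by
      by_contra hneg
      have h3 : ρ N ^ m = 0 := le_antisymm (not_lt.1 hneg) (pow_nonneg (h.radius_nonneg N) m)
      rw [h3] at hρ
      simp at hρ
      linarith
    field_simp
  have hNM : 0 < (N : ℝ) / M N := by positivity
  have hup2 := mul_le_mul_of_nonneg_left hup hNM.le
  have hlow2 := mul_le_mul_of_nonneg_left hlow' hNM.le
  have e1 : (N : ℝ) / M N * ((f₁ y₀ + δ) * ((a * ρ N) ^ m * unitBallVolume m))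
      = f₁ y₀ / κ * a ^ m + δ * (a ^ m / κ) := by
    rw [mul_left_comm, hvol]; ring
  have e2 : (N : ℝ) / M N * ((f₁ y₀ - δ) * ((a * ρ N) ^ m * unitBallVolume m))
      = f₁ y₀ / κ * a ^ m - δ * (a ^ m / κ) := by
    rw [mul_left_comm, hvol]; ring
  rw [e1] at hup2
  rw [e2] at hlow2
  have h4 : δ * (a ^ m / κ) < ε := by
    rw [hδ]
    have : ε * κ / (2 * (a ^ m + 1)) * (a ^ m / κ) = ε * (a ^ m / (2 * (a ^ m + 1))) := by
      field_simp
    rw [this]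
    refine mul_lt_of_lt_one_right hε ?_
    rw [div_lt_one (by positivity)]
    linarith
  rw [Real.dist_eq, abs_lt]
  constructor <;> linarith

variable {ν₀ : Measure (E m)} [IsProbabilityMeasure ν₀] {s u b : ℝ}

/-- By Minkowski, the p-th moment of the measure of the section is at most the p-th power of the
ν₁-integral of the p-th root of the Chernoff bound. That integral is O(1/N), and N/M times it is
O(1/M). -/
lemma tendsto_lintegral_farSet [IsProbabilityMeasure ν₁] (h : MatchingRegime m κ M N₁ ρ)
    (hf₁ : Measurable f₁) (hν₁ : ν₁ = volume.withDensity (fun y => ENNReal.ofReal (f₁ y)))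
    (hs : 1 < s) (hu : 0 < u) (hν₀ : DensityNear ν₀ y₀ κ s (2 * u)) (hb0 : 0 < b)
    (hb : ∀ y ∈ Metric.ball y₀ (2 * u), f₁ y ≤ b) {p : ℕ} (hp : 0 < p) :
    Tendsto (fun N : ℕ => ((N : ℝ≥0∞) / (M N : ℝ≥0∞)) ^ p *
      ∫⁻ w, ν₁ {y | (w, y) ∈ farSet y₀ (s ^ 2) (s ^ 4 * ρ N) u (u / 6) (M N)} ^ p
        ∂(Measure.pi fun _ : Fin N => ν₀)) atTop (𝓝 0) := by
  obtain ⟨c, hc, hfar⟩ := exists_pi_farSet_le h.dim h.pos hs hu hν₀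
  have hV := unitBallVolume_pos m
  have hp0 : (0 : ℝ) < p := by exact_mod_cast hp
  set a := c / p with ha
  have ha0 : 0 < a := by positivity
  -- The first term comes from the radial exponential within u, the second from exp(−aN) ≤ 1/(aN)
  -- beyond u.
  set K := b * unitBallVolume m / a + 1 / a with hK
  have hlim : Tendsto (fun N : ℕ => ENNReal.ofReal (K / M N) ^ p) atTop (𝓝 0) := by
    have h1 : Tendsto (fun N : ℕ => K / M N) atTop (𝓝 0) :=
      tendsto_const_nhds.div_atTop (tendsto_natCast_atTop_atTop.comp h.count)
    have := (ENNReal.continuous_ofReal.tendsto 0).comp h1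
    rw [ENNReal.ofReal_zero] at this
    have h2 := (ENNReal.continuous_pow p).tendsto 0 |>.comp this
    rwa [zero_pow hp.ne'] at h2
  refine tendsto_of_tendsto_of_tendsto_of_le_of_le' tendsto_const_nhds hlim
    (Eventually.of_forall fun _ => zero_le) ?_
  filter_upwards [h.eventually_pos, h.radius_pow, h.frac.eventually_lt_const hc] with N hN hρ hMc
  have hM0 : (0 : ℝ) < M N := by exact_mod_cast hN.2.1
  have hN0 : (0 : ℝ) < N := by exact_mod_cast hN.1
  rw [div_lt_iff₀ hN0] at hMc
  set β : E m → ℝ≥0∞ := fun y => if ‖y - y₀‖ ≤ u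
    then ENNReal.ofReal (Real.exp (-(a * N * ‖y - y₀‖ ^ m)))
    else ENNReal.ofReal (Real.exp (-(a * N))) with hβ
  have hball : MeasurableSet {y : E m | ‖y - y₀‖ ≤ u} :=
    measurableSet_le (by fun_prop) measurable_const
  have hβm : Measurable β := Measurable.ite hball (by fun_prop) measurable_const
  have hexp : ∀ x : ℝ, ENNReal.ofReal (Real.exp (-(a * N * x))) ^ p
      = ENNReal.ofReal (Real.exp (-(c * N * x))) := by
    intro x
    rw [← ENNReal.ofReal_pow (Real.exp_pos _).le, ← Real.exp_nat_mul, ha]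
    congr 2
    field_simp
  have key := lintegral_measure_section_pow_le (Measure.pi fun _ : Fin N => ν₀) ν₁
    (measurableSet_farSet y₀ (s ^ 2) (s ^ 4 * ρ N) u (u / 6) (M N)) hp hβm
    (fun y => by simp only [hβ]; split_ifs <;> simp [Real.exp_pos])
    (fun y => by simp only [hβ]; split_ifs <;> simp)
    (fun y => by
      refine (hfar N (M N) (ρ N) (h.radius_nonneg N) hρ hMc.le y).trans (le_of_eq ?_)
      simp only [hβ]
      split_ifs
      · exact (hexp _).symm
      · have := hexp 1
        simp only [mul_one] at this
        exact this.symm)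
  have hint : ∫⁻ y, β y ∂ν₁ ≤ ENNReal.ofReal (K / N) := by
    rw [← lintegral_add_compl β hball]
    have hA : ∫⁻ y in {y : E m | ‖y - y₀‖ ≤ u}, β y ∂ν₁
        ≤ ENNReal.ofReal (b * unitBallVolume m / (a * N)) := by
      rw [setLIntegral_congr_fun hball (g := fun y =>
        ENNReal.ofReal (Real.exp (-(a * N * ‖y - y₀‖ ^ m)))) (fun y (hy : ‖y - y₀‖ ≤ u) => by
          simp only [hβ, if_pos hy])]
      refine setLIntegral_exp_neg_le h.dim hf₁ hν₁ hball hb0.le (fun y hy => hb y ?_) y₀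
        (by positivity)
      rw [Metric.mem_ball, dist_eq_norm]
      exact lt_of_le_of_lt hy (by linarith)
    have hB : ∫⁻ y in {y : E m | ‖y - y₀‖ ≤ u}ᶜ, β y ∂ν₁ ≤ ENNReal.ofReal (1 / (a * N)) := by
      rw [setLIntegral_congr_fun hball.compl (g := fun _ =>
        ENNReal.ofReal (Real.exp (-(a * N)))) (fun y (hy : ¬ ‖y - y₀‖ ≤ u) => by
          simp only [hβ, if_neg hy]), setLIntegral_const]
      refine (mul_le_of_le_one_right zero_le prob_le_one).trans (ENNReal.ofReal_le_ofReal ?_)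
      rw [Real.exp_neg, ← one_div]
      exact one_div_le_one_div_of_le (by positivity)
        (by linarith [Real.add_one_le_exp (a * N)])
    refine (add_le_add hA hB).trans (le_of_eq ?_)
    rw [← ENNReal.ofReal_add (by positivity) (by positivity), hK]
    congr 1
    field_simp
  calc _ ≤ ((N : ℝ≥0∞) / (M N : ℝ≥0∞)) ^ p * (∫⁻ y, β y ∂ν₁) ^ p := by gcongr
    _ = ((N : ℝ≥0∞) / (M N : ℝ≥0∞) * ∫⁻ y, β y ∂ν₁) ^ p := (mul_pow _ _ _).symm
    _ ≤ (ENNReal.ofReal ((N : ℝ) / M N) * ENNReal.ofReal (K / N)) ^ p := by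
        rw [ratio_eq hN]; gcongr
    _ = _ := by
        rw [← ENNReal.ofReal_mul (by positivity)]
        congr 2
        field_simp

/-- The sections lie in a ball of ν₁-measure O(M/N), which compensates N/M; the Chernoff factor, of
p-th root exp(−aM) ≤ 1/(aM), is what tends to 0. -/
lemma tendsto_lintegral_nearSet [IsProbabilityMeasure ν₁] (h : MatchingRegime m κ M N₁ ρ)
    (hν₁ : ν₁ = volume.withDensity (fun y => ENNReal.ofReal (f₁ y)))
    (hs : 1 < s) (hu : 0 < u) (hν₀ : DensityNear ν₀ y₀ κ s (2 * u)) (hb0 : 0 < b)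
    (hb : ∀ y ∈ Metric.ball y₀ (2 * u), f₁ y ≤ b) {p : ℕ} (hp : 0 < p) :
    Tendsto (fun N : ℕ => ((N : ℝ≥0∞) / (M N : ℝ≥0∞)) ^ p *
      ∫⁻ w, ν₁ {y | (w, y) ∈ nearSet y₀ (ρ N / s ^ 4) (ρ N / s ^ 2) (M N)} ^ p
        ∂(Measure.pi fun _ : Fin N => ν₀)) atTop (𝓝 0) := by
  obtain ⟨c, hc, hnear⟩ := exists_pi_nearSet_le h.dim h.pos hs hν₀
  have hV := unitBallVolume_pos m
  have hκ := h.pos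
  have hp0 : (0 : ℝ) < p := by exact_mod_cast hp
  set a := c / p with ha
  have ha0 : 0 < a := by positivity
  have hlim : Tendsto (fun N : ℕ => ENNReal.ofReal (b / κ * (1 / (a * M N))) ^ p)
      atTop (𝓝 0) := by
    have h1 : Tendsto (fun N : ℕ => b / κ * (1 / (a * M N))) atTop (𝓝 0) := by
      have : Tendsto (fun N : ℕ => 1 / (a * M N)) atTop (𝓝 0) :=
        tendsto_const_nhds.div_atTop
          ((tendsto_natCast_atTop_atTop.comp h.count).const_mul_atTop ha0)
      simpa using this.const_mul (b / κ)
    have := (ENNReal.continuous_ofReal.tendsto 0).comp h1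
    rw [ENNReal.ofReal_zero] at this
    have h2 := (ENNReal.continuous_pow p).tendsto 0 |>.comp this
    rwa [zero_pow hp.ne'] at h2
  refine tendsto_of_tendsto_of_tendsto_of_le_of_le' tendsto_const_nhds hlim
    (Eventually.of_forall fun _ => zero_le) ?_
  filter_upwards [h.eventually_pos, h.radius_pow, h.radius.eventually_lt_const hu] with N hN hρ hρu
  have hM0 : (0 : ℝ) < M N := by exact_mod_cast hN.2.1
  have hN0 : (0 : ℝ) < N := by exact_mod_cast hN.1
  set B := Metric.closedBall y₀ (ρ N / s ^ 4) with hB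
  have hBm : MeasurableSet B := Metric.isClosed_closedBall.measurableSet
  have hs0 : 0 < s := by linarith
  have hρs : ρ N / s ^ 4 ≤ ρ N := div_le_self (h.radius_nonneg N) (one_le_pow₀ hs.le)
  have hBvol : ν₁ B ≤ ENNReal.ofReal (b / κ * (M N / N)) := by
    rw [← ENNReal.ofReal_toReal (measure_ne_top ν₁ B)]
    refine ENNReal.ofReal_le_ofReal ?_
    have h1 := real_le_of_density_le hν₁ hBm measure_closedBall_lt_top.ne hb0.le
      (fun y hy => hb y (Metric.closedBall_subset_ball (by linarith) hy))
    rw [hB, volume_real_closedBall _ (div_nonneg (h.radius_nonneg N) (by positivity))] at h1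
    refine h1.trans ?_
    calc b * ((ρ N / s ^ 4) ^ m * unitBallVolume m) ≤ b * (ρ N ^ m * unitBallVolume m) := by
          gcongr
          exact div_nonneg (h.radius_nonneg N) (by positivity)
      _ = _ := by rw [← hρ]; field_simp
  have key := lintegral_measure_section_pow_le (Measure.pi fun _ : Fin N => ν₀) (ν₁.restrict B)
    (measurableSet_nearSet y₀ (ρ N / s ^ 4) (ρ N / s ^ 2) (M N)) hp
    (b := fun _ => ENNReal.ofReal (Real.exp (-(a * M N)))) measurable_const
    (fun y => by simp [Real.exp_pos]) (fun y => by simp)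
    (fun y => by
      refine (hnear N (M N) (ρ N) (h.radius_nonneg N) hρu.le hρ y).trans (le_of_eq ?_)
      rw [← ENNReal.ofReal_pow (Real.exp_pos _).le, ← Real.exp_nat_mul, ha]
      congr 2
      field_simp)
  -- Restricting ν₁ to the small ball loses nothing, but makes the integral of the constant Chernoff
  -- root small.
  have hsec : ∀ w : Fin N → E m,
      (ν₁.restrict B) {y | (w, y) ∈ nearSet y₀ (ρ N / s ^ 4) (ρ N / s ^ 2) (M N)}
        = ν₁ {y | (w, y) ∈ nearSet y₀ (ρ N / s ^ 4) (ρ N / s ^ 2) (M N)} := by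
    intro w
    have hm : MeasurableSet {y | (w, y) ∈ nearSet y₀ (ρ N / s ^ 4) (ρ N / s ^ 2) (M N)} :=
      measurable_prodMk_left (measurableSet_nearSet y₀ (ρ N / s ^ 4) (ρ N / s ^ 2) (M N))
    rw [Measure.restrict_apply hm]
    congr 1
    refine Set.inter_eq_left.2 fun y hy => ?_
    rw [hB, Metric.mem_closedBall, dist_eq_norm]
    exact hy.1
  simp_rw [hsec] at key
  rw [lintegral_const, Measure.restrict_apply_univ] at key
  calc _ ≤ ((N : ℝ≥0∞) / (M N : ℝ≥0∞)) ^ p *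
          (ENNReal.ofReal (Real.exp (-(a * M N))) * ν₁ B) ^ p := by gcongr
    _ = ((N : ℝ≥0∞) / (M N : ℝ≥0∞) * (ENNReal.ofReal (Real.exp (-(a * M N))) * ν₁ B)) ^ p :=
        (mul_pow _ _ _).symm
    _ ≤ (ENNReal.ofReal ((N : ℝ) / M N) * (ENNReal.ofReal (1 / (a * M N)) *
          ENNReal.ofReal (b / κ * (M N / N)))) ^ p := by
        rw [ratio_eq hN]
        gcongr
        rw [Real.exp_neg, ← one_div]
        exact one_div_le_one_div_of_le (by positivity)
          (by linarith [Real.add_one_le_exp (a * M N)])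
    _ = _ := by
        rw [← ENNReal.ofReal_mul (by positivity), ← ENNReal.ofReal_mul (by positivity)]
        congr 2
        field_simp

/-- The numbers of the points in the balls of radii `2 ^ (i + 1) * a * ρ N` exceed twice the bounds
of their means by negligible amounts, uniformly in `i`. -/
lemma tendsto_lintegral_excess [IsProbabilityMeasure ν₁] (h : MatchingRegime m κ M N₁ ρ)
    (hν₁ : ν₁ = volume.withDensity (fun y => ENNReal.ofReal (f₁ y))) (hu : 0 < u) (hb0 : 0 < b)
    (hb : ∀ y ∈ Metric.ball y₀ (2 * u), f₁ y ≤ b) {a : ℝ} (ha : 1 ≤ a) {p : ℕ} (hp : 0 < p) :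
    Tendsto (fun N : ℕ => ∫⁻ y : Fin (N₁ N) → E m, ∑' i : ℕ,
      (ENNReal.ofReal ((N : ℝ) / (N₁ N * M N)) *
        ENNReal.ofReal (hits (Metric.closedBall y₀ (min (2 ^ (i + 1) * (a * ρ N)) u)) y -
          2 * (N₁ N * (b * ((2 ^ (i + 1) * (a * ρ N)) ^ m * unitBallVolume m))))) ^ p
      ∂(Measure.pi fun _ : Fin (N₁ N) => ν₁)) atTop (𝓝 0) := by
  have hV := unitBallVolume_pos m
  have hκ := h.pos
  have hsum : Summable fun i : ℕ => Real.exp (-((i : ℝ) + 1)) := by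
    have h1 := Real.summable_exp_neg_nat.mul_left (Real.exp (-1))
    refine h1.congr fun i => ?_
    rw [← Real.exp_add]
    ring_nf
  set K : ℝ≥0∞ := ENNReal.ofReal (p.factorial * ∑' i : ℕ, Real.exp (-((i : ℝ) + 1))) with hK
  have hlim := ENNReal.Tendsto.mul_const (b := K) (h.tendsto_scale_pow hp)
    (Or.inr ENNReal.ofReal_ne_top)
  rw [zero_mul] at hlim
  refine tendsto_of_tendsto_of_tendsto_of_le_of_le' tendsto_const_nhds hlim
    (Eventually.of_forall fun _ => zero_le) ?_
  filter_upwards [h.eventually_pos, h.radius_pow,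
    h.mean.eventually_ge_atTop (4 * κ / b)] with N hN hρ hmean
  have hM0 : (0 : ℝ) < M N := by exact_mod_cast hN.2.1
  have hN0 : (0 : ℝ) < N := by exact_mod_cast hN.1
  have hN10 : (0 : ℝ) < N₁ N := by exact_mod_cast hN.2.2
  have hρ0 := h.radius_nonneg N
  simp_rw [mul_pow _ (ENNReal.ofReal _) p]
  rw [lintegral_tsum fun i => ((((measurable_hits
    Metric.isClosed_closedBall.measurableSet).sub_const _).ennreal_ofReal.pow_const p).const_mul
      _).aemeasurable]
  simp_rw [lintegral_const_mul' _ _ (ENNReal.pow_ne_top ENNReal.ofReal_ne_top)]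
  rw [ENNReal.tsum_mul_left]
  gcongr
  rw [hK, ← tsum_mul_left, ENNReal.ofReal_tsum_of_nonneg (fun i => by positivity)
    (hsum.mul_left _)]
  refine ENNReal.tsum_le_tsum fun i => ?_
  set R := 2 ^ (i + 1) * (a * ρ N) with hR
  have hR0 : 0 ≤ R := by positivity
  refine (lintegral_hits_excess_pow_le ν₁ (N₁ N) Metric.isClosed_closedBall.measurableSet hp.ne'
    (μ := N₁ N * (b * (R ^ m * unitBallVolume m))) ?_).trans (ENNReal.ofReal_le_ofReal ?_)
  · refine mul_le_mul_of_nonneg_left ?_ hN10.le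
    have hmin : 0 ≤ min R u := le_min hR0 hu.le
    refine (real_le_of_density_le hν₁ Metric.isClosed_closedBall.measurableSet
      measure_closedBall_lt_top.ne hb0.le (fun y hy => hb y
        (Metric.closedBall_subset_ball ?_ hy))).trans ?_
    · exact (min_le_right _ _).trans_lt (by linarith)
    · rw [volume_real_closedBall _ hmin]
      gcongr
      exact min_le_left _ _
  · gcongr
    have h1 : N₁ N * (b * (R ^ m * unitBallVolume m))
        = b / κ * (M N * N₁ N / N) * (2 ^ (i + 1) * a) ^ m := by
      rw [hR, ← hρ, mul_pow _ (a * ρ N), mul_pow a, mul_pow _ a]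
      field_simp
    -- The mean bound grows geometrically in i and carries the factor M N₁/N; once it is at least
    -- 4(i + 1), the i-th excess is at most p! e^{−(i+1)}, which is summable.
    have h2 : (i : ℝ) + 1 ≤ (2 ^ (i + 1) * a) ^ m := by
      have h3 : ((i + 1 : ℕ) : ℝ) < 2 ^ (i + 1) := by exact_mod_cast Nat.lt_two_pow_self
      push_cast at h3
      have h4 : (1 : ℝ) ≤ 2 ^ (i + 1) := one_le_pow₀ one_le_two
      calc (i : ℝ) + 1 ≤ 2 ^ (i + 1) * a := by nlinarith
        _ ≤ _ := le_self_pow₀ (by nlinarith) (by have := h.dim; omega)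
    have h5 : 4 ≤ b / κ * (M N * N₁ N / N) := by
      calc (4 : ℝ) = b / κ * (4 * κ / b) := by field_simp
        _ ≤ _ := by gcongr
    rw [h1]
    have h6 : 4 * ((i : ℝ) + 1) ≤ b / κ * (M N * N₁ N / N) * (2 ^ (i + 1) * a) ^ m :=
      mul_le_mul h5 h2 (by positivity) (by positivity)
    linarith

end Ball

end MatchingRegime

/-! ### Order statistics as counts -/

section OrderStatistic

lemma hits_le_hits {α β : Type*} {k : ℕ} {G : Set α} {H : Set β} {w : Fin k → α} {v : Fin k → β}
    (h : ∀ i, w i ∈ G → v i ∈ H) : hits G w ≤ hits H v := by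
  refine Finset.sum_le_sum fun i _ => ?_
  by_cases hi : w i ∈ G
  · simp [hi, h i hi]
  · rw [Set.indicator_of_notMem hi]
    exact Set.indicator_nonneg (fun _ _ => zero_le_one) _

lemma hits_eq_card {α : Type*} {k : ℕ} (G : Set α) [DecidablePred (· ∈ G)] (y : Fin k → α) :
    hits G y = (Finset.univ.filter fun i => y i ∈ G).card := by
  unfold hits
  rw [Finset.card_filter]
  push_cast
  exact Finset.sum_congr rfl fun i _ => by rw [Set.indicator_apply]

/-- Turns catchment membership into a statement on counts of points in balls. The M-th statistic
sits at index M − 1 of the sorted tuple, hence the shift between < and ≤. -/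
lemma orderStat_lt_iff {n M : ℕ} (hM : 1 ≤ M) (hMn : M ≤ n) (a : Fin n → ℝ) (t : ℝ) :
    orderStat M a < t ↔ (M : ℝ) ≤ hits (Set.Iio t) a := by
  classical
  have h : M - 1 < n := by omega
  rw [orderStat, dif_pos h, hits_eq_card, Nat.cast_le]
  have h1 := Tuple.lt_card_lt_iff_apply_lt_of_monotone (j := ⟨M - 1, h⟩) (a := t)
    (Tuple.monotone_sort a)
  have h2 : (Finset.univ.filter fun i => (a ∘ Tuple.sort a) i < t).card
      = (Finset.univ.filter fun i => a i ∈ Set.Iio t).card := by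
    refine Finset.card_equiv (Tuple.sort a) fun i => ?_
    simp
  rw [Function.comp_apply] at h1
  rw [← h1, h2]
  change M - 1 < _ ↔ _
  omega

lemma measurable_orderStat {n : ℕ} (M : ℕ) :
    Measurable (fun a : Fin n → ℝ => orderStat M a) := by
  by_cases h : M - 1 < n
  · refine measurable_of_Iio fun t => ?_
    -- Writing M − 1 + 1 covers M = 0, where truncated subtraction selects the smallest entry.
    have h1 : (fun a : Fin n → ℝ => orderStat M a) ⁻¹' Set.Iio t
        = {a | (((M - 1 : ℕ) + 1 : ℕ) : ℝ) ≤ hits (Set.Iio t) a} := by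
      ext a
      rw [Set.mem_preimage, Set.mem_Iio, Set.mem_ofPred_eq,
        ← orderStat_lt_iff (by omega) (by omega)]
      simp [orderStat]
    rw [h1]
    exact measurableSet_le measurable_const (measurable_hits measurableSet_Iio)
  · simp only [orderStat, dif_neg h]
    exact measurable_const

end OrderStatistic

/-! ### Catchment areas of φ̂ compared with balls of φ -/

section Catchment

variable {d m n k : ℕ} {𝒳 𝒵 : Set (E d)} {φ g : E d → E m}

/-- The increments of `g - φ` between points whose images under `φ` have a distance of at most `T`
are at most `ε * T`, if `T` exceeds `D`. -/
def IncrementBound (𝒳 : Set (E d)) (φ g : E d → E m) (ε : ℝ) (D : ℝ≥0∞) : Prop :=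
  ∀ s ∈ 𝒳, ∀ t ∈ 𝒳, ∀ T : ℝ, D < ENNReal.ofReal T → ‖φ s - φ t‖ ≤ T →
    ‖(g s - φ s) - (g t - φ t)‖ ≤ ε * T

lemma norm_sub_le_of_increment {a b a' b' : E m} {e : ℝ} (h : ‖(a - a') - (b - b')‖ ≤ e) :
    ‖a - b‖ ≤ ‖a' - b'‖ + e := by
  have : a - b = (a' - b') + ((a - a') - (b - b')) := by abel
  rw [this]
  exact (norm_add_le _ _).trans (by linarith)

lemma le_norm_sub_of_increment {a b a' b' : E m} {e : ℝ} (h : ‖(a - a') - (b - b')‖ ≤ e) :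
    ‖a' - b'‖ - e ≤ ‖a - b‖ := by
  have : a' - b' = (a - b) - ((a - a') - (b - b')) := by abel
  have h2 : ‖a' - b'‖ ≤ ‖a - b‖ + ‖(a - a') - (b - b')‖ := by
    rw [this]
    exact norm_sub_le _ _
  linarith

variable {M : ℕ} {xs : Fin n → E d} {x z : E d} {θ : ℝ} {D : ℝ≥0∞}

/-- With ε = (θ − 1)/(θ + 1) one has (1 + ε)/θ = 1 − ε. Writing r for the distance of φ z and φ x, a
point within r/θ of φ z has a g-distance from z below (1 − ε) r, hence below that of x; M such
points would exclude z from the catchment area. -/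
lemma hits_ball_lt_of_mem_catchment (hM : 1 ≤ M) (hMn : M ≤ n) (hθ : 1 < θ)
    (hg : IncrementBound 𝒳 φ g ((θ - 1) / (θ + 1)) D) (hx : x ∈ 𝒳) (hz : z ∈ 𝒳)
    (hxs : ∀ i, xs i ∈ 𝒳) (hzA : z ∈ catchment 𝒵 M xs g x)
    (hD : D < ENNReal.ofReal (‖φ z - φ x‖ / θ)) :
    hits (Metric.ball (φ z) (‖φ z - φ x‖ / θ)) (fun i => φ (xs i)) < M := by
  by_contra hcon
  rw [not_lt] at hcon
  set r := ‖φ z - φ x‖ with hr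
  set ε := (θ - 1) / (θ + 1) with hε
  have hθ1 : ε * (θ + 1) = θ - 1 := div_mul_cancel₀ _ (by linarith)
  have hrr : r / θ ≤ r := div_le_self (norm_nonneg _) hθ.le
  have h1 := hg x hx z hz r (hD.trans_le (ENNReal.ofReal_le_ofReal hrr))
    (by rw [norm_sub_rev])
  have h2 := le_norm_sub_of_increment h1
  rw [norm_sub_rev (φ x), ← hr] at h2
  have h3 : (M : ℝ) ≤ hits (Set.Iio ‖g x - g z‖) (fun i => ‖g (xs i) - g z‖) := by
    refine hcon.trans (hits_le_hits fun i hi => ?_)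
    rw [Metric.mem_ball, dist_eq_norm] at hi
    have h4 := norm_sub_le_of_increment (hg (xs i) (hxs i) z hz _ hD hi.le)
    rw [Set.mem_Iio]
    have h5 : r / θ + ε * (r / θ) = r - ε * r := by
      field_simp
      linear_combination (r) * hθ1
    linarith
  have h6 := (orderStat_lt_iff hM hMn _ _).2 h3
  exact absurd hzA.2 (not_le.2 h6)

/-- The same comparison with the uniform error only: each of the two increments involved costs 2e.
-/
lemma hits_ball_sub_lt_of_mem_catchment (hM : 1 ≤ M) (hMn : M ≤ n) {e : ℝ}
    (hg : ∀ t ∈ 𝒳, ‖g t - φ t‖ ≤ e) (hx : x ∈ 𝒳) (hz : z ∈ 𝒳)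
    (hxs : ∀ i, xs i ∈ 𝒳) (hzA : z ∈ catchment 𝒵 M xs g x) :
    hits (Metric.ball (φ z) (‖φ z - φ x‖ - 4 * e)) (fun i => φ (xs i)) < M := by
  by_contra hcon
  rw [not_lt] at hcon
  have hinc : ∀ s ∈ 𝒳, ∀ t ∈ 𝒳, ‖(g s - φ s) - (g t - φ t)‖ ≤ 2 * e := fun s hs t ht =>
    (norm_sub_le _ _).trans (by linarith [hg s hs, hg t ht])
  have h2 := le_norm_sub_of_increment (hinc x hx z hz)
  rw [norm_sub_rev (φ x)] at h2
  have h3 : (M : ℝ) ≤ hits (Set.Iio ‖g x - g z‖) (fun i => ‖g (xs i) - g z‖) := by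
    refine hcon.trans (hits_le_hits fun i hi => ?_)
    rw [Metric.mem_ball, dist_eq_norm] at hi
    have h4 := norm_sub_le_of_increment (hinc (xs i) (hxs i) z hz)
    rw [Set.mem_Iio]
    linarith
  have h6 := (orderStat_lt_iff hM hMn _ _).2 h3
  exact absurd hzA.2 (not_le.2 h6)

/-- The converse comparison: x has a g-distance from z of at most (1 + ε) T/θ = (1 − ε) T, while a
sample point outside the ball of radius T has at least (1 − ε) T. So only points in the ball can be
strictly closer than x. -/
lemma mem_catchment_of_hits_ball_lt (hM : 1 ≤ M) (hMn : M ≤ n) (hθ : 1 < θ)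
    (hg : IncrementBound 𝒳 φ g ((θ - 1) / (θ + 1)) D) (hx : x ∈ 𝒳) (hz : z ∈ 𝒳) (hz' : z ∈ 𝒵)
    (hxs : ∀ i, xs i ∈ 𝒳) {T : ℝ} (hD : D < ENNReal.ofReal (T / θ))
    (hzx : ‖φ z - φ x‖ ≤ T / θ) (h : hits (Metric.ball (φ z) T) (fun i => φ (xs i)) < M) :
    z ∈ catchment 𝒵 M xs g x := by
  refine ⟨hz', ?_⟩
  by_contra hcon
  rw [not_le, orderStat_lt_iff hM hMn] at hcon
  refine absurd (hcon.trans (hits_le_hits fun i hi => ?_)) (not_le.2 h)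
  rw [Set.mem_Iio] at hi
  rw [Metric.mem_ball, dist_eq_norm]
  by_contra hL
  rw [not_lt] at hL
  set ε := (θ - 1) / (θ + 1) with hε
  have hθ1 : ε * (θ + 1) = θ - 1 := div_mul_cancel₀ _ (by linarith)
  have hT0 : 0 < T / θ := ENNReal.ofReal_pos.1 (zero_le.trans_lt hD)
  have hθ0 : 0 < θ := by linarith
  have hT : 0 < T := by
    have := mul_pos hT0 hθ0
    rwa [div_mul_cancel₀ _ hθ0.ne'] at this
  have hε1 : 0 ≤ 1 - ε := by
    rw [hε, sub_nonneg, div_le_one (by linarith)]; linarith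
  have h1 := norm_sub_le_of_increment (hg x hx z hz _ hD (by rwa [norm_sub_rev]))
  rw [norm_sub_rev (φ x)] at h1
  have hTL : T / θ ≤ ‖φ (xs i) - φ z‖ := (div_le_self hT.le hθ.le).trans hL
  have h2 := le_norm_sub_of_increment (hg (xs i) (hxs i) z hz _
    (hD.trans_le (ENNReal.ofReal_le_ofReal hTL)) le_rfl)
  have h5 : T / θ + ε * (T / θ) = T - ε * T := by
    have hw : T = θ * (T / θ) := by field_simp
    linear_combination (T / θ) * hθ1 + (ε - 1) * hw
  nlinarith

end Catchment

/-! ### Pathwise bounds for the number of matches -/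

section Bounds

variable {d m n k : ℕ} {𝒳 𝒵 : Set (E d)} {φ g : E d → E m}
  {M : ℕ} {xs : Fin n → E d} {zs : Fin k → E d} {x : E d} {s ρ u : ℝ} {D : ℝ≥0∞}

/-- The points at a distance between `a` and `u` from `y₀` that are not farther from `y₀` than
`θ * D`. -/
def errorAnnulus (y₀ : E m) (θ a u : ℝ) (D : ℝ≥0∞) : Set (E m) :=
  {y | a < ‖y - y₀‖ ∧ ‖y - y₀‖ ≤ u ∧ ENNReal.ofReal (‖y - y₀‖ / θ) ≤ D}

lemma matchCount_eq_hits : matchCount 𝒵 M xs zs g x = hits (catchment 𝒵 M xs g x) zs := rfl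

/-- A matched point outside the ball of radius s⁴ρ is treated by its distance: up to u, either its
scale exceeds D and the increment bound puts it in `farSet`, or it lies in `errorAnnulus`; beyond u
the uniform bound u/6 puts it in `farSet`. -/
lemma matchCount_le (hM : 1 ≤ M) (hMn : M ≤ n) (hs : 1 < s)
    (hg : IncrementBound 𝒳 φ g ((s ^ 2 - 1) / (s ^ 2 + 1)) D) (hge : ∀ t ∈ 𝒳, ‖g t - φ t‖ ≤ u / 6)
    (hx : x ∈ 𝒳) (hxs : ∀ i, xs i ∈ 𝒳) (hzs : ∀ j, zs j ∈ 𝒳) :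
    matchCount 𝒵 M xs zs g x ≤
      hits (Metric.closedBall (φ x) (s ^ 4 * ρ)) (fun j => φ (zs j)) +
      hits {y | ((fun i => φ (xs i)), y) ∈ farSet (φ x) (s ^ 2) (s ^ 4 * ρ) u (u / 6) M}
        (fun j => φ (zs j)) +
      hits (errorAnnulus (φ x) (s ^ 2) (s ^ 4 * ρ) u D) (fun j => φ (zs j)) := by
  rw [matchCount_eq_hits]
  refine (hits_le_hits (H := (Metric.closedBall (φ x) (s ^ 4 * ρ) ∪
    {y | ((fun i => φ (xs i)), y) ∈ farSet (φ x) (s ^ 2) (s ^ 4 * ρ) u (u / 6) M}) ∪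
    errorAnnulus (φ x) (s ^ 2) (s ^ 4 * ρ) u D) (v := fun j => φ (zs j)) fun j hj => ?_).trans
    ((hits_union_le _ _ _).trans (add_le_add_left (hits_union_le _ _ _) _))
  have hθ : 1 < s ^ 2 := one_lt_pow₀ hs two_ne_zero
  by_cases h1 : ‖φ (zs j) - φ x‖ ≤ s ^ 4 * ρ
  · exact Or.inl (Or.inl (by rwa [Metric.mem_closedBall, dist_eq_norm]))
  rw [not_le] at h1
  by_cases h2 : ‖φ (zs j) - φ x‖ ≤ u
  · by_cases h3 : D < ENNReal.ofReal (‖φ (zs j) - φ x‖ / s ^ 2)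
    · exact Or.inl (Or.inr (Or.inl ⟨h1, h2,
        hits_ball_lt_of_mem_catchment hM hMn hθ hg hx (hzs j) hxs hj h3⟩))
    · exact Or.inr ⟨h1, h2, not_lt.1 h3⟩
  · exact Or.inl (Or.inr (Or.inr ⟨not_le.1 h2,
      hits_ball_sub_lt_of_mem_catchment hM hMn hge hx (hzs j) hxs hj⟩))

/-- The converse comparison with θ = s² and T = ρ/s²: a point of the inner ball is matched unless M
sample points lie within ρ/s² of it. -/
lemma hits_closedBall_le (hM : 1 ≤ M) (hMn : M ≤ n) (hs : 1 < s)
    (hg : IncrementBound 𝒳 φ g ((s ^ 2 - 1) / (s ^ 2 + 1)) D)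
    (hx : x ∈ 𝒳) (hxs : ∀ i, xs i ∈ 𝒳) (hzs : ∀ j, zs j ∈ 𝒳) (hzs' : ∀ j, zs j ∈ 𝒵)
    (hD : D < ENNReal.ofReal (ρ / s ^ 4)) :
    hits (Metric.closedBall (φ x) (ρ / s ^ 4)) (fun j => φ (zs j)) ≤
      matchCount 𝒵 M xs zs g x +
      hits {y | ((fun i => φ (xs i)), y) ∈ nearSet (φ x) (ρ / s ^ 4) (ρ / s ^ 2) M}
        (fun j => φ (zs j)) := by
  have hθ : 1 < s ^ 2 := one_lt_pow₀ hs two_ne_zero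
  have e : ρ / s ^ 2 / s ^ 2 = ρ / s ^ 4 := by rw [div_div, ← pow_add]
  set Y := fun j => φ (zs j) with hY
  have key : ∀ j, Y j ∈ Metric.closedBall (φ x) (ρ / s ^ 4) → zs j ∈ catchment 𝒵 M xs g x ∪
      φ ⁻¹' {y | ((fun i => φ (xs i)), y) ∈ nearSet (φ x) (ρ / s ^ 4) (ρ / s ^ 2) M} := by
    intro j hj
    rw [Metric.mem_closedBall, dist_eq_norm] at hj
    by_cases h : hits (Metric.ball (φ (zs j)) (ρ / s ^ 2)) (fun i => φ (xs i)) < M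
    · exact Or.inl (mem_catchment_of_hits_ball_lt hM hMn hθ hg hx (hzs j) (hzs' j) hxs
        (by rwa [e]) (by rwa [e]) h)
    · exact Or.inr ⟨hj, not_lt.1 h⟩
  exact (hits_le_hits key).trans (hits_union_le _ _ _)

/-- The number of the points in an annulus of random outer radius, in terms of the radius and of
the excesses of the numbers of the points in balls of fixed radii. -/
lemma hits_errorAnnulus_le {κ c : ℝ≥0∞} {b V : ℝ} (hb : 0 < b) (hV : 0 < V) {y₀ : E m}
    (hm : 1 ≤ m) {θ a : ℝ}
    (hθ : 0 < θ) (ha : 0 < a) (hu : 0 < u) (hκ : κ ≠ 0) (hc : c * (k : ℝ≥0∞) = κ)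
    (Y : Fin k → E m) {p : ℕ} (hp : 0 < p) :
    c * ENNReal.ofReal (hits (errorAnnulus y₀ θ a u D) Y) ≤
      ENNReal.ofReal ((θ / u) ^ m + 2 * (b * ((2 * θ) ^ m * V))) * (κ * D ^ m) +
      (∑' i : ℕ, (c * ENNReal.ofReal (hits (Metric.closedBall y₀ (min (2 ^ (i + 1) * a) u)) Y -
          2 * (k * (b * ((2 ^ (i + 1) * a) ^ m * V))))) ^ p) ^ (1 / (p : ℝ)) := by
  have hC1 : 0 < (θ / u) ^ m := by positivity
  have hC2 : 0 < 2 * (b * ((2 * θ) ^ m * V)) := by positivity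
  by_cases hDtop : D = ∞
  · have : ENNReal.ofReal ((θ / u) ^ m + 2 * (b * ((2 * θ) ^ m * V))) * (κ * D ^ m) = ∞ := by
      rw [hDtop, ENNReal.top_pow (by omega), ENNReal.mul_top hκ, ENNReal.mul_top]
      exact (ENNReal.ofReal_pos.2 (by positivity)).ne'
    rw [this, top_add]
    exact le_top
  obtain ⟨D', hD', rfl⟩ : ∃ D' : ℝ, 0 ≤ D' ∧ D = ENNReal.ofReal D' :=
    ⟨D.toReal, ENNReal.toReal_nonneg, (ENNReal.ofReal_toReal hDtop).symm⟩
  have hmem : ∀ y ∈ errorAnnulus y₀ θ a u (ENNReal.ofReal D'),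
      ‖y - y₀‖ ≤ θ * D' := by
    rintro y ⟨-, -, h⟩
    rw [ENNReal.ofReal_le_ofReal_iff hD', div_le_iff₀ hθ] at h
    linarith
  have hCD : ∀ C : ℝ, 0 ≤ C → C ≤ (θ / u) ^ m + 2 * (b * ((2 * θ) ^ m * V)) →
      κ * ENNReal.ofReal (C * D' ^ m) ≤
      ENNReal.ofReal ((θ / u) ^ m + 2 * (b * ((2 * θ) ^ m * V))) *
        (κ * ENNReal.ofReal D' ^ m) := by
    intro C hC0 hC
    rw [ENNReal.ofReal_mul hC0, ← ENNReal.ofReal_pow hD', mul_left_comm]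
    gcongr
  -- If the error scale reaches u, all k points are conceded, and (θ/u)^m D^m ≥ 1 pays for them.
  by_cases h1 : u < θ * D'
  · refine le_add_right (le_trans ?_ (hCD ((θ / u) ^ m) hC1.le (by linarith)))
    rw [← hc, mul_assoc]
    gcongr
    calc ENNReal.ofReal (hits (errorAnnulus y₀ θ a u (ENNReal.ofReal D')) Y)
        ≤ ENNReal.ofReal (k : ℝ) := ENNReal.ofReal_le_ofReal (hits_le _ _)
      _ = (k : ℝ≥0∞) * 1 := by rw [ENNReal.ofReal_natCast, mul_one]
      _ ≤ _ := by
        gcongr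
        rw [ENNReal.one_le_ofReal, ← mul_pow]
        refine one_le_pow₀ ?_
        rw [div_mul_eq_mul_div, one_le_div hu]
        exact h1.le
  rw [not_lt] at h1
  by_cases h2 : θ * D' ≤ a
  · have : hits (errorAnnulus y₀ θ a u (ENNReal.ofReal D')) Y ≤ 0 := by
      refine (hits_mono (H := ∅) (fun y hy => ?_) Y).trans (by simp [hits])
      exact absurd hy.1 (not_lt.2 ((hmem y hy).trans h2))
    rw [ENNReal.ofReal_of_nonpos this, mul_zero]
    exact zero_le
  rw [not_le] at h2
  -- Rounding the random radius θ D up to a dyadic multiple of a replaces the annulus by one of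
  -- countably many deterministic balls, at the cost of a factor 2 in the radius.
  obtain ⟨i, hi1, hi2⟩ := exists_nat_pow_near (x := θ * D' / a) (y := (2 : ℝ))
    ((one_le_div ha).2 h2.le) one_lt_two
  rw [le_div_iff₀ ha] at hi1
  rw [div_lt_iff₀ ha] at hi2
  set μ := (k : ℝ) * (b * ((2 ^ (i + 1) * a) ^ m * V)) with hμ
  set B := hits (Metric.closedBall y₀ (min (2 ^ (i + 1) * a) u)) Y with hB
  have h3 : hits (errorAnnulus y₀ θ a u (ENNReal.ofReal D')) Y ≤ B := by
    refine hits_mono (fun y hy => ?_) Y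
    rw [Metric.mem_closedBall, dist_eq_norm]
    exact le_min ((hmem y hy).trans hi2.le) hy.2.1
  have h4 : hits (errorAnnulus y₀ θ a u (ENNReal.ofReal D')) Y ≤ 2 * μ + max (B - 2 * μ) 0 :=
    h3.trans (by linarith [le_max_left (B - 2 * μ) 0])
  have hμ0 : 0 ≤ μ := by positivity
  calc _ ≤ c * ENNReal.ofReal (2 * μ + max (B - 2 * μ) 0) := by gcongr
    _ = c * ENNReal.ofReal (2 * μ) + c * ENNReal.ofReal (B - 2 * μ) := by
        rw [ENNReal.ofReal_add (by positivity) (le_max_right _ _), mul_add]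
        congr 2
        rw [ENNReal.ofReal_max, ENNReal.ofReal_zero, max_eq_left zero_le]
    _ ≤ _ := by
        refine add_le_add (le_trans ?_ (hCD _ hC2.le (by linarith))) ?_
        · rw [← hc, mul_assoc, ← ENNReal.ofReal_natCast k, ← ENNReal.ofReal_mul (by positivity)]
          refine mul_le_mul_right (ENNReal.ofReal_le_ofReal ?_) _
          rw [hμ]
          have h5 : (2 ^ (i + 1) * a) ^ m ≤ (2 * θ * D') ^ m := by
            refine pow_le_pow_left₀ (by positivity) ?_ m
            rw [pow_succ]
            linarith
          rw [mul_pow (2 * θ) D'] at h5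
          calc 2 * ((k : ℝ) * (b * ((2 ^ (i + 1) * a) ^ m * V)))
              ≤ 2 * ((k : ℝ) * (b * (((2 * θ) ^ m * D' ^ m) * V))) := by gcongr
            _ = _ := by ring
        -- The index i is random; the p-th root of the sum of all p-th powers dominates whichever
        -- excess occurs.
        · have hp0 : (p : ℝ) ≠ 0 := by positivity
          calc c * ENNReal.ofReal (B - 2 * μ)
              = ((c * ENNReal.ofReal (B - 2 * μ)) ^ p) ^ (1 / (p : ℝ)) := by
                rw [← ENNReal.rpow_natCast, ← ENNReal.rpow_mul, mul_one_div_cancel hp0,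
                  ENNReal.rpow_one]
            _ ≤ _ := by
                gcongr
                exact ENNReal.le_tsum (f := fun i : ℕ => (c * ENNReal.ofReal
                  (hits (Metric.closedBall y₀ (min (2 ^ (i + 1) * a) u)) Y -
                    2 * (k * (b * ((2 ^ (i + 1) * a) ^ m * V))))) ^ p) i

end Bounds

/-! ### Sums of terms with vanishing p-th moments -/

section Powers

variable {Ω : Type*} [MeasurableSpace Ω]

lemma add_pow_le_two_pow_mul (a b : ℝ≥0∞) (p : ℕ) : (a + b) ^ p ≤ 2 ^ p * (a ^ p + b ^ p) := by
  calc (a + b) ^ p ≤ (2 * max a b) ^ p := by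
        gcongr
        rw [two_mul]
        exact add_le_add (le_max_left _ _) (le_max_right _ _)
    _ = 2 ^ p * max a b ^ p := mul_pow _ _ _
    _ ≤ _ := by
        gcongr
        rcases max_choice a b with h | h <;> rw [h]
        · exact le_self_add
        · exact le_add_self

lemma lintegral_add_pow_le (P : Measure Ω) {f g : Ω → ℝ≥0∞} (hf : AEMeasurable f P) (p : ℕ) :
    ∫⁻ ω, (f ω + g ω) ^ p ∂P ≤ 2 ^ p * (∫⁻ ω, f ω ^ p ∂P + ∫⁻ ω, g ω ^ p ∂P) := by
  rw [← lintegral_add_left' (hf.pow_const p),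
    ← lintegral_const_mul' _ _ (ENNReal.pow_ne_top ENNReal.ofNat_ne_top)]
  exact lintegral_mono fun ω => add_pow_le_two_pow_mul _ _ p

lemma tendsto_lintegral_add_pow {P : Measure Ω} {f g : ℕ → Ω → ℝ≥0∞}
    (hfm : ∀ N, AEMeasurable (f N) P) {p : ℕ}
    (hf : Tendsto (fun N => ∫⁻ ω, f N ω ^ p ∂P) atTop (𝓝 0))
    (hg : Tendsto (fun N => ∫⁻ ω, g N ω ^ p ∂P) atTop (𝓝 0)) :
    Tendsto (fun N => ∫⁻ ω, (f N ω + g N ω) ^ p ∂P) atTop (𝓝 0) := by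
  have h := ENNReal.Tendsto.const_mul (a := (2 : ℝ≥0∞) ^ p) (hf.add hg)
    (Or.inr (ENNReal.pow_ne_top ENNReal.ofNat_ne_top))
  rw [add_zero, mul_zero] at h
  exact tendsto_of_tendsto_of_tendsto_of_le_of_le tendsto_const_nhds h
    (fun _ => zero_le) fun N => lintegral_add_pow_le P (hfm N) p

end Powers

lemma MatchingRegime.radius_pos {m : ℕ} {κ : ℝ} {M N₁ : ℕ → ℕ} {ρ : ℕ → ℝ}
    (h : MatchingRegime m κ M N₁ ρ) : ∀ᶠ N in atTop, 0 < ρ N := by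
  filter_upwards [h.eventually_pos, h.radius_pow] with N hN hρ
  refine lt_of_le_of_ne (h.radius_nonneg N) fun h0 => ?_
  rw [← h0, zero_pow (by have := h.dim; omega)] at hρ
  have h1 : (M N : ℝ) = 0 := by rw [← hρ]; ring
  exact hN.2.1.ne' (by exact_mod_cast h1)

lemma MatchingRegime.eventually_le {m : ℕ} {κ : ℝ} {M N₁ : ℕ → ℕ} {ρ : ℕ → ℝ}
    (h : MatchingRegime m κ M N₁ ρ) : ∀ᶠ N in atTop, M N ≤ N := by
  filter_upwards [h.eventually_pos, h.frac.eventually_lt_const one_pos] with N hN h1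
  rw [div_lt_one (by exact_mod_cast hN.1)] at h1
  exact_mod_cast h1.le

/-! ### The pathwise error bound for the estimator -/

section Pointwise

variable {d m n k : ℕ} {𝒳 𝒵 : Set (E d)} {φ g : E d → E m}
  {M : ℕ} {xs : Fin n → E d} {zs : Fin k → E d} {x : E d} {s ρ u : ℝ} {D : ℝ≥0∞}

lemma ofReal_abs_le {a : ℝ} {A : ℝ≥0∞} (h1 : ENNReal.ofReal a ≤ A) (h2 : ENNReal.ofReal (-a) ≤ A) :
    ENNReal.ofReal |a| ≤ A := by
  rcases abs_choice a with h | h <;> rwa [h]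

lemma ratioEstimate_eq : ratioEstimate 𝒵 M xs zs g x
    = (n : ℝ) / (k * M) * matchCount 𝒵 M xs zs g x := by
  unfold ratioEstimate
  rw [div_mul_div_comm, div_mul_eq_mul_div]

lemma matchCount_nonneg : 0 ≤ matchCount 𝒵 M xs zs g x := hits_nonneg _ _

lemma ratioEstimate_nonneg : 0 ≤ ratioEstimate 𝒵 M xs zs g x := by
  rw [ratioEstimate_eq]
  exact mul_nonneg (by positivity) matchCount_nonneg

lemma ratioEstimate_le : ratioEstimate 𝒵 M xs zs g x ≤ n / M := by
  rw [ratioEstimate_eq]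
  rcases Nat.eq_zero_or_pos k with rfl | hk
  · simp; positivity
  have hk' : (0 : ℝ) < k := by exact_mod_cast hk
  calc (n : ℝ) / (k * M) * matchCount 𝒵 M xs zs g x ≤ (n : ℝ) / (k * M) * k := by
        gcongr
        exact hits_le _ _
    _ = n / M := by field_simp

/-- The error of the density ratio estimator is bounded by the deviations of the numbers of the
points in two balls, the numbers of the points in the exceptional sets, and a multiple of `D ^ m`. -/
lemma ofReal_abs_ratioEstimate_sub_le (hm : 1 ≤ m) (hk : 0 < k) (hM : 1 ≤ M) (hMn : M ≤ n)
    (hs : 1 < s) {κ b r q₁ q₂ : ℝ} (hκ : 0 < κ) (hb : 0 < b) (hr : 0 ≤ r) (hρ : 0 < ρ) (hu : 0 < u)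
    (hρM : n * (κ * ρ ^ m * unitBallVolume m) = M)
    (hg : IncrementBound 𝒳 φ g ((s ^ 2 - 1) / (s ^ 2 + 1)) D) (hge : ∀ t ∈ 𝒳, ‖g t - φ t‖ ≤ u / 6)
    (hx : x ∈ 𝒳) (hxs : ∀ i, xs i ∈ 𝒳) (hzs : ∀ j, zs j ∈ 𝒳) (hzs' : ∀ j, zs j ∈ 𝒵)
    {p : ℕ} (hp : 0 < p) :
    let c : ℝ≥0∞ := ENNReal.ofReal ((n : ℝ) / (k * M))
    let W : Fin n → E m := fun i => φ (xs i)
    let Y : Fin k → E m := fun j => φ (zs j)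
    ENNReal.ofReal |ratioEstimate 𝒵 M xs zs g x - r| ≤
      c * ENNReal.ofReal |hits (Metric.closedBall (φ x) (s ^ 4 * ρ)) Y - k * q₁| +
      (c * ENNReal.ofReal |hits (Metric.closedBall (φ x) (ρ / s ^ 4)) Y - k * q₂| +
      (c * ENNReal.ofReal (hits {y | (W, y) ∈ farSet (φ x) (s ^ 2) (s ^ 4 * ρ) u (u / 6) M} Y) +
      (c * ENNReal.ofReal (hits {y | (W, y) ∈ nearSet (φ x) (ρ / s ^ 4) (ρ / s ^ 2) M} Y) +
      (ENNReal.ofReal ((s ^ 2 / u) ^ m + 2 * (b * ((2 * s ^ 2) ^ m * unitBallVolume m)) +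
          r * s ^ (4 * m) * κ * unitBallVolume m) * ((n : ℝ≥0∞) / (M : ℝ≥0∞) * D ^ m) +
      ((∑' i : ℕ, (c * ENNReal.ofReal
        (hits (Metric.closedBall (φ x) (min (2 ^ (i + 1) * (s ^ 4 * ρ)) u)) Y -
          2 * (k * (b * ((2 ^ (i + 1) * (s ^ 4 * ρ)) ^ m * unitBallVolume m))))) ^ p)
            ^ (1 / (p : ℝ)) +
      (ENNReal.ofReal |n / M * q₁ - r| + ENNReal.ofReal |n / M * q₂ - r|)))))) := by
  intro c W Y
  set V := unitBallVolume m with hVdef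
  have hV : 0 < V := unitBallVolume_pos m
  have hM' : (0 : ℝ) < M := by exact_mod_cast hM
  have hk' : (0 : ℝ) < k := by exact_mod_cast hk
  have hn' : (0 : ℝ) < n := by exact_mod_cast (hM.trans hMn)
  have hs0 : 0 < s := by linarith
  set cR : ℝ := (n : ℝ) / (k * M) with hcR
  have hcR0 : 0 < cR := by positivity
  have hck : cR * k = n / M := by rw [hcR]; field_simp
  have hratio : (n : ℝ≥0∞) / (M : ℝ≥0∞) = ENNReal.ofReal (n / M) := by
    rw [ENNReal.ofReal_div_of_pos hM', ENNReal.ofReal_natCast, ENNReal.ofReal_natCast]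
  have hck' : c * (k : ℝ≥0∞) = (n : ℝ≥0∞) / (M : ℝ≥0∞) := by
    rw [hratio, ← hck, ENNReal.ofReal_mul hcR0.le, ENNReal.ofReal_natCast]
  set B₁ := hits (Metric.closedBall (φ x) (s ^ 4 * ρ)) Y with hB₁
  set B₂ := hits (Metric.closedBall (φ x) (ρ / s ^ 4)) Y with hB₂
  set Fa := hits {y | (W, y) ∈ farSet (φ x) (s ^ 2) (s ^ 4 * ρ) u (u / 6) M} Y with hFa
  set Fn := hits {y | (W, y) ∈ nearSet (φ x) (ρ / s ^ 4) (ρ / s ^ 2) M} Y with hFn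
  set A := hits (errorAnnulus (φ x) (s ^ 2) (s ^ 4 * ρ) u D) Y with hA
  set K := matchCount 𝒵 M xs zs g x with hK
  set X6 := (∑' i : ℕ, (c * ENNReal.ofReal
        (hits (Metric.closedBall (φ x) (min (2 ^ (i + 1) * (s ^ 4 * ρ)) u)) Y -
          2 * (k * (b * ((2 ^ (i + 1) * (s ^ 4 * ρ)) ^ m * V))))) ^ p) ^ (1 / (p : ℝ)) with hX6
  set C₁ := (s ^ 2 / u) ^ m + 2 * (b * ((2 * s ^ 2) ^ m * V)) with hC₁
  set C₂ := r * s ^ (4 * m) * κ * V with hC₂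
  have hC₁0 : 0 ≤ C₁ := by positivity
  have hC₂0 : 0 ≤ C₂ := by positivity
  set NM := (n : ℝ≥0∞) / (M : ℝ≥0∞) with hNM
  have hann : c * ENNReal.ofReal A ≤ ENNReal.ofReal C₁ * (NM * D ^ m) + X6 :=
    hits_errorAnnulus_le hb hV hm (by positivity) (by positivity) hu
      (by rw [hratio]; exact (ENNReal.ofReal_pos.2 (by positivity)).ne') hck' Y hp
  have hc0 : ∀ a : ℝ, c * ENNReal.ofReal a = ENNReal.ofReal (cR * a) := fun a =>
    (ENNReal.ofReal_mul hcR0.le).symm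
  have hC : ENNReal.ofReal (C₁ + C₂) * (NM * D ^ m)
      = ENNReal.ofReal C₁ * (NM * D ^ m) + ENNReal.ofReal C₂ * (NM * D ^ m) := by
    rw [ENNReal.ofReal_add hC₁0 hC₂0, add_mul]
  rw [hC, ratioEstimate_eq, ← hcR, ← hK]
  -- A scaled count differs from r by its deviation from the mean k q plus the bias of the scaled
  -- mean.
  have hdev : ∀ B q : ℝ, ENNReal.ofReal (|cR * B - r|) ≤
      c * ENNReal.ofReal |B - k * q| + ENNReal.ofReal |n / M * q - r| := by
    intro B q
    rw [hc0, ← ENNReal.ofReal_add (by positivity) (abs_nonneg _)]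
    refine ENNReal.ofReal_le_ofReal ?_
    have e : cR * B - r = cR * (B - k * q) + (n / M * q - r) := by rw [← hck]; ring
    rw [e]
    refine (abs_add_le _ _).trans ?_
    rw [abs_mul, abs_of_pos hcR0]
  refine ofReal_abs_le ?_ ?_
  · have hup := matchCount_le (ρ := ρ) (zs := zs) (𝒵 := 𝒵) hM hMn hs hg hge hx hxs hzs
    have h1 : cR * K - r ≤ |cR * B₁ - r| + (cR * Fa + cR * A) := by
      have := mul_le_mul_of_nonneg_left hup hcR0.le
      rw [mul_add, mul_add] at this
      linarith [le_abs_self (cR * B₁ - r)]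
    calc ENNReal.ofReal (cR * K - r)
        ≤ ENNReal.ofReal |cR * B₁ - r| + (c * ENNReal.ofReal Fa + c * ENNReal.ofReal A) := by
          rw [hc0, hc0, ← ENNReal.ofReal_add, ← ENNReal.ofReal_add]
          · exact ENNReal.ofReal_le_ofReal h1
          all_goals have := hits_nonneg {y | (W, y) ∈ farSet (φ x) (s ^ 2) (s ^ 4 * ρ) u (u / 6) M} Y
          all_goals have := hits_nonneg (errorAnnulus (φ x) (s ^ 2) (s ^ 4 * ρ) u D) Y
          all_goals positivity
      _ ≤ (c * ENNReal.ofReal |B₁ - k * q₁| + ENNReal.ofReal |n / M * q₁ - r|) +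
          (c * ENNReal.ofReal Fa + (ENNReal.ofReal C₁ * (NM * D ^ m) + X6)) :=
          add_le_add (hdev B₁ q₁) (add_le_add_right hann _)
      _ ≤ ((c * ENNReal.ofReal |B₁ - k * q₁| + ENNReal.ofReal |n / M * q₁ - r|) +
          (c * ENNReal.ofReal Fa + (ENNReal.ofReal C₁ * (NM * D ^ m) + X6))) +
          (c * ENNReal.ofReal |B₂ - k * q₂| + c * ENNReal.ofReal Fn +
            ENNReal.ofReal C₂ * (NM * D ^ m) + ENNReal.ofReal |n / M * q₂ - r|) := le_self_add
      _ = _ := by ring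
  · by_cases hD : D < ENNReal.ofReal (ρ / s ^ 4)
    · have hlow := hits_closedBall_le (zs := zs) (𝒵 := 𝒵) hM hMn hs hg hx hxs hzs hzs' hD
      have h1 : -(cR * K - r) ≤ |cR * B₂ - r| + cR * Fn := by
        have := mul_le_mul_of_nonneg_left hlow hcR0.le
        rw [mul_add] at this
        linarith [neg_abs_le (cR * B₂ - r)]
      calc ENNReal.ofReal (-(cR * K - r))
          ≤ ENNReal.ofReal |cR * B₂ - r| + c * ENNReal.ofReal Fn := by
            rw [hc0, ← ENNReal.ofReal_add (abs_nonneg _)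
              (mul_nonneg hcR0.le (hits_nonneg _ _))]
            exact ENNReal.ofReal_le_ofReal h1
        _ ≤ (c * ENNReal.ofReal |B₂ - k * q₂| + ENNReal.ofReal |n / M * q₂ - r|) +
            c * ENNReal.ofReal Fn := add_le_add_left (hdev B₂ q₂) _
        _ ≤ ((c * ENNReal.ofReal |B₂ - k * q₂| + ENNReal.ofReal |n / M * q₂ - r|) +
            c * ENNReal.ofReal Fn) +
            (c * ENNReal.ofReal |B₁ - k * q₁| + c * ENNReal.ofReal Fa +
              (ENNReal.ofReal C₁ * (NM * D ^ m) + ENNReal.ofReal C₂ * (NM * D ^ m)) + X6 +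
              ENNReal.ofReal |n / M * q₁ - r|) := le_self_add
        _ = _ := by ring
    -- If D reaches the inner radius, only nonnegativity of the estimate is used: since (n/M) κ ρ^m
    -- V = 1, the constant C₂ makes C₂ (n/M) D^m at least r.
    · rw [not_lt] at hD
      have h2 : ENNReal.ofReal r ≤ ENNReal.ofReal C₂ * (NM * D ^ m) := by
        have h3 : ENNReal.ofReal ((ρ / s ^ 4) ^ m) ≤ D ^ m := by
          rw [ENNReal.ofReal_pow (by positivity)]
          gcongr
        calc ENNReal.ofReal r
            = ENNReal.ofReal C₂ * (NM * ENNReal.ofReal ((ρ / s ^ 4) ^ m)) := by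
              rw [hratio, ← ENNReal.ofReal_mul (by positivity), ← ENNReal.ofReal_mul hC₂0,
                ← hρM, hC₂]
              congr 1
              rw [pow_mul, div_pow]
              field_simp
          _ ≤ _ := by gcongr
      have hKn : 0 ≤ cR * K := mul_nonneg hcR0.le matchCount_nonneg
      calc ENNReal.ofReal (-(cR * K - r)) ≤ ENNReal.ofReal r :=
            ENNReal.ofReal_le_ofReal (by linarith)
        _ ≤ ENNReal.ofReal C₂ * (NM * D ^ m) := h2
        _ ≤ ENNReal.ofReal C₂ * (NM * D ^ m) +
            (c * ENNReal.ofReal |B₁ - k * q₁| + c * ENNReal.ofReal |B₂ - k * q₂| +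
              c * ENNReal.ofReal Fa + c * ENNReal.ofReal Fn + ENNReal.ofReal C₁ * (NM * D ^ m) +
              X6 + ENNReal.ofReal |n / M * q₁ - r| + ENNReal.ofReal |n / M * q₂ - r|) :=
            le_self_add
        _ = _ := by ring

end Pointwise

/-! ### Consistency under abstract control of the error of φ̂ -/

section Consistency

variable {Ω : Type*} [MeasurableSpace Ω] {d m : ℕ}

/-- The errors of the transformations `g N` are controlled by the random variables `D N`, through
increments, and `S N`, uniformly. -/
structure ErrorControl (P : Measure Ω) (M : ℕ → ℕ) (𝒳 : Set (E d)) (φ : E d → E m)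
    (g : ℕ → Ω → E d → E m) (p : ℕ) (ε : ℝ) (D S : ℕ → Ω → ℝ≥0∞) : Prop where
  aemeasurable_D : ∀ N, AEMeasurable (D N) P
  aemeasurable_S : ∀ N, AEMeasurable (S N) P
  moment : Tendsto (fun N : ℕ => ((N : ℝ≥0∞) / (M N : ℝ≥0∞)) ^ p * ∫⁻ ω, D N ω ^ (m * p) ∂P)
    atTop (𝓝 0)
  tail : ∀ e : ℝ, 0 < e → Tendsto (fun N : ℕ => ((N : ℝ≥0∞) / (M N : ℝ≥0∞)) ^ p *
    P {ω | ENNReal.ofReal e < S N ω}) atTop (𝓝 0)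
  increment : ∀ N, ∀ᵐ ω ∂P, S N ω ≤ 1 → IncrementBound 𝒳 φ (g N ω) ε (D N ω)
  le_S : ∀ N, ∀ᵐ ω ∂P, ∀ t ∈ 𝒳, ‖g N ω t - φ t‖ₑ ≤ S N ω

variable {P : Measure Ω} {Xs Zs : ℕ → Ω → E d} {𝒳 𝒵 : Set (E d)}
  {φ : E d → E m} {ν₀ ν₁ : Measure (E m)} [IsProbabilityMeasure ν₀] [IsProbabilityMeasure ν₁]
  {f₀ f₁ : E m → ℝ} {x : E d} {M N₁ : ℕ → ℕ} {ρ : ℕ → ℝ} {g : ℕ → Ω → E d → E m} {p : ℕ}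

/-- For fixed s the error splits into a random part `G` with vanishing p-th moment and a
deterministic bias `δ`, namely that of the scaled ν₁-masses of the balls of radii s⁴ρ and ρ/s⁴. The
bias does not vanish until s tends to 1. -/
lemma exists_error_decomposition (h : MatchingRegime m (f₀ (φ x)) M N₁ ρ)
    (hf₀ : Measurable f₀) (hν₀ : ν₀ = volume.withDensity (fun y => ENNReal.ofReal (f₀ y)))
    (hf₁ : Measurable f₁) (hf₁0 : ∀ y, 0 ≤ f₁ y)
    (hν₁ : ν₁ = volume.withDensity (fun y => ENNReal.ofReal (f₁ y)))
    (hc₀ : ContinuousAt f₀ (φ x)) (hc₁ : ContinuousAt f₁ (φ x))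
    (hlaw : ∀ N, MeasurePreserving (fun ω => ((fun i : Fin N => φ (Xs i ω)),
      (fun j : Fin (N₁ N) => φ (Zs j ω)))) P
      ((Measure.pi fun _ : Fin N => ν₀).prod (Measure.pi fun _ : Fin (N₁ N) => ν₁)))
    (hx : x ∈ 𝒳) (hXs : ∀ᵐ ω ∂P, ∀ i, Xs i ω ∈ 𝒳) (hZs : ∀ᵐ ω ∂P, ∀ j, Zs j ω ∈ 𝒵)
    (h𝒵𝒳 : 𝒵 ⊆ 𝒳) (hp : 0 < p) (hpe : Even p) {s : ℝ} (hs : 1 < s) {D S : ℕ → Ω → ℝ≥0∞}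
    (hg : ErrorControl P M 𝒳 φ g p ((s ^ 2 - 1) / (s ^ 2 + 1)) D S) :
    ∃ (G : ℕ → Ω → ℝ≥0∞) (δ : ℕ → ℝ≥0∞), (∀ N, AEMeasurable (G N) P) ∧
      Tendsto (fun N => ∫⁻ ω, G N ω ^ p ∂P) atTop (𝓝 0) ∧
      Tendsto δ atTop (𝓝
        (ENNReal.ofReal |f₁ (φ x) / f₀ (φ x) * (s ^ 4) ^ m - f₁ (φ x) / f₀ (φ x)| +
        ENNReal.ofReal |f₁ (φ x) / f₀ (φ x) * ((s ^ 4)⁻¹) ^ m - f₁ (φ x) / f₀ (φ x)|)) ∧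
      ∀ᶠ N in atTop, ∀ᵐ ω ∂P, ENNReal.ofReal |ratioEstimate 𝒵 (M N) (fun i : Fin N => Xs i ω)
        (fun j : Fin (N₁ N) => Zs j ω) (g N ω) x - f₁ (φ x) / f₀ (φ x)| ≤ G N ω + δ N := by
  set y₀ := φ x with hy₀
  set r := f₁ y₀ / f₀ y₀ with hr
  have hκ := h.pos
  have hr0 : 0 ≤ r := div_nonneg (hf₁0 _) hκ.le
  set b := f₁ y₀ + 1 with hb
  have hb0 : 0 < b := by have := hf₁0 y₀; linarith
  obtain ⟨R₀, hR₀, hdens₀⟩ := exists_densityNear hf₀ hν₀ hc₀ hκ hs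
  obtain ⟨R₁, hR₁, hdens₁⟩ := Metric.eventually_nhds_iff_ball.1
    (hc₁.eventually_lt_const (lt_add_one (f₁ y₀)))
  -- On the ball of radius 2u the density bounds for ν₀ and f₁ ≤ b hold; u ≤ 1 ensures that S ≤ u/6
  -- implies S ≤ 1, as the increment clause demands.
  set u := min 1 (min (R₀ / 2) (R₁ / 2)) with hu
  have hu0 : 0 < u := by positivity
  have hu1 : u ≤ 1 := min_le_left _ _
  have huR₀ : 2 * u ≤ R₀ := by
    have : u ≤ R₀ / 2 := (min_le_right _ _).trans (min_le_left _ _)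
    linarith
  have huR₁ : 2 * u ≤ R₁ := by
    have : u ≤ R₁ / 2 := (min_le_right _ _).trans (min_le_right _ _)
    linarith
  have hnear := hdens₀.mono huR₀
  have hbb : ∀ y ∈ Metric.ball y₀ (2 * u), f₁ y ≤ b := fun y hy =>
    (hdens₁ y (Metric.ball_subset_ball huR₁ hy)).le
  set c : ℕ → ℝ≥0∞ := fun N => ENNReal.ofReal ((N : ℝ) / (N₁ N * M N)) with hc
  set W : ∀ N : ℕ, Ω → Fin N → E m := fun N ω i => φ (Xs i ω) with hW
  set Y : ∀ N : ℕ, Ω → Fin (N₁ N) → E m := fun N ω j => φ (Zs j ω) with hY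
  have hlawY : ∀ N, MeasurePreserving (Y N) P (Measure.pi fun _ : Fin (N₁ N) => ν₁) := fun N =>
    (measurePreserving_snd (μ := Measure.pi fun _ : Fin N => ν₀)).comp (hlaw N)
  have hWYm : ∀ N, Measurable fun ω => (W N ω, Y N ω) := fun N => (hlaw N).measurable
  have hYm : ∀ N, Measurable (Y N) := fun N => (hlawY N).measurable
  set S₁ : ℕ → Set (E m) := fun N => Metric.closedBall y₀ (s ^ 4 * ρ N) with hS₁
  set S₂ : ℕ → Set (E m) := fun N => Metric.closedBall y₀ (ρ N / s ^ 4) with hS₂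
  have hS₁m : ∀ N, MeasurableSet (S₁ N) := fun N => Metric.isClosed_closedBall.measurableSet
  have hS₂m : ∀ N, MeasurableSet (S₂ N) := fun N => Metric.isClosed_closedBall.measurableSet
  have hL₁ : Tendsto (fun N : ℕ => (N : ℝ) / M N * ν₁.real (S₁ N)) atTop (𝓝 (r * (s ^ 4) ^ m)) :=
    h.tendsto_real_closedBall hf₁ hf₁0 hν₁ hc₁ (by positivity)
  have hL₂ : Tendsto (fun N : ℕ => (N : ℝ) / M N * ν₁.real (S₂ N)) atTop
      (𝓝 (r * ((s ^ 4)⁻¹) ^ m)) := by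
    refine (h.tendsto_real_closedBall hf₁ hf₁0 hν₁ hc₁ (a := (s ^ 4)⁻¹) (by positivity)).congr
      fun N => ?_
    rw [hS₂, inv_mul_eq_div]
  set t₁ : ℕ → Ω → ℝ≥0∞ := fun N ω =>
    c N * ENNReal.ofReal |hits (S₁ N) (Y N ω) - N₁ N * ν₁.real (S₁ N)| with ht₁
  set t₂ : ℕ → Ω → ℝ≥0∞ := fun N ω =>
    c N * ENNReal.ofReal |hits (S₂ N) (Y N ω) - N₁ N * ν₁.real (S₂ N)| with ht₂
  set t₃ : ℕ → Ω → ℝ≥0∞ := fun N ω => c N * ENNReal.ofReal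
    (hits {y | (W N ω, y) ∈ farSet y₀ (s ^ 2) (s ^ 4 * ρ N) u (u / 6) (M N)} (Y N ω)) with ht₃
  set t₄ : ℕ → Ω → ℝ≥0∞ := fun N ω => c N * ENNReal.ofReal
    (hits {y | (W N ω, y) ∈ nearSet y₀ (ρ N / s ^ 4) (ρ N / s ^ 2) (M N)} (Y N ω)) with ht₄
  set C : ℝ := (s ^ 2 / u) ^ m + 2 * (b * ((2 * s ^ 2) ^ m * unitBallVolume m)) +
          r * s ^ (4 * m) * f₀ y₀ * unitBallVolume m with hC
  set t₅ : ℕ → Ω → ℝ≥0∞ := fun N ω =>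
    ENNReal.ofReal C * ((N : ℝ≥0∞) / (M N : ℝ≥0∞) * D N ω ^ m) with ht₅
  set v : ∀ N, (Fin (N₁ N) → E m) → ℝ≥0∞ := fun N Y => ∑' i : ℕ, (c N * ENNReal.ofReal
        (hits (Metric.closedBall y₀ (min (2 ^ (i + 1) * (s ^ 4 * ρ N)) u)) Y -
          2 * (N₁ N * (b * ((2 ^ (i + 1) * (s ^ 4 * ρ N)) ^ m * unitBallVolume m))))) ^ p with hv
  set t₆ : ℕ → Ω → ℝ≥0∞ := fun N ω => v N (Y N ω) ^ (1 / (p : ℝ)) with ht₆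
  -- On the event of a large sup-norm error only the trivial bound N/M of the estimate is used; as
  -- N/M ≥ 1 eventually, it absorbs r.
  set t₇ : ℕ → Ω → ℝ≥0∞ := fun N ω => ENNReal.ofReal (1 + r) * ((N : ℝ≥0∞) / (M N : ℝ≥0∞)) *
    {ω | ENNReal.ofReal (u / 6) < S N ω}.indicator 1 ω with ht₇
  have hvm : ∀ N, Measurable (v N) := fun N => Measurable.tsum fun i =>
    ((((measurable_hits Metric.isClosed_closedBall.measurableSet).sub_const
      _).ennreal_ofReal).const_mul _).pow_const p
  have hSset : ∀ N, NullMeasurableSet {ω | ENNReal.ofReal (u / 6) < S N ω} P := fun N =>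
    nullMeasurableSet_lt aemeasurable_const (hg.aemeasurable_S N)
  have hdevm : ∀ (N : ℕ) {A : Set (E m)} (q : ℝ), MeasurableSet A →
      Measurable fun y : Fin (N₁ N) → E m => c N * ENNReal.ofReal |hits A y - q| :=
    fun N A q hA => (((measurable_hits hA).sub_const q).abs.ennreal_ofReal).const_mul _
  have hsecm : ∀ (N : ℕ) {F : Set ((Fin N → E m) × E m)}, MeasurableSet F →
      Measurable fun z : (Fin N → E m) × (Fin (N₁ N) → E m) =>
        c N * ENNReal.ofReal (hits {y | (z.1, y) ∈ F} z.2) :=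
    fun N F hF => (measurable_hits_section hF).ennreal_ofReal.const_mul _
  have hm₁ : ∀ N, AEMeasurable (t₁ N) P := fun N =>
    ((hdevm N _ (hS₁m N)).comp (hYm N)).aemeasurable
  have hm₂ : ∀ N, AEMeasurable (t₂ N) P := fun N =>
    ((hdevm N _ (hS₂m N)).comp (hYm N)).aemeasurable
  have hm₃ : ∀ N, AEMeasurable (t₃ N) P := fun N =>
    ((hsecm N (measurableSet_farSet y₀ _ _ _ _ _)).comp (hWYm N)).aemeasurable
  have hm₄ : ∀ N, AEMeasurable (t₄ N) P := fun N =>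
    ((hsecm N (measurableSet_nearSet y₀ _ _ _)).comp (hWYm N)).aemeasurable
  have hm₅ : ∀ N, AEMeasurable (t₅ N) P := fun N =>
    (((hg.aemeasurable_D N).pow_const m).const_mul _).const_mul _
  have hm₆ : ∀ N, AEMeasurable (t₆ N) P := fun N =>
    (((hvm N).comp (hYm N)).pow_const _).aemeasurable
  have hm₇ : ∀ N, AEMeasurable (t₇ N) P := fun N =>
    (aemeasurable_one.indicator₀ (hSset N)).const_mul _
  have hT₁ : Tendsto (fun N => ∫⁻ ω, t₁ N ω ^ p ∂P) atTop (𝓝 0) := by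
    refine (h.tendsto_lintegral_central ν₁ hp hpe hS₁m hL₁).congr fun N => ?_
    exact ((hlawY N).lintegral_comp ((hdevm N _ (hS₁m N)).pow_const p)).symm
  have hT₂ : Tendsto (fun N => ∫⁻ ω, t₂ N ω ^ p ∂P) atTop (𝓝 0) := by
    refine (h.tendsto_lintegral_central ν₁ hp hpe hS₂m hL₂).congr fun N => ?_
    exact ((hlawY N).lintegral_comp ((hdevm N _ (hS₂m N)).pow_const p)).symm
  have hT₃ : Tendsto (fun N => ∫⁻ ω, t₃ N ω ^ p ∂P) atTop (𝓝 0) := by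
    refine (h.tendsto_lintegral_hits_section ν₀ ν₁ hp (fun N => measurableSet_farSet y₀ _ _ _ _ _)
      (h.tendsto_lintegral_farSet hf₁ hν₁ hs hu0 hnear hb0 hbb hp)).congr fun N => ?_
    exact ((hlaw N).lintegral_comp
      ((hsecm N (measurableSet_farSet y₀ _ _ _ _ _)).pow_const p)).symm
  have hT₄ : Tendsto (fun N => ∫⁻ ω, t₄ N ω ^ p ∂P) atTop (𝓝 0) := by
    refine (h.tendsto_lintegral_hits_section ν₀ ν₁ hp (fun N => measurableSet_nearSet y₀ _ _ _)
      (h.tendsto_lintegral_nearSet hν₁ hs hu0 hnear hb0 hbb hp)).congr fun N => ?_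
    exact ((hlaw N).lintegral_comp
      ((hsecm N (measurableSet_nearSet y₀ _ _ _)).pow_const p)).symm
  have hT₅ : Tendsto (fun N => ∫⁻ ω, t₅ N ω ^ p ∂P) atTop (𝓝 0) := by
    have h1 := ENNReal.Tendsto.const_mul (a := ENNReal.ofReal C ^ p) hg.moment
      (Or.inr (ENNReal.pow_ne_top ENNReal.ofReal_ne_top))
    rw [mul_zero] at h1
    refine h1.congr fun N => ?_
    simp only [ht₅, mul_pow, ← pow_mul]
    rw [lintegral_const_mul' _ _ (ENNReal.pow_ne_top ENNReal.ofReal_ne_top),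
      lintegral_const_mul'' _ ((hg.aemeasurable_D N).pow_const _)]
  have hT₆ : Tendsto (fun N => ∫⁻ ω, t₆ N ω ^ p ∂P) atTop (𝓝 0) := by
    refine (h.tendsto_lintegral_excess hν₁ hu0 hb0 hbb (a := s ^ 4) (one_le_pow₀ hs.le) hp).congr
      fun N => ?_
    rw [← (hlawY N).lintegral_comp (hvm N)]
    refine lintegral_congr fun ω => ?_
    have hp0 : (p : ℝ) ≠ 0 := by positivity
    rw [ht₆, ← ENNReal.rpow_natCast, ← ENNReal.rpow_mul, one_div_mul_cancel hp0, ENNReal.rpow_one]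
  have hT₇ : Tendsto (fun N => ∫⁻ ω, t₇ N ω ^ p ∂P) atTop (𝓝 0) := by
    have h1 := ENNReal.Tendsto.const_mul (a := ENNReal.ofReal (1 + r) ^ p)
      (hg.tail (u / 6) (by positivity)) (Or.inr (ENNReal.pow_ne_top ENNReal.ofReal_ne_top))
    rw [mul_zero] at h1
    refine h1.congr fun N => ?_
    have h2 : ∀ ω, t₇ N ω ^ p = (ENNReal.ofReal (1 + r) ^ p * ((N : ℝ≥0∞) / (M N : ℝ≥0∞)) ^ p) *
        {ω | ENNReal.ofReal (u / 6) < S N ω}.indicator 1 ω := by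
      intro ω
      simp only [ht₇, mul_pow]
      congr 1
      by_cases hω : ω ∈ {ω | ENNReal.ofReal (u / 6) < S N ω}
      · simp [Set.indicator_of_mem hω]
      · simp [Set.indicator_of_notMem hω, hp.ne']
    simp_rw [h2]
    have h3 : AEMeasurable ({ω | ENNReal.ofReal (u / 6) < S N ω}.indicator (1 : Ω → ℝ≥0∞)) P :=
      aemeasurable_one.indicator₀ (hSset N)
    rw [lintegral_const_mul'' _ h3,
      lintegral_indicator_one₀ (hSset N), mul_assoc]
  refine ⟨fun N ω => t₁ N ω + (t₂ N ω + (t₃ N ω + (t₄ N ω + (t₅ N ω + (t₆ N ω + t₇ N ω))))),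
    fun N => ENNReal.ofReal |(N : ℝ) / M N * ν₁.real (S₁ N) - r| +
      ENNReal.ofReal |(N : ℝ) / M N * ν₁.real (S₂ N) - r|, ?_, ?_, ?_, ?_⟩
  · exact fun N => (hm₁ N).add ((hm₂ N).add ((hm₃ N).add ((hm₄ N).add ((hm₅ N).add
      ((hm₆ N).add (hm₇ N))))))
  · exact tendsto_lintegral_add_pow hm₁ hT₁ (tendsto_lintegral_add_pow hm₂ hT₂
      (tendsto_lintegral_add_pow hm₃ hT₃ (tendsto_lintegral_add_pow hm₄ hT₄
      (tendsto_lintegral_add_pow hm₅ hT₅ (tendsto_lintegral_add_pow hm₆ hT₆ hT₇)))))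
  · have hcont : ∀ L : ℝ, Tendsto (fun a : ℝ => ENNReal.ofReal |a - r|) (𝓝 L)
        (𝓝 (ENNReal.ofReal |L - r|)) := fun L =>
      (ENNReal.continuous_ofReal.comp (continuous_id.sub continuous_const).abs).tendsto L
    exact ((hcont _).comp hL₁).add ((hcont _).comp hL₂)
  · filter_upwards [h.eventually_pos, h.radius_pow, h.radius_pos, h.eventually_le]
      with N hN hρM hρ hMN
    filter_upwards [hXs, hZs, hg.increment N, hg.le_S N] with ω hXω hZω hincω hSω
    have hM' : (0 : ℝ) < M N := by exact_mod_cast hN.2.1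
    by_cases hSu : ENNReal.ofReal (u / 6) < S N ω
    · have h1 : ENNReal.ofReal |ratioEstimate 𝒵 (M N) (fun i : Fin N => Xs i ω)
          (fun j : Fin (N₁ N) => Zs j ω) (g N ω) x - r| ≤ t₇ N ω := by
        have h2 : (1 : ℝ) ≤ N / M N := by
          rw [one_le_div hM']
          exact_mod_cast hMN
        have h3 : {ω | ENNReal.ofReal (u / 6) < S N ω}.indicator (1 : Ω → ℝ≥0∞) ω = 1 :=
          Set.indicator_of_mem (by exact hSu) _
        simp only [ht₇, h3]
        rw [mul_one, MatchingRegime.ratio_eq hN, ← ENNReal.ofReal_mul (by positivity)]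
        refine ENNReal.ofReal_le_ofReal ?_
        have h4 := ratioEstimate_nonneg (𝒵 := 𝒵) (M := M N) (xs := fun i : Fin N => Xs i ω)
          (zs := fun j : Fin (N₁ N) => Zs j ω) (g := g N ω) (x := x)
        have h5 := ratioEstimate_le (𝒵 := 𝒵) (M := M N) (xs := fun i : Fin N => Xs i ω)
          (zs := fun j : Fin (N₁ N) => Zs j ω) (g := g N ω) (x := x)
        rw [abs_le]
        constructor <;> nlinarith
      refine h1.trans (le_trans ?_ le_self_add)
      calc t₇ N ω ≤ t₇ N ω + (t₁ N ω + t₂ N ω + t₃ N ω + t₄ N ω + t₅ N ω + t₆ N ω) := le_self_add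
        _ = _ := by ring
    · rw [not_lt] at hSu
      have hge : ∀ t ∈ 𝒳, ‖g N ω t - φ t‖ ≤ u / 6 := by
        intro t ht
        have := (hSω t ht).trans hSu
        rwa [← ofReal_norm, ENNReal.ofReal_le_ofReal_iff (by positivity)] at this
      have hS1 : S N ω ≤ 1 := by
        refine hSu.trans ?_
        rw [ENNReal.ofReal_le_one]
        linarith
      have key := ofReal_abs_ratioEstimate_sub_le (q₁ := ν₁.real (S₁ N)) (q₂ := ν₁.real (S₂ N))
        (𝒵 := 𝒵) h.dim hN.2.2 hN.2.1 hMN hs hκ hb0 hr0 hρ hu0 hρM (hincω hS1) hge hx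
        (xs := fun i : Fin N => Xs i ω) (zs := fun j : Fin (N₁ N) => Zs j ω)
        (fun i => hXω i) (fun j => h𝒵𝒳 (hZω j)) (fun j => hZω j) hp
      refine key.trans ?_
      calc _ = t₁ N ω + (t₂ N ω + (t₃ N ω + (t₄ N ω + (t₅ N ω + (t₆ N ω +
            (ENNReal.ofReal |(N : ℝ) / M N * ν₁.real (S₁ N) - r| +
              ENNReal.ofReal |(N : ℝ) / M N * ν₁.real (S₂ N) - r|)))))) := rfl
        _ ≤ t₁ N ω + (t₂ N ω + (t₃ N ω + (t₄ N ω + (t₅ N ω + (t₆ N ω +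
            (ENNReal.ofReal |(N : ℝ) / M N * ν₁.real (S₁ N) - r| +
              ENNReal.ofReal |(N : ℝ) / M N * ν₁.real (S₂ N) - r|)))))) + t₇ N ω := le_self_add
        _ = _ := by ring

/-- Consistency of the density ratio estimator if the errors of the transformations are
controlled. -/
lemma tendsto_lintegral_ratioEstimate [IsProbabilityMeasure P]
    (h : MatchingRegime m (f₀ (φ x)) M N₁ ρ)
    (hf₀ : Measurable f₀) (hν₀ : ν₀ = volume.withDensity (fun y => ENNReal.ofReal (f₀ y)))
    (hf₁ : Measurable f₁) (hf₁0 : ∀ y, 0 ≤ f₁ y)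
    (hν₁ : ν₁ = volume.withDensity (fun y => ENNReal.ofReal (f₁ y)))
    (hc₀ : ContinuousAt f₀ (φ x)) (hc₁ : ContinuousAt f₁ (φ x))
    (hlaw : ∀ N, MeasurePreserving (fun ω => ((fun i : Fin N => φ (Xs i ω)),
      (fun j : Fin (N₁ N) => φ (Zs j ω)))) P
      ((Measure.pi fun _ : Fin N => ν₀).prod (Measure.pi fun _ : Fin (N₁ N) => ν₁)))
    (hx : x ∈ 𝒳) (hXs : ∀ᵐ ω ∂P, ∀ i, Xs i ω ∈ 𝒳) (hZs : ∀ᵐ ω ∂P, ∀ j, Zs j ω ∈ 𝒵)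
    (h𝒵𝒳 : 𝒵 ⊆ 𝒳) (hp : 0 < p) (hpe : Even p)
    (hg : ∀ ε : ℝ, 0 < ε → ∃ D S : ℕ → Ω → ℝ≥0∞, ErrorControl P M 𝒳 φ g p ε D S) :
    Tendsto (fun N : ℕ => ∫⁻ ω, ENNReal.ofReal |ratioEstimate 𝒵 (M N) (fun i : Fin N => Xs i ω)
        (fun j : Fin (N₁ N) => Zs j ω) (g N ω) x - f₁ (φ x) / f₀ (φ x)| ^ p ∂P)
      atTop (𝓝 0) := by
  set r := f₁ (φ x) / f₀ (φ x) with hr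
  set L : ℝ → ℝ≥0∞ := fun s => ENNReal.ofReal |r * (s ^ 4) ^ m - r| +
    ENNReal.ofReal |r * ((s ^ 4)⁻¹) ^ m - r| with hL
  have h2top : (2 : ℝ≥0∞) ^ p ≠ ∞ := ENNReal.pow_ne_top ENNReal.ofNat_ne_top
  -- Order of limits: s is first taken close to 1 to make the limiting bias small; only then does N
  -- grow, with D and S belonging to the ε determined by s.
  have hLlim : Tendsto (fun s => 2 ^ p * L s ^ p) (𝓝[>] (1 : ℝ)) (𝓝 0) := by
    have h1 : ContinuousAt (fun s : ℝ => |r * (s ^ 4) ^ m - r|) 1 := by fun_prop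
    have h2 : ContinuousAt (fun s : ℝ => |r * ((s ^ 4)⁻¹) ^ m - r|) 1 := by
      have : ContinuousAt (fun s : ℝ => (s ^ 4)⁻¹) 1 :=
        ContinuousAt.inv₀ (by fun_prop) (by norm_num)
      fun_prop
    have h3 : ContinuousAt L 1 :=
      (ENNReal.continuous_ofReal.continuousAt.comp h1).add
        (ENNReal.continuous_ofReal.continuousAt.comp h2)
    have h4 : Tendsto (fun s => 2 ^ p * L s ^ p) (𝓝 (1 : ℝ)) (𝓝 (2 ^ p * L 1 ^ p)) :=
      ENNReal.Tendsto.const_mul (((ENNReal.continuous_pow p).tendsto _).comp h3) (Or.inr h2top)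
    have h5 : L 1 = 0 := by simp [hL]
    rw [h5, zero_pow hp.ne', mul_zero] at h4
    exact h4.mono_left nhdsWithin_le_nhds
  refine ENNReal.tendsto_nhds_zero.2 fun η hη => ?_
  obtain ⟨s, hsη, hs⟩ := ((hLlim.eventually_lt_const hη).and
    (eventually_mem_nhdsWithin (s := Set.Ioi (1 : ℝ)))).exists
  have hs : 1 < s := hs
  have hε : 0 < (s ^ 2 - 1) / (s ^ 2 + 1) :=
    div_pos (by nlinarith) (by positivity)
  obtain ⟨D, S, hDS⟩ := hg _ hε
  obtain ⟨G, δ, hGm, hG, hδ, hbound⟩ := exists_error_decomposition h hf₀ hν₀ hf₁ hf₁0 hν₁ hc₀ hc₁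
    hlaw hx hXs hZs h𝒵𝒳 hp hpe hs hDS
  have hlim : Tendsto (fun N => 2 ^ p * (∫⁻ ω, G N ω ^ p ∂P + δ N ^ p)) atTop
      (𝓝 (2 ^ p * L s ^ p)) := by
    have h1 := hG.add (((ENNReal.continuous_pow p).tendsto _).comp hδ)
    rw [zero_add] at h1
    exact ENNReal.Tendsto.const_mul h1 (Or.inr h2top)
  filter_upwards [hbound, hlim.eventually_lt_const hsη] with N hN hη'
  refine le_trans ?_ hη'.le
  calc _ ≤ ∫⁻ ω, (G N ω + δ N) ^ p ∂P := by
        refine lintegral_mono_ae ?_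
        filter_upwards [hN] with ω hω
        gcongr
    _ ≤ 2 ^ p * (∫⁻ ω, G N ω ^ p ∂P + ∫⁻ _, δ N ^ p ∂P) := lintegral_add_pow_le P (hGm N) p
    _ = _ := by simp

end Consistency

/-! ### Conditions (A) and (B) imply the error control -/

section Conditions

variable {Ω : Type*} [MeasurableSpace Ω] {d m : ℕ}
  {P : Measure Ω} {Xs Zs : ℕ → Ω → E d} {𝒳 𝒵 : Set (E d)}
  {φ : E d → E m} {x : E d} {M N₁ : ℕ → ℕ} {p : ℕ}
  {φhat : ∀ N : ℕ, TransformEstimator d m N (N₁ N)}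

/-- Through this the suprema over 𝒵ᵖ bound the actual estimator. The points come from an infinite
sequence because p may exceed the sample size k. -/
lemma replaceFirst_self {k : ℕ} (z : ℕ → E d) :
    replaceFirst p (fun j : Fin k => z j) (fun i : Fin p => z i) = fun j : Fin k => z j := by
  ext1 j
  unfold replaceFirst
  split_ifs <;> rfl

lemma measurable_sample (hXs : ∀ i, Measurable (Xs i)) (hZs : ∀ j, Measurable (Zs j)) (N k : ℕ) :
    Measurable (sample Xs Zs N k) := by
  unfold sample
  exact (measurable_pi_lambda _ fun i : Fin N => hXs i).prodMk
    (measurable_pi_lambda _ fun j : Fin k => hZs j)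

lemma enorm_sub_le_supDist {g : E d → E m} {t : E d} (ht : t ∈ 𝒳) :
    ‖g t - φ t‖ₑ ≤ supDist 𝒳 g φ :=
  le_iSup₂ (f := fun t (_ : t ∈ 𝒳) => ‖g t - φ t‖ₑ) t ht

lemma supDist_pow_le_replacedSupPow {n k : ℕ} {ψ : TransformEstimator d m n k} {r : ℕ}
    {xs : Fin n → E d} {z : ℕ → E d} (hz : ∀ j, z j ∈ 𝒵) :
    supDist 𝒳 (ψ xs (fun j => z j) x) φ ^ r
      ≤ replacedSupPow 𝒳 𝒵 φ ψ x p r xs (fun j => z j) := by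
  have h := le_iSup₂ (f := fun (y : Fin p → E d) (_ : y ∈ {y : Fin p → E d | ∀ i, y i ∈ 𝒵}) =>
    supDist 𝒳 (ψ xs (replaceFirst p (fun j : Fin k => z j) y) x) φ ^ r)
    (fun i => z i) (fun i => hz i)
  simp only [replaceFirst_self] at h
  exact h

/-- The sup-norm condition controls the errors of the estimated transformations. -/
lemma SupNormCondition.errorControl (hm : 1 ≤ m) (hp : 0 < p)
    (hXs : ∀ i, Measurable (Xs i)) (hZs : ∀ j, Measurable (Zs j))
    (hZ : ∀ᵐ ω ∂P, ∀ j, Zs j ω ∈ 𝒵)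
    (h : SupNormCondition P Xs Zs M N₁ 𝒳 𝒵 φ φhat p x) {ε : ℝ} (hε : 0 < ε) :
    ∃ D S : ℕ → Ω → ℝ≥0∞, ErrorControl P M 𝒳 φ
      (fun N ω => φhat N (fun i => Xs i ω) (fun j => Zs j ω) x) p ε D S := by
  obtain ⟨q, hq1, hqm, hmeas, hlim⟩ := h
  set ψ : ℕ → Ω → ℝ≥0∞ := fun N ω => replacedSupPow 𝒳 𝒵 φ (φhat N) x p (p * q)
    (sample Xs Zs N (N₁ N) ω).1 (sample Xs Zs N (N₁ N) ω).2 with hψ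
  have hψm : ∀ N, AEMeasurable (ψ N) P := fun N =>
    (hmeas N).comp_measurable (measurable_sample hXs hZs N (N₁ N))
  have hlim' : Tendsto (fun N : ℕ => ((N : ℝ≥0∞) / (M N : ℝ≥0∞)) ^ p * ∫⁻ ω, ψ N ω ∂P)
      atTop (𝓝 0) := by
    refine hlim.congr fun N => ?_
    rw [lintegral_const_mul'' _ (hψm N)]
  have hpq : 0 < p * q := by positivity
  have hpq' : ((p * q : ℕ) : ℝ) ≠ 0 := by positivity
  have hmp : ((m * p : ℕ) : ℝ) ≠ 0 := by positivity
  have hle : ∀ N, ∀ᵐ ω ∂P, ∀ t ∈ 𝒳,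
      ‖φhat N (fun i => Xs i ω) (fun j => Zs j ω) x t - φ t‖ₑ
        ≤ ψ N ω ^ (1 / ((p * q : ℕ) : ℝ)) := by
    intro N
    filter_upwards [hZ] with ω hω t ht
    refine (enorm_sub_le_supDist ht).trans ?_
    have h1 := supDist_pow_le_replacedSupPow (p := p) (𝒳 := 𝒳) (φ := φ) (x := x)
      (ψ := φhat N) (r := p * q) (xs := fun i => Xs i ω) (z := fun j => Zs j ω) hω
    calc _ = (supDist 𝒳 (φhat N (fun i => Xs i ω) (fun j => Zs j ω) x) φ ^ (p * q))
          ^ (1 / ((p * q : ℕ) : ℝ)) := by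
          rw [← ENNReal.rpow_natCast, ← ENNReal.rpow_mul, mul_one_div_cancel hpq',
            ENNReal.rpow_one]
      _ ≤ _ := ENNReal.rpow_le_rpow h1 (by positivity)
  -- ψ has the power p q of the error. The root of order m p in D turns E[D^{mp}] into a multiple of
  -- E[ψ]; the root of order p q in S recovers the sup norm, and its tail is bounded by Markov's
  -- inequality.
  refine ⟨fun N ω => ENNReal.ofReal (2 / ε) * ψ N ω ^ (1 / ((m * p : ℕ) : ℝ)),
    fun N ω => ψ N ω ^ (1 / ((p * q : ℕ) : ℝ)), ?_, ?_, ?_, ?_, ?_, hle⟩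
  · exact fun N => ((hψm N).pow_const _).const_mul _
  · exact fun N => (hψm N).pow_const _
  · have h1 := ENNReal.Tendsto.const_mul (a := ENNReal.ofReal (2 / ε) ^ (m * p)) hlim'
      (Or.inr (ENNReal.pow_ne_top ENNReal.ofReal_ne_top))
    rw [mul_zero] at h1
    refine h1.congr fun N => ?_
    have h2 : ∀ ω, (ENNReal.ofReal (2 / ε) * ψ N ω ^ (1 / ((m * p : ℕ) : ℝ))) ^ (m * p)
        = ENNReal.ofReal (2 / ε) ^ (m * p) * ψ N ω := by
      intro ω
      rw [mul_pow, ← ENNReal.rpow_natCast (_ ^ (1 / ((m * p : ℕ) : ℝ))), ← ENNReal.rpow_mul,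
        one_div_mul_cancel hmp, ENNReal.rpow_one]
    simp_rw [h2]
    rw [lintegral_const_mul'' _ (hψm N), mul_left_comm]
  · intro e he
    have hc : ENNReal.ofReal e ^ (p * q) ≠ 0 := pow_ne_zero _ (ENNReal.ofReal_pos.2 he).ne'
    have hc' : ENNReal.ofReal e ^ (p * q) ≠ ∞ := ENNReal.pow_ne_top ENNReal.ofReal_ne_top
    have h1 := ENNReal.Tendsto.mul_const (b := (ENNReal.ofReal e ^ (p * q))⁻¹) hlim'
      (Or.inr (ENNReal.inv_ne_top.2 hc))
    rw [zero_mul] at h1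
    refine tendsto_of_tendsto_of_tendsto_of_le_of_le tendsto_const_nhds h1
      (fun _ => zero_le) fun N => ?_
    have h2 : P {ω | ENNReal.ofReal e < ψ N ω ^ (1 / ((p * q : ℕ) : ℝ))}
        ≤ (∫⁻ ω, ψ N ω ∂P) / ENNReal.ofReal e ^ (p * q) := by
      refine (measure_mono fun ω hω => ?_).trans (meas_ge_le_lintegral_div (hψm N) hc hc')
      have h3 : ENNReal.ofReal e < ψ N ω ^ (1 / ((p * q : ℕ) : ℝ)) := hω
      calc ENNReal.ofReal e ^ (p * q) ≤ (ψ N ω ^ (1 / ((p * q : ℕ) : ℝ))) ^ (p * q) := by gcongr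
        _ = ψ N ω := by
          rw [← ENNReal.rpow_natCast, ← ENNReal.rpow_mul, one_div_mul_cancel hpq',
            ENNReal.rpow_one]
    calc _ ≤ ((N : ℝ≥0∞) / (M N : ℝ≥0∞)) ^ p *
          ((∫⁻ ω, ψ N ω ∂P) / ENNReal.ofReal e ^ (p * q)) := by gcongr
      _ = _ := by rw [div_eq_mul_inv (∫⁻ ω, ψ N ω ∂P), mul_assoc]
  · intro N
    -- S ≤ 1 gives ψ ≤ 1, so by q ≤ m the sup norm ψ^{1/(pq)} is at most ψ^{1/(mp)} = (ε/2) D <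
    -- (ε/2) T; an increment costs two such errors.
    filter_upwards [hle N] with ω hω hS s hs t ht T hT _
    have hψ1 : ψ N ω ≤ 1 := by
      by_contra hcon
      exact absurd hS (not_le.2 (ENNReal.one_lt_rpow (not_le.1 hcon) (by positivity)))
    have hroot : ψ N ω ^ (1 / ((p * q : ℕ) : ℝ)) ≤ ψ N ω ^ (1 / ((m * p : ℕ) : ℝ)) := by
      refine ENNReal.rpow_le_rpow_of_exponent_ge hψ1 ?_
      refine one_div_le_one_div_of_le (by positivity) ?_
      rw [mul_comm p q]
      exact_mod_cast Nat.mul_le_mul_right p hqm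
    have hT0 : 0 < T := ENNReal.ofReal_pos.1 (zero_le.trans_lt hT)
    have hsmall : ψ N ω ^ (1 / ((m * p : ℕ) : ℝ)) ≤ ENNReal.ofReal (ε / 2 * T) := by
      rw [ENNReal.ofReal_mul (by positivity)]
      calc _ = ENNReal.ofReal (ε / 2) * (ENNReal.ofReal (2 / ε) *
            ψ N ω ^ (1 / ((m * p : ℕ) : ℝ))) := by
            rw [← mul_assoc, ← ENNReal.ofReal_mul (by positivity)]
            have : ε / 2 * (2 / ε) = 1 := by field_simp
            rw [this, ENNReal.ofReal_one, one_mul]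
        _ ≤ _ := by gcongr
    have hpt : ∀ t ∈ 𝒳,
        ‖φhat N (fun i => Xs i ω) (fun j => Zs j ω) x t - φ t‖ ≤ ε / 2 * T := by
      intro t ht
      have := ((hω t ht).trans hroot).trans hsmall
      rwa [← ofReal_norm, ENNReal.ofReal_le_ofReal_iff (by positivity)] at this
    refine (norm_sub_le _ _).trans ?_
    linarith [hpt s hs, hpt t ht]

lemma replacedModulus_antitone {n k : ℕ} {ψ : TransformEstimator d m n k}
    {xs : Fin n → E d} {zs : Fin k → E d} :
    Antitone fun u => replacedModulus 𝒳 𝒵 φ ψ x p u xs zs := fun _ _ huv =>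
  iSup_mono fun _ => iSup_mono' fun h => ⟨huv.trans h, le_rfl⟩

lemma increment_le_of_replacedModulus_le {n k : ℕ} {ψ : TransformEstimator d m n k}
    {xs : Fin n → E d} {z : ℕ → E d} (hz : ∀ j, z j ∈ 𝒵) {u ε T : ℝ} (hu : 0 < u) (hε : 0 ≤ ε)
    (h : replacedModulus 𝒳 𝒵 φ ψ x p u xs (fun j => z j) ≤ ENNReal.ofReal ε) (huT : u ≤ T)
    {s t : E d} (hs : s ∈ 𝒳) (ht : t ∈ 𝒳) (hst : ‖φ s - φ t‖ ≤ T) :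
    ‖(ψ xs (fun j => z j) x s - φ s) - (ψ xs (fun j => z j) x t - φ t)‖ ≤ ε * T := by
  have hT : 0 < T := hu.trans_le huT
  have h1 : ENNReal.ofReal T⁻¹ *
      ‖(ψ xs (fun j => z j) x s - φ s) - (ψ xs (fun j => z j) x t - φ t)‖ₑ ≤ ENNReal.ofReal ε := by
    refine le_trans ?_ h
    unfold replacedModulus
    refine le_trans ?_ (le_iSup₂ T huT)
    gcongr
    refine le_trans ?_ (le_iSup₂ s hs)
    refine le_trans ?_ (le_iSup₂ t ht)
    refine le_trans ?_ (le_iSup _ hst)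
    refine le_trans ?_ (le_iSup₂ (fun i : Fin p => z i) (fun i : Fin p => hz i))
    rw [replaceFirst_self]
  rw [← ofReal_norm, ← ENNReal.ofReal_mul (by positivity),
    ENNReal.ofReal_le_ofReal_iff hε, inv_mul_le_iff₀ hT] at h1
  linarith

/-- The infimum of the positive rational arguments at which a family of numbers is at most `e`. -/
noncomputable def firstBelow (F : ℝ → ℝ≥0∞) (e : ℝ≥0∞) : ℝ≥0∞ :=
  ⨅ q : {q : ℚ // 0 < q}, if F (q : ℚ) ≤ e then ENNReal.ofReal (q : ℚ) else ∞

lemma exists_of_firstBelow_lt {F : ℝ → ℝ≥0∞} {e : ℝ≥0∞} {T : ℝ}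
    (h : firstBelow F e < ENNReal.ofReal T) : ∃ u : ℝ, 0 < u ∧ u ≤ T ∧ F u ≤ e := by
  obtain ⟨⟨q, hq⟩, hlt⟩ := iInf_lt_iff.1 h
  split_ifs at hlt with hF
  · have hq' : (0 : ℝ) < q := by exact_mod_cast hq
    exact ⟨q, hq', ((ENNReal.ofReal_lt_ofReal_iff_of_nonneg hq'.le).1 hlt).le, hF⟩
  · exact absurd hlt not_top_lt

/-- A rational just above u also qualifies, by monotonicity, so taking the infimum over rationals
loses nothing. -/
lemma firstBelow_le {F : ℝ → ℝ≥0∞} (hF : Antitone F) {e : ℝ≥0∞} {u : ℝ} (hu : 0 < u)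
    (h : F u ≤ e) : firstBelow F e ≤ ENNReal.ofReal u := by
  refine le_of_forall_gt_imp_ge_of_dense fun a ha => ?_
  by_cases hatop : a = ∞
  · rw [hatop]; exact le_top
  rw [← ENNReal.ofReal_toReal hatop] at ha ⊢
  obtain ⟨q, hq1, hq2⟩ := exists_rat_btwn ((ENNReal.ofReal_lt_ofReal_iff_of_nonneg hu.le).1 ha)
  have hq0 : (0 : ℚ) < q := by exact_mod_cast hu.trans hq1
  refine (iInf_le _ ⟨q, hq0⟩).trans ?_
  rw [if_pos ((hF hq1.le).trans h)]
  exact ENNReal.ofReal_le_ofReal hq2.le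

/-- The infimum is countable, so measurability at each fixed scale suffices. -/
lemma aemeasurable_firstBelow {F : Ω → ℝ → ℝ≥0∞} (hF : ∀ u, 0 < u → AEMeasurable (F · u) P)
    (e : ℝ≥0∞) : AEMeasurable (fun ω => firstBelow (F ω) e) P := by
  refine AEMeasurable.iInf fun ⟨q, hq⟩ => ?_
  have hq' : (0 : ℝ) < q := by exact_mod_cast hq
  have h1 : Measurable fun a : ℝ≥0∞ => if a ≤ e then ENNReal.ofReal q else ∞ :=
    Measurable.ite measurableSet_Iic measurable_const measurable_const
  exact h1.comp_aemeasurable (hF q hq')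

/-- A bound of a moment by an integral of bounds of the tail probabilities. -/
lemma lintegral_pow_le_of_tail_le (hm : 1 ≤ m) (hp : 0 < p) {D : Ω → ℝ≥0∞}
    (hD : AEMeasurable D P) {T : ℝ → ℝ≥0∞}
    (hT : ∀ u, 0 < u → P {ω | ENNReal.ofReal u < D ω} ≤ T u)
    (hfin : ∫⁻ u in Set.Ioi (0 : ℝ), ENNReal.ofReal (u ^ (p - 1)) * T (u ^ (1 / (m : ℝ))) ≠ ∞) :
    ∫⁻ ω, D ω ^ (m * p) ∂P ≤ p *
      ∫⁻ u in Set.Ioi (0 : ℝ), ENNReal.ofReal (u ^ (p - 1)) * T (u ^ (1 / (m : ℝ))) := by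
  have hp' : (0 : ℝ) < p := by exact_mod_cast hp
  have hm' : (m : ℝ) ≠ 0 := by positivity
  -- Were D infinite with positive probability, T would be bounded below on (1, ∞) and the integral
  -- would diverge.
  have htop : ∀ᵐ ω ∂P, D ω ≠ ∞ := by
    rw [ae_iff]
    by_contra ha
    refine hfin (top_unique ?_)
    calc (∞ : ℝ≥0∞) = ∫⁻ _ in Set.Ioi (1 : ℝ), P {ω | ¬D ω ≠ ∞} := by
          rw [setLIntegral_const, Real.volume_Ioi, ENNReal.mul_top ha]
      _ ≤ ∫⁻ u in Set.Ioi (1 : ℝ), ENNReal.ofReal (u ^ (p - 1)) * T (u ^ (1 / (m : ℝ))) := by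
          refine setLIntegral_mono' measurableSet_Ioi fun u hu => ?_
          have hu1 : (1 : ℝ) < u := hu
          have h1 : P {ω | ¬D ω ≠ ∞} ≤ T (u ^ (1 / (m : ℝ))) := by
            refine (measure_mono fun ω hω => ?_).trans (hT _ (by positivity))
            have : D ω = ∞ := not_not.1 hω
            rw [Set.mem_ofPred_eq, this]
            exact ENNReal.ofReal_lt_top
          calc _ = 1 * P {ω | ¬D ω ≠ ∞} := (one_mul _).symm
            _ ≤ _ := by
              gcongr
              rw [ENNReal.one_le_ofReal]
              exact one_le_pow₀ hu1.le
      _ ≤ _ := lintegral_mono_set (Set.Ioi_subset_Ioi zero_le_one)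
  -- Layer-cake formula for the p-th moment of D^m, whose tail at u is the tail of D at u^{1/m}.
  set f : Ω → ℝ := fun ω => (D ω ^ m).toReal with hf
  have h1 := lintegral_rpow_eq_lintegral_meas_lt_mul P (f := f)
    (Eventually.of_forall fun ω => ENNReal.toReal_nonneg) (hD.pow_const m).ennreal_toReal hp'
  have h2 : ∫⁻ ω, D ω ^ (m * p) ∂P = ∫⁻ ω, ENNReal.ofReal (f ω ^ (p : ℝ)) ∂P := by
    refine lintegral_congr_ae ?_
    filter_upwards [htop] with ω hω
    rw [Real.rpow_natCast, ENNReal.ofReal_pow ENNReal.toReal_nonneg,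
      ENNReal.ofReal_toReal (ENNReal.pow_ne_top hω), pow_mul]
  rw [h2, h1, ENNReal.ofReal_natCast]
  refine mul_le_mul_right ?_ _
  refine setLIntegral_mono' measurableSet_Ioi fun u hu => ?_
  have hu0 : (0 : ℝ) < u := hu
  rw [mul_comm]
  refine mul_le_mul' (le_of_eq ?_) ?_
  · rw [← Real.rpow_natCast, Nat.cast_sub hp, Nat.cast_one]
  · refine (measure_mono fun ω hω => ?_).trans (hT _ (by positivity))
    have h3 : u < (D ω ^ m).toReal := hω
    rw [Set.mem_ofPred_eq]
    by_contra hcon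
    rw [not_lt] at hcon
    have h4 : D ω ^ m ≤ ENNReal.ofReal u := by
      calc D ω ^ m ≤ ENNReal.ofReal (u ^ (1 / (m : ℝ))) ^ m := by gcongr
        _ = ENNReal.ofReal u := by
          rw [← ENNReal.ofReal_pow (by positivity), ← Real.rpow_natCast, ← Real.rpow_mul hu0.le,
            one_div_mul_cancel hm', Real.rpow_one]
    exact absurd (ENNReal.toReal_le_of_le_ofReal hu0.le h4) (not_le.2 h3)

/-- The condition on the modulus of continuity controls the errors of the estimated
transformations. -/
lemma ModulusCondition.errorControl (hm : 1 ≤ m) (hp : 0 < p)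
    (hXs : ∀ i, Measurable (Xs i)) (hZs : ∀ j, Measurable (Zs j))
    (hZ : ∀ᵐ ω ∂P, ∀ j, Zs j ω ∈ 𝒵) (hpos : ∀ᶠ N in atTop, 0 < N ∧ 0 < M N ∧ 0 < N₁ N)
    (h : ModulusCondition P Xs Zs M N₁ 𝒳 𝒵 φ φhat p x) {ε : ℝ} (hε : 0 < ε) :
    ∃ D S : ℕ → Ω → ℝ≥0∞, ErrorControl P M 𝒳 φ
      (fun N ω => φhat N (fun i => Xs i ω) (fun j => Zs j ω) x) p ε D S := by
  obtain ⟨hmeas, hcond⟩ := h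
  set F : ℕ → Ω → ℝ → ℝ≥0∞ := fun N ω u => replacedModulus 𝒳 𝒵 φ (φhat N) x p u
    (sample Xs Zs N (N₁ N) ω).1 (sample Xs Zs N (N₁ N) ω).2 with hF
  have hsm := measurable_sample hXs hZs
  have hD : ∀ N, AEMeasurable (fun ω => firstBelow (F N ω) (ENNReal.ofReal ε)) P := fun N =>
    aemeasurable_firstBelow (fun u hu => ((hmeas N).1 u hu).comp_measurable (hsm N (N₁ N))) _
  refine ⟨fun N ω => firstBelow (F N ω) (ENNReal.ofReal ε),
    fun N ω => supDist 𝒳 (φhat N (fun i => Xs i ω) (fun j => Zs j ω) x) φ, hD, ?_, ?_, ?_, ?_, ?_⟩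
  · exact fun N => (hmeas N).2.comp_measurable (hsm N (N₁ N))
  · obtain ⟨T, hT, hTlim, -⟩ := hcond ε hε
    have hlim := hTlim p hp le_rfl
    have h1 := ENNReal.Tendsto.const_mul (a := (p : ℝ≥0∞)) hlim
      (Or.inr (ENNReal.natCast_ne_top p))
    rw [mul_zero] at h1
    refine tendsto_of_tendsto_of_tendsto_of_le_of_le' tendsto_const_nhds h1
      (Eventually.of_forall fun _ => zero_le) ?_
    filter_upwards [hpos, hlim.eventually_lt_const ENNReal.zero_lt_top] with N hN hlt
    have hratio : ((N : ℝ≥0∞) / (M N : ℝ≥0∞)) ^ p ≠ 0 := by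
      refine pow_ne_zero _ (ENNReal.div_ne_zero.2 ⟨?_, ENNReal.natCast_ne_top _⟩)
      exact_mod_cast hN.1.ne'
    -- The scaled integral is eventually below ∞ and the factor N/M is nonzero, so the integral
    -- itself is finite.
    have hfin : ∫⁻ u in Set.Ioi (0 : ℝ), ENNReal.ofReal (u ^ (p - 1)) *
        T N (u ^ (1 / (m : ℝ))) ≠ ∞ := by
      intro h0
      rw [h0, ENNReal.mul_top hratio] at hlt
      exact lt_irrefl _ hlt
    rw [mul_left_comm]
    gcongr
    refine lintegral_pow_le_of_tail_le hm hp (hD N) (fun u hu => ?_) hfin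
    -- If D exceeds u, the modulus at u exceeds ε.
    refine (measure_mono fun ω hω => ?_).trans (hT N u hu)
    by_contra hcon
    exact absurd hω (not_lt.2 (firstBelow_le replacedModulus_antitone hu (not_lt.1 hcon)))
  · intro e he
    obtain ⟨T, -, -, hTtail⟩ := hcond e he
    exact hTtail
  · intro N
    filter_upwards [hZ] with ω hω _ s hs t ht T hT hst
    obtain ⟨u, hu0, huT, hu⟩ := exists_of_firstBelow_lt hT
    exact increment_le_of_replacedModulus_le hω hu0 hε.le hu huT hs ht hst
  · exact fun N => Eventually.of_forall fun ω t ht => enorm_sub_le_supDist ht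

end Conditions

/-! ### Radii, joint law and measurability for the given samples -/

section Sample

variable {Ω : Type*} [MeasurableSpace Ω] {d m : ℕ} {P : Measure Ω} {Xs Zs : ℕ → Ω → E d}

/-- The radius is the explicit solution of N κ ρ^m V = M. It tends to 0 because M/N does, log N
being eventually at least 1. -/
lemma exists_matchingRegime (hm : 1 ≤ m) {κ : ℝ} (hκ : 0 < κ) {M N₁ : ℕ → ℕ}
    (hM_log : Tendsto (fun N : ℕ => (M N : ℝ) * Real.log N / N) atTop (𝓝 0))
    (hMN₁ : Tendsto (fun N : ℕ => (M N : ℝ) * (N₁ N : ℝ) / N) atTop atTop)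
    (hM : Tendsto M atTop atTop) : ∃ ρ, MatchingRegime m κ M N₁ ρ := by
  have hV := unitBallVolume_pos m
  have hm0 : (m : ℝ) ≠ 0 := by positivity
  have hfrac : Tendsto (fun N : ℕ => (M N : ℝ) / N) atTop (𝓝 0) := by
    refine tendsto_of_tendsto_of_tendsto_of_le_of_le' tendsto_const_nhds hM_log
      (Eventually.of_forall fun N => by positivity) ?_
    filter_upwards [(Real.tendsto_log_atTop.comp
      tendsto_natCast_atTop_atTop).eventually_ge_atTop 1] with N hN
    gcongr
    exact le_mul_of_one_le_right (by positivity) hN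
  refine ⟨fun N => ((M N : ℝ) / N / (κ * unitBallVolume m)) ^ (1 / (m : ℝ)),
    hm, hκ, hfrac, hMN₁, hM, fun N => by positivity, ?_, ?_⟩
  · have h1 := (hfrac.div_const (κ * unitBallVolume m)).rpow_const (p := 1 / (m : ℝ))
      (Or.inr (by positivity))
    rwa [zero_div, Real.zero_rpow (by positivity)] at h1
  · filter_upwards [eventually_gt_atTop 0] with N hN
    have hN' : (0 : ℝ) < N := by exact_mod_cast hN
    rw [← Real.rpow_natCast, ← Real.rpow_mul (by positivity), one_div_mul_cancel hm0,
      Real.rpow_one]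
    field_simp

/-- The joint law of the images of two independent samples. -/
lemma measurePreserving_sample [IsProbabilityMeasure P]
    (hXs : ∀ i, Measurable (Xs i)) (hZs : ∀ j, Measurable (Zs j))
    {X Z : Ω → E d} (hXs_copy : ∀ i, IdentDistrib (Xs i) X P P)
    (hZs_copy : ∀ j, IdentDistrib (Zs j) Z P P) (hindep : iIndepFun (Sum.elim Xs Zs) P)
    {φ : E d → E m} (hφ : Measurable φ) (N k : ℕ) :
    MeasurePreserving (fun ω => ((fun i : Fin N => φ (Xs i ω)), (fun j : Fin k => φ (Zs j ω)))) P
      ((Measure.pi fun _ : Fin N => P.map (fun ω => φ (X ω))).prod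
        (Measure.pi fun _ : Fin k => P.map (fun ω => φ (Z ω)))) := by
  -- Both samples form one independent family over the disjoint sum of the index sets; its product
  -- law is then split along the sum.
  set f : Fin N ⊕ Fin k → Ω → E m := fun i ω =>
    φ (Sum.elim Xs Zs (Sum.map Fin.val Fin.val i) ω) with hf
  have hfm : ∀ i, Measurable (f i) := by
    rintro (i | j)
    · exact hφ.comp (hXs i)
    · exact hφ.comp (hZs j)
  have hind : iIndepFun f P :=
    (hindep.precomp (Fin.val_injective.sumMap Fin.val_injective)).comp (fun _ => φ) fun _ => hφ
  have hmap := (iIndepFun_iff_map_fun_eq_pi_map fun i => (hfm i).aemeasurable).1 hind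
  have hprob : ∀ i, IsProbabilityMeasure (P.map (f i)) := fun i =>
    Measure.isProbabilityMeasure_map (hfm i).aemeasurable
  have h1 : MeasurePreserving (fun ω i => f i ω) P (Measure.pi fun i => P.map (f i)) :=
    ⟨measurable_pi_lambda _ hfm, hmap⟩
  have h2 := (measurePreserving_sumPiEquivProdPi fun i => P.map (f i)).comp h1
  have hX : ∀ i : Fin N, P.map (f (Sum.inl i)) = P.map (fun ω => φ (X ω)) := fun i =>
    ((hXs_copy i).comp hφ).map_eq
  have hZ : ∀ j : Fin k, P.map (f (Sum.inr j)) = P.map (fun ω => φ (Z ω)) := fun j =>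
    ((hZs_copy j).comp hφ).map_eq
  simp_rw [hX, hZ] at h2
  exact h2

lemma ae_forall_mem_support (hXs : ∀ i, Measurable (Xs i)) {X : Ω → E d}
    (hXs_copy : ∀ i, IdentDistrib (Xs i) X P P) :
    ∀ᵐ ω ∂P, ∀ i, Xs i ω ∈ (P.map X).support := by
  refine ae_all_iff.2 fun i => ?_
  have h : ∀ᵐ y ∂(P.map X), y ∈ (P.map X).support := Measure.support_mem_ae
  rw [← (hXs_copy i).map_eq] at h ⊢
  exact ae_of_ae_map (hXs i).aemeasurable h

lemma measurable_ratioEstimate (hXs : ∀ i, Measurable (Xs i)) (hZs : ∀ j, Measurable (Zs j))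
    {𝒵 : Set (E d)} (h𝒵 : MeasurableSet 𝒵) {N k : ℕ} (M : ℕ) {ψ : TransformEstimator d m N k}
    {x : E d} (hψ : Measurable
      (fun s : ((Fin N → E d) × (Fin k → E d)) × E d => ψ s.1.1 s.1.2 x s.2)) :
    Measurable fun ω => ratioEstimate 𝒵 M (fun i : Fin N => Xs i ω) (fun j : Fin k => Zs j ω)
      (ψ (fun i => Xs i ω) (fun j => Zs j ω) x) x := by
  have hg : ∀ {Y : Ω → E d}, Measurable Y →
      Measurable fun ω => ψ (fun i => Xs i ω) (fun j => Zs j ω) x (Y ω) := fun hY =>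
    hψ.comp ((measurable_sample hXs hZs N k).prodMk hY)
  unfold ratioEstimate matchCount
  refine ((Finset.measurable_sum _ fun j _ => ?_).div_const _).const_mul _
  have hset : MeasurableSet {ω | Zs j ω ∈ catchment 𝒵 M (fun i : Fin N => Xs i ω)
      (ψ (fun i => Xs i ω) (fun j => Zs j ω) x) x} := by
    refine (hZs j h𝒵).inter (measurableSet_le ((hg measurable_const).sub (hg (hZs j))).norm ?_)
    exact (measurable_orderStat M).comp
      (measurable_pi_lambda _ fun i => ((hg (hXs i)).sub (hg (hZs j))).norm)
  exact Measurable.indicator (measurable_const (a := (1 : ℝ))) hset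

end Sample

end DensityRatio

/-! ### The corollary -/

theorem mainTheorem10
    {Ω : Type*} [MeasurableSpace Ω] (P : Measure Ω) [IsProbabilityMeasure P]
    (d m : ℕ) (hm : 1 ≤ m)
    -- the two random vectors, and their samples: independent copies, mutually independent
    (X Z : Ω → DensityRatio.E d) (hX : Measurable X) (hZ : Measurable Z)
    (Xs Zs : ℕ → Ω → DensityRatio.E d)
    (hXs : ∀ i, Measurable (Xs i)) (hZs : ∀ j, Measurable (Zs j))
    (hXs_copy : ∀ i, IdentDistrib (Xs i) X P P) (hZs_copy : ∀ j, IdentDistrib (Zs j) Z P P)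
    (hindep : iIndepFun (Sum.elim Xs Zs) P)
    -- the supports of the two random vectors
    (𝒳 𝒵 : Set (DensityRatio.E d))
    (h𝒳 : 𝒳 = (P.map X).support) (h𝒵 : 𝒵 = (P.map Z).support) (h𝒵𝒳 : 𝒵 ⊆ 𝒳)
    -- the transformation, the densities of the transformed vectors, and their ratio
    (φ : DensityRatio.E d → DensityRatio.E m) (hφ : Measurable φ)
    (f₀ f₁ r : DensityRatio.E m → ℝ)
    (hf₀ : Measurable f₀) (hf₁ : Measurable f₁)
    (hf₀_nonneg : ∀ y, 0 ≤ f₀ y) (hf₁_nonneg : ∀ y, 0 ≤ f₁ y)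
    (hν₀ : P.map (fun ω => φ (X ω)) = volume.withDensity (fun y => ENNReal.ofReal (f₀ y)))
    (hν₁ : P.map (fun ω => φ (Z ω)) = volume.withDensity (fun y => ENNReal.ofReal (f₁ y)))
    (hac : P.map (fun ω => φ (Z ω)) ≪ P.map (fun ω => φ (X ω)))
    (hr : ∀ y, r y = f₁ y / f₀ y)
    -- the number of matches and the second sample size, as functions of the first sample size
    (M N₁ : ℕ → ℕ)
    (hM_log : Tendsto (fun N : ℕ => (M N : ℝ) * Real.log N / N) atTop (𝓝 0))
    (hMN₁ : Tendsto (fun N : ℕ => (M N : ℝ) * (N₁ N : ℝ) / N) atTop atTop)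
    (hM : Tendsto M atTop atTop)
    -- the estimators of the transformation
    (φhat : ∀ N : ℕ, DensityRatio.TransformEstimator d m N (N₁ N))
    (hφhat : ∀ N x, Measurable
      (fun s : ((Fin N → DensityRatio.E d) × (Fin (N₁ N) → DensityRatio.E d)) ×
        DensityRatio.E d => φhat N s.1.1 s.1.2 x s.2))
    (p : ℕ) (hp : 0 < p) (hp_even : Even p) :
    ∀ x ∈ 𝒳,
      (DensityRatio.SupNormCondition P Xs Zs M N₁ 𝒳 𝒵 φ φhat p x ∨
        DensityRatio.ModulusCondition P Xs Zs M N₁ 𝒳 𝒵 φ φhat p x) →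
      0 < f₀ (φ x) → ContinuousAt f₀ (φ x) → ContinuousAt f₁ (φ x) →
      (∀ N : ℕ, Integrable (fun ω =>
        |DensityRatio.ratioEstimate 𝒵 (M N) (fun i : Fin N => Xs i ω)
            (fun j : Fin (N₁ N) => Zs j ω)
            (φhat N (fun i => Xs i ω) (fun j => Zs j ω) x) x - r (φ x)| ^ p) P) ∧
      Tendsto (fun N : ℕ => ∫ ω,
        |DensityRatio.ratioEstimate 𝒵 (M N) (fun i : Fin N => Xs i ω)
            (fun j : Fin (N₁ N) => Zs j ω)
            (φhat N (fun i => Xs i ω) (fun j => Zs j ω) x) x - r (φ x)| ^ p ∂P)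
        atTop (𝓝 0) := by
  open DensityRatio in
  intro x hx hcond hpos hc₀ hc₁
  have hprob₀ : IsProbabilityMeasure (P.map (fun ω => φ (X ω))) :=
    Measure.isProbabilityMeasure_map (hφ.comp hX).aemeasurable
  have hprob₁ : IsProbabilityMeasure (P.map (fun ω => φ (Z ω))) :=
    Measure.isProbabilityMeasure_map (hφ.comp hZ).aemeasurable
  obtain ⟨ρ, hreg⟩ := exists_matchingRegime hm hpos hM_log hMN₁ hM
  have hXmem : ∀ᵐ ω ∂P, ∀ i, Xs i ω ∈ 𝒳 := by
    rw [h𝒳]; exact ae_forall_mem_support hXs hXs_copy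
  have hZmem : ∀ᵐ ω ∂P, ∀ j, Zs j ω ∈ 𝒵 := by
    rw [h𝒵]; exact ae_forall_mem_support hZs hZs_copy
  have h𝒵m : MeasurableSet 𝒵 := by
    rw [h𝒵]; exact Measure.isClosed_support.measurableSet
  have hlim := tendsto_lintegral_ratioEstimate (P := P) (Xs := Xs) (Zs := Zs)
    (g := fun N ω => φhat N (fun i => Xs i ω) (fun j => Zs j ω) x) hreg hf₀ hν₀ hf₁ hf₁_nonneg hν₁
    hc₀ hc₁ (fun N => measurePreserving_sample hXs hZs hXs_copy hZs_copy hindep hφ N (N₁ N))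
    hx hXmem hZmem h𝒵𝒳 hp hp_even (fun ε hε => by
      rcases hcond with h | h
      · exact h.errorControl hm hp hXs hZs hZmem hε
      · exact h.errorControl hm hp hXs hZs hZmem hreg.eventually_pos hε)
  simp_rw [← hr] at hlim
  have hmeas : ∀ N, Measurable fun ω => |ratioEstimate 𝒵 (M N) (fun i : Fin N => Xs i ω)
      (fun j : Fin (N₁ N) => Zs j ω) (φhat N (fun i => Xs i ω) (fun j => Zs j ω) x) x
        - r (φ x)| ^ p := fun N =>
    ((measurable_ratioEstimate hXs hZs h𝒵m (M N) (hφhat N x)).sub_const _).abs.pow_const p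
  refine ⟨fun N => ?_, ?_⟩
  -- For every N the estimate lies between 0 and N/M, also when a sample size or M is 0, where
  -- division by zero gives 0.
  · refine Integrable.of_bound (hmeas N).aestronglyMeasurable (((N : ℝ) / M N + |r (φ x)|) ^ p)
      (Eventually.of_forall fun ω => ?_)
    rw [Real.norm_of_nonneg (by positivity)]
    gcongr
    refine (abs_sub _ _).trans (add_le_add_left ?_ _)
    rw [abs_of_nonneg ratioEstimate_nonneg]
    exact ratioEstimate_le
  · have h1 := (ENNReal.tendsto_toReal ENNReal.zero_ne_top).comp hlim
    rw [ENNReal.toReal_zero] at h1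
    refine h1.congr fun N => ?_
    rw [integral_eq_lintegral_of_nonneg_ae (Eventually.of_forall fun ω => by positivity)
      (hmeas N).aestronglyMeasurable, Function.comp_apply]
    simp_rw [ENNReal.ofReal_pow (abs_nonneg _)]
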